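/- Let $\hbar=1$, $N,d\ge 1$, $L,m>0$, and let $\Lambda=[0,L]^d$ with periodic boundary conditions, of volume $V=L^d$. Let $w:\Lambda\to\mathbb R$ be periodic, continuous and even, and let $u:\Lambda\to\mathbb R$ be periodic and continuously differentiable. Let $\mathcal H$ be the closed subspace of $L^2(\Lambda^N)$ of wave functions of a given statistics, i.e. $\psi(\mathbf x_{\sigma 1},\dots,\mathbf x_{\sigma N})=\chi(\sigma)\psi(\mathbf x_1,\dots,\mathbf x_N)$ for all $\sigma$ in a subgroup $G$ of the permutation group $S_N$, where $\chi:G\to\{\pm1\}$ is a character ($G=S_N$ with $\chi=1$ for bosons, $G=S_N$ with $\chi=\mathrm{sgn}$ for fermions, $G$ trivial for distinguishable particles). On $\mathcal H$ let $$H_0=\sum_{j=1}^N\sum_{\mu=1}^d\frac{(p_j^\mu)^2}{2m}+\sum_{j<l}w(\mathbf x_j-\mathbf x_l),\qquad U=\sum_{j=1}^N u(\mathbf x_j),\qquad P_\mu=\sum_{j=1}^N p_j^\mu,$$ where $p_j^\mu=-i\,\partial/\partial x_j^\mu$ with periodic boundary conditions. Fix one axis, called the $d$-th, and put $U_d=\sum_j(\partial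 u/\partial x^d)(\mathbf x_j)$. Let $E(\kappa,v)$ be the ground state energy (the infimum of $\langle\psi,H\psi\rangle$ over unit vectors $\psi$ in the domain) of $H(\kappa,v)=H_0+\kappa U-vP_d$. Assume that the ground state of $H_0$ is unique up to scalar multiples. Then: 1. For all real $\kappa$ in a neighbourhood of $0$, the function $v\mapsto E(\kappa,v)$ is real analytic at $0$, and $E(\kappa,v)=E(\kappa,0)+c_2(\kappa)v^2+O(v^4)$ as $v\to0$, where $c_2(\kappa)=\tfrac12\,\partial_v^2E(\kappa,v)|_{v=0}$. Define the superfluid fraction by $\rho_s(\kappa)/\rho=1+\frac{2}{Nm}c_2(\kappa)$. 2. The terms of order $\kappa^0$ and $\kappa^1$ of $c_2$ vanish: $c_2(0)=0$ and $c_2'(0)=0$. 3. $\mathcal H$ has an orthonormal basis $(\Omega_n)_{n\ge0}$ of simultaneous eigenvectors of $H_0$ and $P_1,\dots,P_d$, in which $\Omega_0$ is a ground state of $H_0$. 4. For every orthonormal basis $(\Omega_n)_{n\ge0}$ of $\mathcal H$ with $H_0\Omega_n=E_n\Omega_n$ and $E_0=E(0,0)$, the series below converges, and as $\kappa\to0$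 $$\frac{\rho_s(\kappa)}{\rho}=1-\frac{2\kappa^2}{Nm}\sum_{n=1}^\infty\frac{|\langle\Omega_n,U_d\Omega_0\rangle|^2}{(E_n-E_0)^3}+O(\kappa^3).$$ 5. Suppose in addition that $P_\mu\Omega_n=k_\mu(n)\Omega_n$ for all $n$ and $\mu$, with $\mathbf k(n)\in\frac{2\pi}{L}\mathbb Z^d$. Let $\tilde u(\mathbf k)=\int_\Lambda u(\mathbf x)e^{-i\mathbf k\cdot\mathbf x}d\mathbf x$ and $\rho_{\mathbf k}=\sum_je^{-i\mathbf k\cdot\mathbf x_j}$, and let the dynamic structure factor be the measure $$S(\mathbf k,\omega)\,d\omega=\sum_{n:\,\mathbf k(n)=\mathbf k}|\langle\Omega_n,\rho_{-\mathbf k}\Omega_0\rangle|^2\,\delta(\omega-(E_n-E_0))\,d\omega .$$ Then, for each $\mathbf k\in\frac{2\pi}{L}\mathbb Z^d$, $\omega^{-3}$ is integrable over $(0,\infty)$ with respect to $S(\mathbf k,\omega)\,d\omega$; the sum over $\mathbf k$ below converges; $$\sum_{n=1}^\infty\frac{|\langle\Omega_n,U_d\Omega_0\rangle|^2}{(E_n-E_0)^3}=\sum_{\mathbf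 k\in\frac{2\pi}{L}\mathbb Z^d}\Big(\frac{k_d|\tilde u(\mathbf k)|}{V}\Big)^2\int_{(0,\infty)}\frac{S(\mathbf k,\omega)}{\omega^3}\,d\omega ;$$ and consequently, as $\kappa\to0$, $$\frac{\rho_s(\kappa)}{\rho}=1-\frac{2\kappa^2}{Nm}\sum_{\mathbf k}\Big(\frac{k_d|\tilde u(\mathbf k)|}{V}\Big)^2\int_{(0,\infty)}\frac{S(\mathbf k,\omega)}{\omega^3}\,d\omega+O(\kappa^3).$$ -/

import Mathlib

open Filter Topology MeasureTheory Asymptotics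

noncomputable section

namespace Superfluid

/-- The box `[0, L]^d` with periodic boundary conditions, i.e. the torus `(ℝ / Lℤ)^d`. -/
abbrev Torus (d : ℕ) (L : ℝ) : Type := Fin d → AddCircle L

/-- Positions `x = (x_1, …, x_N)` of `N` particles in the periodic box. -/
abbrev Config (N d : ℕ) (L : ℝ) : Type := Fin N → Torus d L

/-- Square-integrable `N`-particle wave functions (with respect to Lebesgue measure on the box). -/
abbrev WaveFun (N d : ℕ) (L : ℝ) [Fact (0 < L)] : Type :=
  Lp ℂ 2 (volume : Measure (Config N d L))

/-- The data of a system of `N` particles (`ħ = 1`) in the periodic box `[0, L]^d`. -/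
structure System (N d : ℕ) (L : ℝ) where
  /-- the mass of a particle -/
  m : ℝ
  /-- the pair interaction, the potential energy being `∑_{j < l} w (x_j - x_l)` -/
  w : Torus d L → ℝ
  /-- the one-particle nonuniform potential, `U = ∑_j u (x_j)` -/
  u : Torus d L → ℝ
  /-- the axis along which the walls slide (the "`d`-th" axis) -/
  axis : Fin d
  /-- the group of exchanges of identical particles: everything for `N` identical particles,
  the trivial group for distinguishable particles -/
  G : Subgroup (Equiv.Perm (Fin N))
  /-- the statistics: the trivial character for bosons, the sign for fermions -/
  χ : G →* ℤˣ

section Operators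

variable {N d : ℕ} {L : ℝ}

/-- `e^{i k · y}` on the torus, for `k = (2π / L) n`. -/
def wave (n : Fin d → ℤ) (y : Torus d L) : ℂ := ∏ μ, fourier (n μ) (y μ)

/-- The plane wave `e^{i ∑_j k_j · x_j}` of `N` particles, for `k_j = (2π / L) n_j`. -/
def planeWave (n : Fin N → Fin d → ℤ) (x : Config N d L) : ℂ := ∏ j, wave (n j) (x j)

/-- The wave number `(2π / L) n`. -/
def waveNumber (L : ℝ) (n : ℤ) : ℝ := 2 * Real.pi / L * n

/-- The collective density mode `ρ_k = ∑_j e^{-i k · x_j}`, for `k = (2π / L) n`. -/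
def densityMode (n : Fin d → ℤ) (x : Config N d L) : ℂ := ∑ j, wave (-n) (x j)

/-- The partial derivative `∂f / ∂y^μ` of a function on the torus. -/
def partialDeriv (f : Torus d L → ℝ) (μ : Fin d) (y : Torus d L) : ℝ :=
  deriv (fun t : ℝ => f (y + Pi.single μ (t : AddCircle L))) 0

variable [Fact (0 < L)]

/-- The Fourier transform `∫ f(y) e^{-i k · y} dy` over the box, for `k = (2π / L) n`. -/
def fourierTransform (f : Torus d L → ℝ) (n : Fin d → ℤ) : ℂ :=
  ∫ y, (f y : ℂ) * wave (-n) y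

/-- The (unnormalised) Fourier coefficient `⟨e_n, ψ⟩` of a wave function. -/
def coeff (ψ : WaveFun N d L) (n : Fin N → Fin d → ℤ) : ℂ :=
  ∫ x, starRingEnd ℂ (planeWave n x) * ψ x

/-- `ψ` is in the domain of the self-adjoint momentum operator `P_μ = ∑_j p_j^μ` and
`P_μ ψ = φ`. Here `p_j^μ = -i ∂/∂x_j^μ` with periodic boundary conditions, which is multiplication
by `k_j^μ` on the Fourier side. -/
def IsMomentum (μ : Fin d) (ψ φ : WaveFun N d L) : Prop :=
  ∀ n, coeff φ n = ((∑ j, waveNumber L (n j μ) : ℝ) : ℂ) * coeff ψ n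

/-- `ψ` is in the domain of the self-adjoint kinetic energy `∑_j ∑_μ (p_j^μ)^2 / (2m)` and `φ` is
its image. -/
def IsKinetic (m : ℝ) (ψ φ : WaveFun N d L) : Prop :=
  ∀ n, coeff φ n = ((∑ j, ∑ μ, waveNumber L (n j μ) ^ 2 / (2 * m) : ℝ) : ℂ) * coeff ψ n

/-- The matrix element `⟨ψ, F φ⟩` of the operator of multiplication by `F`. -/
def matrixElement (F : Config N d L → ℂ) (ψ φ : WaveFun N d L) : ℂ :=
  ∫ x, starRingEnd ℂ (ψ x) * (F x * φ x)

/-- Exchange of particles preserves the measure on configurations. -/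
theorem measurePreserving_perm (σ : Equiv.Perm (Fin N)) :
    MeasurePreserving (fun x : Config N d L => fun j => x (σ j)) volume volume := by
  have h := volume_measurePreserving_piCongrLeft (fun _ : Fin N => Torus d L) σ.symm
  convert h using 1
  ext x j μ
  have := Equiv.piCongrLeft_apply_apply (fun _ : Fin N => Torus d L) σ.symm x (σ j)
  simp only [Equiv.symm_apply_apply] at this
  simp [MeasurableEquiv.coe_piCongrLeft, this]

/-- The unitary `(σ ψ)(x_1, …, x_N) = ψ (x_{σ 1}, …, x_{σ N})`. -/
def permute (σ : Equiv.Perm (Fin N)) : WaveFun N d L →ₗ[ℂ] WaveFun N d L :=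
  (Lp.compMeasurePreservingₗᵢ ℂ (fun x : Config N d L => fun j => x (σ j))
    (measurePreserving_perm σ)).toLinearMap

end Operators

namespace System

variable {N d : ℕ} {L : ℝ} (S : System N d L)

/-- The interaction energy `∑_{j < l} w (x_j - x_l)`. -/
def W (x : Config N d L) : ℝ := ∑ j, ∑ l ∈ Finset.Ioi j, S.w (x j - x l)

/-- The nonuniform potential `U = ∑_j u (x_j)`. -/
def U (x : Config N d L) : ℝ := ∑ j, S.u (x j)

/-- `U_d = ∑_j (∂u/∂x^d) (x_j)`. -/
def Ud (x : Config N d L) : ℝ := ∑ j, partialDeriv S.u S.axis (x j)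

variable [Fact (0 < L)]

/-- The Hilbert space of the system: wave functions of the given exchange statistics,
`ψ (x_{σ 1}, …, x_{σ N}) = χ(σ) ψ (x_1, …, x_N)` for all `σ ∈ G`. -/
def space : Submodule ℂ (WaveFun N d L) :=
  ⨅ σ : S.G, LinearMap.eqLocus (permute (σ : Equiv.Perm (Fin N)))
    ((((S.χ σ : ℤˣ) : ℤ) : ℂ) • LinearMap.id)

/-- `ψ` is in the domain of `H(κ, v) = H₀ + κ U - v P_d`, where
`H₀ = ∑_j ∑_μ (p_j^μ)^2 / (2m) + ∑_{j < l} w (x_j - x_l)`, and `H(κ, v) ψ = φ`. -/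
def IsHamiltonian (κ v : ℝ) (ψ φ : WaveFun N d L) : Prop :=
  ∃ τ π : WaveFun N d L, IsKinetic S.m ψ τ ∧ IsMomentum S.axis ψ π ∧
    ∀ᵐ x, φ x = τ x + ((S.W x + κ * S.U x : ℝ) : ℂ) * ψ x - (v : ℂ) * π x

/-- The ground state energy `E(κ, v)`: the infimum of `⟨ψ, H(κ, v) ψ⟩` over unit vectors in the
domain. -/
def energy (κ v : ℝ) : ℝ :=
  sInf {e : ℝ | ∃ ψ φ : WaveFun N d L, ψ ∈ S.space ∧ ‖ψ‖ = 1 ∧ S.IsHamiltonian κ v ψ φ ∧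
    e = (inner ℂ ψ φ).re}

/-- The ground state of `H₀` exists and is unique up to scalar multiples. -/
def UniqueGroundState : Prop :=
  ∃ Ω ∈ S.space, Ω ≠ 0 ∧ S.IsHamiltonian 0 0 Ω ((S.energy 0 0 : ℂ) • Ω) ∧
    ∀ ψ ∈ S.space, S.IsHamiltonian 0 0 ψ ((S.energy 0 0 : ℂ) • ψ) → ∃ c : ℂ, ψ = c • Ω

/-- The coefficient `c₂(κ)` of `v²` in the Taylor expansion of `v ↦ E(κ, v)` at `0`. -/
def c₂ (κ : ℝ) : ℝ := iteratedDeriv 2 (S.energy κ) 0 / 2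

/-- The superfluid fraction `ρ_s(κ) / ρ = 1 + 2 c₂(κ) / (N m)`. -/
def superfluidFraction (κ : ℝ) : ℝ := 1 + 2 / (N * S.m) * S.c₂ κ

/-- `Ω_0, Ω_1, …` is a complete orthonormal system of eigenvectors of `H₀`, with eigenvalues
`E_0, E_1, …`, and `E_0` is the ground state energy. -/
structure IsEigenbasis (Ω : HilbertBasis ℕ ℂ S.space) (E : ℕ → ℝ) : Prop where
  ground : E 0 = S.energy 0 0
  eigen : ∀ n, S.IsHamiltonian 0 0 (Ω n : WaveFun N d L) ((E n : ℂ) • (Ω n : WaveFun N d L))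

/-- In addition, each `Ω_n` is an eigenvector of the total momentum, with eigenvalue
`(2π / L) q_n`. -/
structure IsMomentumEigenbasis (Ω : HilbertBasis ℕ ℂ S.space) (E : ℕ → ℝ)
    (q : ℕ → Fin d → ℤ) : Prop extends S.IsEigenbasis Ω E where
  momentum : ∀ n μ, IsMomentum μ (Ω n : WaveFun N d L)
    ((waveNumber L (q n μ) : ℂ) • (Ω n : WaveFun N d L))

/-- The `n`-th term `|⟨Ω_n, U_d Ω_0⟩|² / (E_n - E_0)³`. -/
def expansionTerm (Ω : HilbertBasis ℕ ℂ S.space) (E : ℕ → ℝ) (n : ℕ) : ℝ :=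
  ‖matrixElement (fun x => (S.Ud x : ℂ)) (Ω n : WaveFun N d L) (Ω 0 : WaveFun N d L)‖ ^ 2 /
    (E n - E 0) ^ 3

/-- The dynamic structure factor `S(k, ω) dω` at `k = (2π / L) n`, a measure on the energy axis:
`∑ |⟨Ω_l, ρ_{-k} Ω_0⟩|² δ(ω - (E_l - E_0))` over all `l` such that `Ω_l` has momentum `k`. -/
def structureFactor (Ω : HilbertBasis ℕ ℂ S.space) (E : ℕ → ℝ) (q : ℕ → Fin d → ℤ)
    (n : Fin d → ℤ) : Measure ℝ :=
  Measure.sum fun l : {l : ℕ // q l = n} =>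
    ENNReal.ofReal (‖matrixElement (densityMode (-n)) (Ω l : WaveFun N d L)
      (Ω 0 : WaveFun N d L)‖ ^ 2) • Measure.dirac (E l - E 0)

/-- `(k_d |ũ(k)| / V)² ∫_0^∞ S(k, ω) / ω³ dω`, for `k = (2π / L) n` and `V = L^d`. -/
def fourierTerm (Ω : HilbertBasis ℕ ℂ S.space) (E : ℕ → ℝ) (q : ℕ → Fin d → ℤ)
    (n : Fin d → ℤ) : ℝ :=
  (waveNumber L (n S.axis) * ‖fourierTransform S.u n‖ / L ^ d) ^ 2 *
    ∫ ω in Set.Ioi (0 : ℝ), 1 / ω ^ 3 ∂(S.structureFactor Ω E q n)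

end System

end Superfluid

end

/-!
The proof is second order perturbation theory in the velocity around the ground state of `H₀ + κ U`,
followed by an expansion in `κ`. What makes it work is that `U` is bounded, that `P_d` is bounded
relative to `H₀` in the sense of quadratic forms, and that the ground state of `H₀` is simple,
isolated and of momentum zero.

*Perturbation theory.* Let `A = (H₀ - E₀ + |Ω_0⟩⟨Ω_0|)⁻¹` and `Q = P_d A`. Every vector of the domain
is `A y`, and `(H(κ, v) - E₀ - ε + |Ω_0⟩⟨Ω_0|) A` is the bounded operator
`M = 1 - ε A + κ U A - v Q`, invertible for small parameters. The number `E₀ + ε` is an eigenvalue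
of `H(κ, v)` when `⟨Ω_0, M⁻¹ Ω_0⟩ = 1`, and the implicit function theorem gives an analytic solution
`ε(κ, v)` (`GroundFamily.exists_branch`). It is the bottom of the spectrum since the form of `H(κ, v)`
is bounded below by `E₀ + ε` on the vectors `A w` with `w` orthogonal to `Ω_0`
(`GroundFamily.sInf_eq`). The energy is even in `v` by complex conjugation, so its odd Taylor
coefficients vanish. Comparing the eigenvalue equations at `v` and at `0` yields
`c₂(κ) ‖ψ‖² = - ⟨Q y, A M⁻¹ Q y⟩` for the ground state `ψ = A y` of `H₀ + κ U`
(`GroundFamily.second_order`). As `Q Ω_0 = 0` and `y = Ω_0 - κ U Ω_0 + ε Ω_0 + O(κ²)`, the right hand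
side is `- κ² ⟨Q U Ω_0, A Q U Ω_0⟩ + O(κ³)` (`GroundFamily.isBigO_second_order`).

*The system.* In the basis of plane waves the kinetic energy is diagonal with eigenvalues tending to
infinity, and the interaction is bounded; hence `H₀` has a compact resolvent
(`System.exists_resolvent`). It commutes with the projections onto the values of the total momentum,
because a two-body potential is a limit of sums of plane waves of total momentum zero. The spectral
theorem gives joint eigenvectors (`System.exists_isMomentumEigenbasis`); they are infinitely many,
since boosts `e^{i k · (x_1 + ⋯ + x_N)}` shift the momentum and preserve the statistics. Compactness
gives the gap, uniqueness of the ground state and complex conjugation give its momentum zero, and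
`k² ≤ 2 m N (E + ‖W‖)` together with the gap gives `|k| ≤ C (E - E₀)` for the excited states
(`System.IsMomentumEigenbasis.exists_gapCondition`). So `A` and `Q` are bounded diagonal operators in
this basis, and perturbation theory applies.

*The coefficient.* Between an eigenstate of momentum `k` and the ground state only the Fourier
component of a one-body potential at `k` contributes, by density of the plane waves
(`inner_mulOp_oneBody`), and `∂_d` acts on Fourier transforms as `i k_d`. Hence
`k_d ⟨Ω_n, U Ω_0⟩ = - i ⟨Ω_n, U_d Ω_0⟩`, so that `Q U Ω_0 = - i A U_d Ω_0`, and
`⟨Q U Ω_0, A Q U Ω_0⟩ = ⟨U_d Ω_0, A³ U_d Ω_0⟩`. The last expression makes no reference to the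
momentum and can be evaluated in any eigenbasis of `H₀`
(`System.IsMomentumEigenbasis.hasSum_expansionTerm`); sorting its terms by the momentum gives the sum
over the dynamic structure factor (`System.IsMomentumEigenbasis.hasSum_fourierTerm`).
-/

noncomputable section

namespace Superfluid

/-! ### Operators which are diagonal in a Hilbert basis -/

section Diagonal

variable {ι K : Type*} [NormedAddCommGroup K] [InnerProductSpace ℂ K]

theorem HilbertBasis.ext_inner (b : HilbertBasis ι ℂ K) {x y : K}
    (h : ∀ i, inner ℂ (b i) x = inner ℂ (b i) y) : x = y := by
  apply b.repr.injective
  ext i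
  simpa [b.repr_apply_apply] using h i

theorem norm_mul_repr_le (b : HilbertBasis ι ℂ K) {a : ι → ℂ} {C : ℝ} (h : ∀ i, ‖a i‖ ≤ C)
    (x : K) (i : ι) : ‖a i * b.repr x i‖ ≤ ‖b.repr ((C : ℂ) • x) i‖ := by
  have hC : ‖a i‖ ≤ |C| := (h i).trans (le_abs_self C)
  rw [map_smul, lp.coeFn_smul, Pi.smul_apply, norm_mul, norm_smul, Complex.norm_real,
    Real.norm_eq_abs]
  exact mul_le_mul_of_nonneg_right hC (norm_nonneg _)

/-- The bounded operator which is diagonal in the Hilbert basis `b`, with eigenvalues `a i`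
bounded by `C`. The sign of `C` is not constrained, as the index type may be empty. -/
def diag (b : HilbertBasis ι ℂ K) (a : ι → ℂ) (C : ℝ) (h : ∀ i, ‖a i‖ ≤ C) : K →L[ℂ] K :=
  LinearMap.mkContinuous
    { toFun := fun x => b.repr.symm ⟨fun i => a i * b.repr x i,
        (lp.memℓp (b.repr ((C : ℂ) • x))).mono' (norm_mul_repr_le b h x)⟩
      map_add' := fun x y => by
        apply b.repr.injective
        ext i
        simp only [LinearIsometryEquiv.apply_symm_apply, lp.coeFn_add, Pi.add_apply, map_add]
        exact mul_add _ _ _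
      map_smul' := fun c x => by
        apply b.repr.injective
        ext i
        simp only [RingHom.id_apply, LinearIsometryEquiv.apply_symm_apply, lp.coeFn_smul, Pi.smul_apply, map_smul,
          smul_eq_mul]
        exact mul_left_comm _ _ _ }
    |C| fun x => by
      change ‖b.repr.symm _‖ ≤ _
      rw [LinearIsometryEquiv.norm_map, ← Real.norm_eq_abs, ← Complex.norm_real, ← norm_smul,
        ← b.repr.norm_map ((C : ℂ) • x)]
      exact lp.norm_mono (p := 2) (by simp) (norm_mul_repr_le b h x)

variable {b : HilbertBasis ι ℂ K} {a : ι → ℂ} {C : ℝ} {h : ∀ i, ‖a i‖ ≤ C}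

@[simp] theorem inner_diag (i : ι) (x : K) :
    inner ℂ (b i) (diag b a C h x) = a i * inner ℂ (b i) x := by
  rw [← b.repr_apply_apply, ← b.repr_apply_apply]
  simp [diag]

theorem norm_diag_le (hC : 0 ≤ C) : ‖diag b a C h‖ ≤ C := by
  unfold diag
  exact (LinearMap.mkContinuous_norm_le _ (abs_nonneg C) _).trans_eq (abs_of_nonneg hC)

theorem diag_basis (i : ι) : diag b a C h (b i) = a i • b i := by
  apply HilbertBasis.ext_inner b
  intro j
  rw [inner_diag, inner_smul_right]
  by_cases hij : j = i
  · rw [hij]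
  · rw [b.orthonormal.2 hij, mul_zero, mul_zero]

/-- The matrix elements of a diagonal operator with real eigenvalues, as a sum over the basis. -/
theorem hasSum_inner_diag (r : ι → ℝ) (hr : ∀ i, ‖(r i : ℂ)‖ ≤ C) (x y : K) :
    HasSum (fun i => (r i : ℂ) * (starRingEnd ℂ (inner ℂ (b i) x) * inner ℂ (b i) y))
      (inner ℂ x (diag b (fun i => (r i : ℂ)) C hr y)) := by
  refine (b.hasSum_inner_mul_inner x (diag b (fun i => (r i : ℂ)) C hr y)).congr_fun fun i => ?_
  rw [inner_diag, inner_conj_symm]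
  ring

theorem hasSum_inner_diag_self (r : ι → ℝ) (hr : ∀ i, ‖(r i : ℂ)‖ ≤ C) (x : K) :
    HasSum (fun i => r i * ‖inner ℂ (b i) x‖ ^ 2)
      (inner ℂ x (diag b (fun i => (r i : ℂ)) C hr x)).re := by
  refine (Complex.hasSum_re (hasSum_inner_diag (b := b) r hr x x)).congr_fun fun i => ?_
  rw [Complex.conj_mul', ← Complex.ofReal_pow, ← Complex.ofReal_mul, Complex.ofReal_re]

theorem hasSum_norm_sq_inner (b : HilbertBasis ι ℂ K) (x : K) :
    HasSum (fun i => ‖inner ℂ (b i) x‖ ^ 2) (‖x‖ ^ 2) := by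
  have h := Complex.hasSum_re (b.hasSum_inner_mul_inner x x)
  rw [inner_self_eq_norm_sq_to_K] at h
  norm_cast at h
  refine h.congr_fun fun i => ?_
  rw [← inner_conj_symm x, Complex.conj_mul', ← Complex.ofReal_pow, Complex.ofReal_re]

theorem inner_diag_left (r : ι → ℝ) (hr : ∀ i, ‖(r i : ℂ)‖ ≤ C) (x y : K) :
    inner ℂ (diag b (fun i => (r i : ℂ)) C hr x) y =
      inner ℂ x (diag b (fun i => (r i : ℂ)) C hr y) := by
  rw [← b.tsum_inner_mul_inner x, ← b.tsum_inner_mul_inner (diag _ _ _ _ x)]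
  congr 1 with i
  rw [inner_diag, ← inner_conj_symm, inner_diag, map_mul, inner_conj_symm, Complex.conj_ofReal]
  ring

variable [CompleteSpace K]

/-- A diagonal operator with eigenvalues tending to zero is the limit of its finite rank
truncations. -/
theorem isCompactOperator_diag (ha : Tendsto a cofinite (𝓝 0)) :
    IsCompactOperator (diag b a C h) := by
  classical
  let F : ℕ → K →L[ℂ] K := fun n =>
    ∑ i ∈ ((Metric.tendsto_nhds.1 ha _ (Nat.one_div_pos_of_nat (n := n) (α := ℝ))).toFinset),
      (innerSL ℂ (b i)).smulRight (a i • b i)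
  have hF : ∀ n, IsCompactOperator (F n) := by
    intro n
    have : F n ∈ compactOperator (RingHom.id ℂ) K K := by
      refine sum_mem fun i _ => ?_
      exact (isCompactOperator_of_locallyCompactSpace_dom (innerSL ℂ (b i))).clm_comp
        (ContinuousLinearMap.toSpanSingleton ℂ (a i • b i))
    exact this
  refine isCompactOperator_of_tendsto (l := atTop) (F := F) ?_ (Eventually.of_forall hF)
  rw [tendsto_iff_norm_sub_tendsto_zero]
  refine squeeze_zero (fun _ => norm_nonneg _) (fun n => ?_) tendsto_one_div_add_atTop_nhds_zero_nat
  set s := (Metric.tendsto_nhds.1 ha _ (Nat.one_div_pos_of_nat (n := n) (α := ℝ))).toFinset with hs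
  have hsm : ∀ i, ‖if i ∈ s then 0 else - a i‖ ≤ 1 / ((n : ℝ) + 1) := by
    intro i
    split_ifs with hi
    · simpa using (Nat.one_div_pos_of_nat (n := n) (α := ℝ)).le
    · simp [hs] at hi
      simpa using hi.le
  have : F n - diag b a C h = diag b (fun i => if i ∈ s then 0 else - a i) _ hsm := by
    ext x
    apply HilbertBasis.ext_inner b
    intro i
    simp only [F, sub_apply, sum_apply, inner_sub_right,
      inner_diag, inner_sum, ContinuousLinearMap.smulRight_apply, innerSL_apply_apply,
      inner_smul_right, orthonormal_iff_ite.1 b.orthonormal]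
    rw [← hs]
    split_ifs with hi
    · simp [hi, mul_comm]
    · simp [hi]
  rw [this]
  exact norm_diag_le (Nat.one_div_pos_of_nat (n := n) (α := ℝ)).le

end Diagonal

/-! ### Perturbation of a simple lowest eigenvalue -/

section Perturbation

/-- A self-adjoint operator `H₀` with a simple isolated lowest eigenvalue `E₀` and ground state `e`,
encoded through bounded operators. Here `A` is the inverse of `H₀ - E₀ + |e⟩⟨e|`, so that the domain
of `H₀` is the range of `A`; the operator `Q = P A` encodes a perturbation `P` which is relatively
form-bounded and kills `e`; `U` is a bounded perturbation. The constant `C` bounds both the identity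
and `P`, as quadratic forms, by `H₀ - E₀ + |e⟩⟨e|`. -/
structure GroundFamily (K : Type*) [NormedAddCommGroup K] [InnerProductSpace ℂ K] where
  A : K →L[ℂ] K
  Q : K →L[ℂ] K
  U : K →L[ℂ] K
  e : K
  C : ℝ
  norm_e : ‖e‖ = 1
  A_e : A e = e
  Q_e : Q e = 0
  A_symm : ∀ x y, inner ℂ (A x) y = inner ℂ x (A y)
  U_symm : ∀ x y, inner ℂ (U x) y = inner ℂ x (U y)
  AQ_symm : ∀ x y, inner ℂ (A x) (Q y) = inner ℂ (Q x) (A y)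
  A_bound : ∀ x, ‖A x‖ ^ 2 ≤ C * (inner ℂ x (A x)).re
  Q_bound : ∀ x, |(inner ℂ (A x) (Q x)).re| ≤ C * (inner ℂ x (A x)).re
  A_nonneg : ∀ x, 0 ≤ (inner ℂ x (A x)).re

namespace GroundFamily

variable {K : Type*} [NormedAddCommGroup K] [InnerProductSpace ℂ K] (D : GroundFamily K)

/-- The bounded operator `(H₀ + κ U - v P - (E₀ + ε) + |e⟩⟨e|) A`. -/
def M (ε κ v : ℝ) : K →L[ℂ] K := 1 - ε • D.A + κ • (D.U ∘L D.A) - v • D.Q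

theorem M_apply (ε κ v : ℝ) (x : K) :
    D.M ε κ v x = x - (ε : ℂ) • D.A x + (κ : ℂ) • D.U (D.A x) - (v : ℂ) • D.Q x := by
  simp [M]

theorem M_symm (ε κ v : ℝ) (x y : K) :
    inner ℂ (D.M ε κ v x) (D.A y) = inner ℂ (D.A x) (D.M ε κ v y) := by
  simp only [M_apply, inner_sub_left, inner_sub_right, inner_add_left, inner_add_right,
    inner_smul_left, inner_smul_right, Complex.conj_ofReal]
  rw [D.U_symm, D.AQ_symm, D.A_symm x y]

/-- The operator `(H₀ + κ U - v P) A`, where `E₀` is the ground state energy of `H₀`. -/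
def ham (E₀ κ v : ℝ) (y : K) : K :=
  y + (E₀ : ℂ) • D.A y - inner ℂ D.e y • D.e + (κ : ℂ) • D.U (D.A y) - (v : ℂ) • D.Q y

theorem ham_eq (E₀ ε κ v : ℝ) (y : K) :
    D.ham E₀ κ v y = ((E₀ + ε : ℝ) : ℂ) • D.A y + D.M ε κ v y - inner ℂ D.e y • D.e := by
  simp only [ham, M_apply, Complex.ofReal_add, add_smul]
  abel

theorem inner_e_A (y : K) : inner ℂ D.e (D.A y) = inner ℂ D.e y := by
  rw [← D.A_symm, D.A_e]

theorem inner_A_e (y : K) : inner ℂ (D.A y) D.e = inner ℂ y D.e := by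
  rw [D.A_symm, D.A_e]

theorem inner_e_e : inner ℂ D.e D.e = (1 : ℂ) := by
  rw [inner_self_eq_norm_sq_to_K, D.norm_e]; simp

/-- The functional `T ↦ Re ⟨e, T e⟩`. -/
def groundFunctional : (K →L[ℂ] K) →L[ℝ] ℝ :=
  Complex.reCLM ∘L ((innerSL ℂ D.e) ∘L (ContinuousLinearMap.apply ℂ K D.e)).restrictScalars ℝ

/-- The equation `implicitFn = 1` says that `E₀ + ε` is an eigenvalue of `H₀ + κ U - v P`. -/
def implicitFn (u : (ℝ × ℝ) × ℝ) : ℝ :=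
  D.groundFunctional (Ring.inverse (D.M u.2 u.1.1 u.1.2))

theorem contDiff_M {E : Type*} [NormedAddCommGroup E] [NormedSpace ℝ E] {n : WithTop ℕ∞}
    {a b c : E → ℝ} {x : E}
    (ha : ContDiffAt ℝ n a x) (hb : ContDiffAt ℝ n b x) (hc : ContDiffAt ℝ n c x) :
    ContDiffAt ℝ n (fun u => D.M (a u) (b u) (c u)) x := by
  unfold M
  fun_prop

theorem M_zero : D.M 0 0 0 = 1 := by
  ext x; simp [M_apply]

theorem implicitFn_zero : D.implicitFn ((0, 0), 0) = 1 := by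
  simp [implicitFn, D.M_zero, groundFunctional, D.norm_e]

variable [CompleteSpace K]

theorem contDiffAt_inverse_M {E : Type*} [NormedAddCommGroup E] [NormedSpace ℝ E]
    {n : WithTop ℕ∞} {a b c : E → ℝ} {x : E}
    (ha : ContDiffAt ℝ n a x) (hb : ContDiffAt ℝ n b x) (hc : ContDiffAt ℝ n c x)
    (hM : IsUnit (D.M (a x) (b x) (c x))) :
    ContDiffAt ℝ n (fun u => Ring.inverse (D.M (a u) (b u) (c u))) x := by
  obtain ⟨m, hm⟩ := hM
  have h := contDiffAt_ringInverse ℝ (n := n) m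
  rw [hm] at h
  exact h.comp x (D.contDiff_M ha hb hc)

theorem contDiffAt_implicitFn : ContDiffAt ℝ ⊤ D.implicitFn ((0, 0), 0) := by
  unfold implicitFn
  apply D.groundFunctional.contDiff.contDiffAt.comp
  apply D.contDiffAt_inverse_M
  · fun_prop
  · fun_prop
  · fun_prop
  · rw [D.M_zero]; exact isUnit_one

theorem isInvertible_implicitFn :
    (fderiv ℝ D.implicitFn ((0, 0), 0) ∘L .inr ℝ (ℝ × ℝ) ℝ).IsInvertible := by
  have h1 : HasFDerivAt D.implicitFn (fderiv ℝ D.implicitFn ((0, 0), 0)) ((0, 0), (0 : ℝ)) :=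
    (D.contDiffAt_implicitFn.differentiableAt (by simp)).hasFDerivAt
  have h2 : HasFDerivAt (fun ε : ℝ => (((0, 0), ε) : (ℝ × ℝ) × ℝ)) (.inr ℝ (ℝ × ℝ) ℝ) 0 :=
    hasFDerivAt_prodMk_right _ _
  have h3 := (h1.comp (0 : ℝ) h2).hasDerivAt
  have h4 : HasDerivAt (fun ε : ℝ => (1 - ε)⁻¹) 1 0 := by
    have h := ((hasDerivAt_id' (0 : ℝ)).const_sub 1).fun_inv (by simp)
    simpa using h
  have h5 : (D.implicitFn ∘ fun ε : ℝ => (((0, 0), ε) : (ℝ × ℝ) × ℝ)) =ᶠ[𝓝 0]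
      fun ε : ℝ => (1 - ε)⁻¹ := by
    have hc : ContinuousAt (fun ε : ℝ => D.M ε 0 0) 0 :=
      (D.contDiff_M (n := 0) contDiffAt_id contDiffAt_const contDiffAt_const).continuousAt
    have hu : ∀ᶠ ε in 𝓝 (0 : ℝ), IsUnit (D.M ε 0 0) := by
      apply hc.eventually
      exact Units.isOpen.mem_nhds (by simp [D.M_zero])
    have hne : ∀ᶠ ε in 𝓝 (0 : ℝ), ε ≠ 1 := eventually_ne_nhds (by simp)
    filter_upwards [hu, hne] with ε hε hε1
    have hMe : D.M ε 0 0 D.e = ((1 - ε : ℝ) : ℂ) • D.e := by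
      simp [M_apply, D.A_e, D.Q_e, sub_smul]
    have hne' : ((1 - ε : ℝ) : ℂ) ≠ 0 := by
      exact_mod_cast sub_ne_zero.2 hε1.symm
    have hinv : Ring.inverse (D.M ε 0 0) D.e = (((1 - ε)⁻¹ : ℝ) : ℂ) • D.e := by
      have : Ring.inverse (D.M ε 0 0) (D.M ε 0 0 D.e) = D.e := by
        rw [← mul_apply_eq_comp, Ring.inverse_mul_cancel _ hε]; rfl
      rw [hMe, map_smul] at this
      rw [Complex.ofReal_inv, eq_inv_smul_iff₀ hne', this]
    simp only [implicitFn, Function.comp, groundFunctional]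
    change (inner ℂ D.e (Ring.inverse (D.M ε 0 0) D.e)).re = _
    rw [hinv, inner_smul_right, D.inner_e_e, mul_one, Complex.ofReal_re]
  have h6 := (h4.congr_of_eventuallyEq h5).unique h3
  refine ContinuousLinearMap.IsInvertible.of_inverse (g := 1) ?_ ?_ <;>
  · ext
    simpa using h6.symm

end GroundFamily

end Perturbation

/-! ### The perturbed ground state energy -/

/-- Taylor expansion to third order of an even analytic function. -/
theorem isBigO_of_analyticAt_of_even {f : ℝ → ℝ} (hf : AnalyticAt ℝ f 0)
    (heven : ∀ v, f (-v) = f v) :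
    (fun v : ℝ => f v - (f 0 + iteratedDeriv 2 f 0 / 2 * v ^ 2)) =O[𝓝 0] fun v : ℝ => v ^ 4 := by
  have hodd (n : ℕ) (hn : Odd n) : iteratedDeriv n f 0 = 0 := by
    have h := iteratedDeriv_comp_neg n f 0
    simp only [heven, neg_zero, hn.neg_one_pow, neg_smul, one_smul] at h
    linarith
  have h := hf.hasFPowerSeriesAt.isBigO_sub_partialSum_pow 4
  have h1 := hodd 1 (by decide)
  have h3 := hodd 3 (by decide)
  refine h.congr' (Eventually.of_forall fun v => ?_) (Eventually.of_forall fun v => ?_)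
  · simp [FormalMultilinearSeries.partialSum, Finset.sum_range_succ, h1, h3]
    ring
  · simp only [Real.norm_eq_abs]
    exact Even.pow_abs (by decide) v

namespace GroundFamily

variable {K : Type*} [NormedAddCommGroup K] [InnerProductSpace ℂ K] (D : GroundFamily K)

/-- On the complement of the ground state the perturbed operator stays above the perturbed ground
state energy. -/
theorem re_inner_M_nonneg {ε κ v : ℝ} (h : (|ε| + |κ| * ‖D.U‖ + |v|) * D.C ≤ 1) (w : K) :
    0 ≤ (inner ℂ (D.A w) (D.M ε κ v w)).re := by
  set q := (inner ℂ w (D.A w)).re with hq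
  have hA := D.A_bound w
  have h1 : |ε * ‖D.A w‖ ^ 2| ≤ |ε| * (D.C * q) := by
    rw [abs_mul, abs_of_nonneg (sq_nonneg ‖D.A w‖)]
    exact mul_le_mul_of_nonneg_left hA (abs_nonneg _)
  have h2 : |κ * (inner ℂ (D.A w) (D.U (D.A w))).re| ≤ |κ| * (‖D.U‖ * (D.C * q)) := by
    rw [abs_mul]
    refine mul_le_mul_of_nonneg_left ?_ (abs_nonneg _)
    calc |(inner ℂ (D.A w) (D.U (D.A w))).re| ≤ ‖D.A w‖ * ‖D.U (D.A w)‖ :=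
          (Complex.abs_re_le_norm _).trans (norm_inner_le_norm _ _)
      _ ≤ ‖D.A w‖ * (‖D.U‖ * ‖D.A w‖) := by gcongr; exact D.U.le_opNorm _
      _ = ‖D.U‖ * ‖D.A w‖ ^ 2 := by ring
      _ ≤ _ := by gcongr
  have h3 : |v * (inner ℂ (D.A w) (D.Q w)).re| ≤ |v| * (D.C * q) := by
    rw [abs_mul]
    exact mul_le_mul_of_nonneg_left (D.Q_bound w) (abs_nonneg _)
  have h4 : (inner ℂ (D.A w) (D.M ε κ v w)).re = q - ε * ‖D.A w‖ ^ 2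
      + κ * (inner ℂ (D.A w) (D.U (D.A w))).re - v * (inner ℂ (D.A w) (D.Q w)).re := by
    rw [M_apply, inner_sub_right, inner_add_right, inner_sub_right, inner_smul_right,
      inner_smul_right, inner_smul_right, inner_self_eq_norm_sq_to_K, D.A_symm w w, hq]
    simp only [Complex.sub_re, Complex.add_re, Complex.re_ofReal_mul]
    norm_cast
  have hq0 : 0 ≤ q := D.A_nonneg w
  have h5 := mul_le_mul_of_nonneg_right h hq0
  rw [h4]
  nlinarith [abs_le.1 h1, abs_le.1 h2, abs_le.1 h3]

/-- If `M y = e` and `⟨e, y⟩ = 1` with small parameters, then `E₀ + ε` is the ground state energy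
of `H₀ + κ U - v P`. -/
theorem sInf_eq {E₀ ε κ v : ℝ} (h : (|ε| + |κ| * ‖D.U‖ + |v|) * D.C ≤ 1) {y : K}
    (hy : D.M ε κ v y = D.e) (hey : inner ℂ D.e y = (1 : ℂ)) :
    sInf {r : ℝ | ∃ z, ‖D.A z‖ = 1 ∧ r = (inner ℂ (D.A z) (D.ham E₀ κ v z)).re} = E₀ + ε := by
  apply IsLeast.csInf_eq
  have key (z : K) (hz : D.M ε κ v z = inner ℂ D.e z • D.e) (hz1 : ‖D.A z‖ = 1) :
      (inner ℂ (D.A z) (D.ham E₀ κ v z)).re = E₀ + ε := by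
    rw [D.ham_eq E₀ ε, hz, add_sub_cancel_right, inner_smul_right, inner_self_eq_norm_sq_to_K, hz1]
    simp
  have hAy : D.A y ≠ 0 := by
    intro h0
    have := D.inner_e_A y
    rw [h0, hey, inner_zero_right] at this
    exact zero_ne_one this
  refine ⟨⟨((‖D.A y‖⁻¹ : ℝ) : ℂ) • y, ?_, ?_⟩, ?_⟩
  · rw [map_smul, norm_smul, Complex.norm_real, norm_inv, norm_norm,
      inv_mul_cancel₀ (norm_ne_zero_iff.2 hAy)]
  · rw [key]
    · rw [map_smul, hy, inner_smul_right, hey, mul_one]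
    · rw [map_smul, norm_smul, Complex.norm_real, norm_inv, norm_norm,
        inv_mul_cancel₀ (norm_ne_zero_iff.2 hAy)]
  · rintro r ⟨z, hz1, rfl⟩
    -- split off the component of `z` along the perturbed ground state
    set a : ℂ := inner ℂ D.e z with ha
    set w := z - a • y with hw
    have hew : inner ℂ D.e w = (0 : ℂ) := by
      rw [hw, inner_sub_right, inner_smul_right, hey, ← ha, mul_one, sub_self]
    have hz : z = a • y + w := by rw [hw]; abel
    have hMz : D.M ε κ v z = a • D.e + D.M ε κ v w := by rw [hz, map_add, map_smul, hy]
    have h1 : D.ham E₀ κ v z = ((E₀ + ε : ℝ) : ℂ) • D.A z + D.M ε κ v w := by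
      rw [D.ham_eq E₀ ε, hMz, ← ha]; abel
    have h2 : inner ℂ (D.A y) (D.M ε κ v w) = (0 : ℂ) := by
      rw [← D.M_symm, hy, D.inner_e_A, hew]
    have h3 : inner ℂ (D.A z) (D.M ε κ v w) = inner ℂ (D.A w) (D.M ε κ v w) := by
      rw [hz, map_add, map_smul, inner_add_left, inner_smul_left, h2, mul_zero, zero_add]
    rw [h1, inner_add_right, h3, inner_smul_right, inner_self_eq_norm_sq_to_K, hz1]
    have := D.re_inner_M_nonneg h w
    simp only [Complex.add_re, RCLike.ofReal_one]
    simpa using this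

/-- The vector `y` for which `A y` is the perturbed ground state. -/
def vec (ε κ v : ℝ) : K := Ring.inverse (D.M ε κ v) D.e

theorem M_vec {ε κ v : ℝ} (h : IsUnit (D.M ε κ v)) : D.M ε κ v (D.vec ε κ v) = D.e := by
  rw [vec, ← mul_apply_eq_comp, Ring.mul_inverse_cancel _ h, one_apply_eq_self]

theorem norm_one_le {y : K} (hy : inner ℂ D.e y = (1 : ℂ)) : 1 ≤ ‖D.A y‖ := by
  have h := norm_inner_le_norm (𝕜 := ℂ) D.e (D.A y)
  rw [D.inner_e_A, hy, D.norm_e] at h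
  simpa using h

variable [CompleteSpace K]

/-- The analytic branch of eigenvalues starting at the unperturbed ground state energy. -/
theorem exists_branch : ∃ ε : ℝ × ℝ → ℝ, ContDiffAt ℝ ⊤ ε (0, 0) ∧ ε (0, 0) = 0 ∧
    ∀ᶠ p in 𝓝 ((0, 0) : ℝ × ℝ), IsUnit (D.M (ε p) p.1 p.2) ∧
      inner ℂ D.e (D.vec (ε p) p.1 p.2) = (1 : ℂ) := by
  have hinv := D.isInvertible_implicitFn
  have hcd := D.contDiffAt_implicitFn
  refine ⟨hcd.implicitFunction (by simp) hinv, hcd.contDiffAt_implicitFunction (by simp) hinv,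
    hcd.implicitFunction_apply_self (by simp) hinv, ?_⟩
  set ε := hcd.implicitFunction (by simp) hinv
  have hε0 : ε (0, 0) = 0 := hcd.implicitFunction_apply_self (by simp) hinv
  have hε : ContDiffAt ℝ ⊤ ε (0, 0) := hcd.contDiffAt_implicitFunction (by simp) hinv
  have h1 := hcd.eventually_apply_implicitFunction (by simp) hinv
  have hc : ContinuousAt (fun p : ℝ × ℝ => D.M (ε p) p.1 p.2) (0, 0) :=
    (D.contDiff_M hε contDiffAt_fst contDiffAt_snd).continuousAt
  have hu : ∀ᶠ p in 𝓝 ((0, 0) : ℝ × ℝ), IsUnit (D.M (ε p) p.1 p.2) := by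
    apply hc.eventually
    exact Units.isOpen.mem_nhds (by simp [hε0, D.M_zero])
  filter_upwards [h1, hu] with p hp hpu
  refine ⟨hpu, ?_⟩
  have hre : (inner ℂ D.e (D.vec (ε p) p.1 p.2)).re = 1 := by
    have h2 : D.implicitFn (p, ε p) = D.implicitFn ((0, 0), 0) := hp
    rw [D.implicitFn_zero] at h2
    exact h2
  -- the equation is real because `M` is symmetric with respect to `A`
  have him : starRingEnd ℂ (inner ℂ D.e (D.vec (ε p) p.1 p.2)) =
      inner ℂ D.e (D.vec (ε p) p.1 p.2) := by
    have h3 := D.M_symm (ε p) p.1 p.2 (D.vec (ε p) p.1 p.2) (D.vec (ε p) p.1 p.2)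
    rw [D.M_vec hpu, D.inner_e_A, D.inner_A_e] at h3
    rw [inner_conj_symm, h3]
  apply Complex.ext
  · simpa using hre
  · simpa using Complex.conj_eq_iff_im.1 him

/-- The second order coefficient in `v` at a fixed `κ`:
`c ‖ψ‖² = - ⟨P ψ, (H - E + |e⟩⟨e|)⁻¹ P ψ⟩` for the ground state `ψ = A y`. -/
theorem second_order {κ c : ℝ} {ε : ℝ → ℝ} (hε : ContinuousAt ε 0)
    (hu : ∀ᶠ v in 𝓝 (0 : ℝ), IsUnit (D.M (ε v) κ v) ∧
      inner ℂ D.e (D.vec (ε v) κ v) = (1 : ℂ))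
    (hc : (fun v : ℝ => ε v - (ε 0 + c * v ^ 2)) =O[𝓝 0] fun v : ℝ => v ^ 4) :
    (c : ℂ) * inner ℂ (D.A (D.vec (ε 0) κ 0)) (D.A (D.vec (ε 0) κ 0)) =
      - inner ℂ (D.Q (D.vec (ε 0) κ 0))
        (D.A (Ring.inverse (D.M (ε 0) κ 0) (D.Q (D.vec (ε 0) κ 0)))) := by
  set y : ℝ → K := fun v => D.vec (ε v) κ v with hy
  obtain ⟨hu0, h10⟩ := hu.self_of_nhds
  set B := Ring.inverse (D.M (ε 0) κ 0) with hB
  -- first identity: pair the two eigenvalue equations with each other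
  have I1 : ∀ᶠ v in 𝓝 (0 : ℝ), ((ε v - ε 0 : ℝ) : ℂ) * inner ℂ (D.A (y 0)) (D.A (y v)) =
      - (v : ℂ) * inner ℂ (D.Q (y 0)) (D.A (y v)) := by
    filter_upwards [hu] with v hv
    have h1 : inner ℂ (D.A (y 0)) (D.M (ε v) κ v (y v)) = (1 : ℂ) := by
      rw [hy, D.M_vec hv.1, D.inner_A_e, ← inner_conj_symm, h10, map_one]
    have h2 : inner ℂ (D.A (y 0)) (D.M (ε 0) κ 0 (y v)) = (1 : ℂ) := by
      rw [← D.M_symm, hy, D.M_vec hu0, D.inner_e_A, hv.2]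
    have h3 : D.M (ε v) κ v (y v) = D.M (ε 0) κ 0 (y v) - ((ε v - ε 0 : ℝ) : ℂ) • D.A (y v)
        - (v : ℂ) • D.Q (y v) := by
      simp only [M_apply, Complex.ofReal_sub, sub_smul, Complex.ofReal_zero, zero_smul]
      abel
    rw [h3, inner_sub_right, inner_sub_right, h2, inner_smul_right, inner_smul_right,
      D.AQ_symm] at h1
    linear_combination -h1
  have I2 : ∀ᶠ v in 𝓝 (0 : ℝ), y v = y 0 + (v : ℂ) • B (D.Q (y v))
      + ((ε v - ε 0 : ℝ) : ℂ) • B (D.A (y v)) := by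
    filter_upwards [hu] with v hv
    have h3 : D.M (ε 0) κ 0 (y v) = D.e + (v : ℂ) • D.Q (y v)
        + ((ε v - ε 0 : ℝ) : ℂ) • D.A (y v) := by
      rw [← D.M_vec hv.1, hy]
      simp only [M_apply, Complex.ofReal_sub, sub_smul, Complex.ofReal_zero, zero_smul]
      abel
    have h4 := congrArg B h3
    rw [hB, ← mul_apply_eq_comp, Ring.inverse_mul_cancel _ hu0, one_apply_eq_self, map_add,
      map_add, map_smul, map_smul] at h4
    exact h4
  have hyc : Tendsto y (𝓝 0) (𝓝 (y 0)) := by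
    have : ContinuousAt (fun v => Ring.inverse (D.M (ε v) κ v)) 0 := by
      obtain ⟨m, hm⟩ := hu0
      have h1 := NormedRing.inverse_continuousAt m
      rw [hm] at h1
      have h2 : ContinuousAt (fun v => D.M (ε v) κ v) 0 := by
        unfold M
        fun_prop
      exact ContinuousAt.comp (f := fun v => D.M (ε v) κ v) h1 h2
    exact (this.clm_apply continuousAt_const)
  have hyc' : Tendsto y (𝓝[≠] 0) (𝓝 (y 0)) := hyc.mono_left nhdsWithin_le_nhds
  -- divided differences of the eigenvalue
  have hd2 : Tendsto (fun v => (ε v - ε 0) / v ^ 2) (𝓝[≠] 0) (𝓝 c) := by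
    have h1 : Tendsto (fun v => (ε v - (ε 0 + c * v ^ 2)) / v ^ 2) (𝓝[≠] 0) (𝓝 0) := by
      refine IsLittleO.tendsto_div_nhds_zero ?_
      refine (hc.mono nhdsWithin_le_nhds).trans_isLittleO ?_
      exact (isLittleO_pow_pow (by norm_num)).mono nhdsWithin_le_nhds
    have h2 := h1.add_const c
    rw [zero_add] at h2
    refine h2.congr' ?_
    filter_upwards [self_mem_nhdsWithin] with v hv
    have : v ≠ 0 := hv
    field_simp
    ring
  have hv0 : Tendsto (fun v : ℝ => v) (𝓝[≠] 0) (𝓝 0) := nhdsWithin_le_nhds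
  have hd1 : Tendsto (fun v => (ε v - ε 0) / v) (𝓝[≠] 0) (𝓝 0) := by
    have h2 := hd2.mul hv0
    rw [mul_zero] at h2
    refine h2.congr' ?_
    filter_upwards [self_mem_nhdsWithin] with v hv
    have : v ≠ 0 := hv
    field_simp
  have hd2' : Tendsto (fun v => (((ε v - ε 0) / v ^ 2 : ℝ) : ℂ)) (𝓝[≠] 0) (𝓝 c) :=
    (Complex.continuous_ofReal.tendsto _).comp hd2
  have hd1' : Tendsto (fun v => (((ε v - ε 0) / v : ℝ) : ℂ)) (𝓝[≠] 0) (𝓝 0) := by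
    have := (Complex.continuous_ofReal.tendsto _).comp hd1
    rwa [Complex.ofReal_zero] at this
  have hAy : Tendsto (fun v => D.A (y v)) (𝓝[≠] 0) (𝓝 (D.A (y 0))) :=
    (D.A.continuous.tendsto _).comp hyc'
  have hQy : Tendsto (fun v => D.Q (y v)) (𝓝[≠] 0) (𝓝 (D.Q (y 0))) :=
    (D.Q.continuous.tendsto _).comp hyc'
  -- the momentum of the ground state vanishes, as there is no linear term
  have hP0 : inner ℂ (D.Q (y 0)) (D.A (y 0)) = (0 : ℂ) := by
    have h1 : Tendsto (fun v => -((((ε v - ε 0) / v : ℝ) : ℂ) *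
        inner ℂ (D.A (y 0)) (D.A (y v)))) (𝓝[≠] 0) (𝓝 0) := by
      simpa using (hd1'.mul (tendsto_const_nhds.inner hAy)).neg
    have h2 : Tendsto (fun v => (inner ℂ (D.Q (y 0)) (D.A (y v)) : ℂ)) (𝓝[≠] 0)
        (𝓝 (inner ℂ (D.Q (y 0)) (D.A (y 0)))) := tendsto_const_nhds.inner hAy
    refine tendsto_nhds_unique (h2.congr' ?_) h1
    filter_upwards [I1.filter_mono nhdsWithin_le_nhds, self_mem_nhdsWithin] with v hv hv0
    have : (v : ℂ) ≠ 0 := by exact_mod_cast hv0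
    push_cast at hv ⊢
    field_simp
    linear_combination hv
  have hL : Tendsto (fun v => (((ε v - ε 0) / v ^ 2 : ℝ) : ℂ) *
      inner ℂ (D.A (y 0)) (D.A (y v))) (𝓝[≠] 0)
      (𝓝 (c * inner ℂ (D.A (y 0)) (D.A (y 0)))) :=
    hd2'.mul (tendsto_const_nhds.inner hAy)
  have hR : Tendsto (fun v => - (inner ℂ (D.Q (y 0)) (D.A (B (D.Q (y v)))) : ℂ) -
      (((ε v - ε 0) / v : ℝ) : ℂ) * inner ℂ (D.Q (y 0)) (D.A (B (D.A (y v))))) (𝓝[≠] 0)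
      (𝓝 (- inner ℂ (D.Q (y 0)) (D.A (B (D.Q (y 0)))) -
        0 * inner ℂ (D.Q (y 0)) (D.A (B (D.A (y 0)))))) :=
    (tendsto_const_nhds.inner (((D.A ∘L B).continuous.tendsto _).comp hQy)).neg.sub
      (hd1'.mul (tendsto_const_nhds.inner (((D.A ∘L B).continuous.tendsto _).comp hAy)))
  rw [zero_mul, sub_zero] at hR
  refine tendsto_nhds_unique (hL.congr' ?_) hR
  filter_upwards [I1.filter_mono nhdsWithin_le_nhds, I2.filter_mono nhdsWithin_le_nhds,
    self_mem_nhdsWithin] with v h1 h2 hv0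
  have hv : (v : ℂ) ≠ 0 := by exact_mod_cast hv0
  have h3 : (inner ℂ (D.Q (y 0)) (D.A (y v)) : ℂ) =
      v * inner ℂ (D.Q (y 0)) (D.A (B (D.Q (y v)))) +
      ((ε v - ε 0 : ℝ) : ℂ) * inner ℂ (D.Q (y 0)) (D.A (B (D.A (y v)))) := by
    conv_lhs => rw [h2]
    rw [map_add, map_add, map_smul, map_smul, inner_add_right, inner_add_right, hP0, zero_add,
      inner_smul_right, inner_smul_right]
  rw [h3] at h1
  push_cast at h1 ⊢
  field_simp
  linear_combination h1

end GroundFamily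

/-! ### Second order perturbation theory -/

namespace GroundFamily

variable {K : Type*} [NormedAddCommGroup K] [InnerProductSpace ℂ K] (D : GroundFamily K)

theorem isBigO_inner_mul {α F : Type*} [NormedAddCommGroup F]
    [InnerProductSpace ℂ F] {l : Filter α} {f g : α → F} {a b : α → ℝ} (hf : f =O[l] a)
    (hg : g =O[l] b) : (fun x => (inner ℂ (f x) (g x) : ℂ)) =O[l] fun x => a x * b x := by
  refine IsBigO.trans ?_ (hf.norm_left.mul hg.norm_left)
  exact IsBigO.of_bound 1 (Eventually.of_forall fun x => by
    simpa using norm_inner_le_norm (𝕜 := ℂ) (f x) (g x))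

variable [CompleteSpace K]

/-- To leading order in `κ`, `⟨P ψ, (H - E + |e⟩⟨e|)⁻¹ P ψ⟩ = κ² ⟨Q U e, A Q U e⟩` for the ground
state `ψ` of `H₀ + κ U`. -/
theorem isBigO_second_order {ε : ℝ → ℝ} (hε : ε =O[𝓝 0] fun κ => κ)
    (hu : ∀ᶠ κ in 𝓝 (0 : ℝ), IsUnit (D.M (ε κ) κ 0) ∧
      inner ℂ D.e (D.vec (ε κ) κ 0) = (1 : ℂ)) {c : ℝ → ℝ}
    (hc : ∀ᶠ κ in 𝓝 (0 : ℝ),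
      (c κ : ℂ) * inner ℂ (D.A (D.vec (ε κ) κ 0)) (D.A (D.vec (ε κ) κ 0)) =
      - inner ℂ (D.Q (D.vec (ε κ) κ 0))
        (D.A (Ring.inverse (D.M (ε κ) κ 0) (D.Q (D.vec (ε κ) κ 0))))) :
    (fun κ : ℝ => c κ + κ ^ 2 * (inner ℂ (D.Q (D.U D.e)) (D.A (D.Q (D.U D.e)))).re)
      =O[𝓝 0] fun κ : ℝ => κ ^ 3 := by
  set y : ℝ → K := fun κ => D.vec (ε κ) κ 0 with hy
  set q := D.Q (D.U D.e) with hq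
  set z : ℝ → K := fun κ => Ring.inverse (D.M (ε κ) κ 0) (D.Q (y κ)) with hz
  have hid : (fun κ : ℝ => ((κ : ℝ) : ℂ)) =O[𝓝 0] fun κ : ℝ => κ :=
    IsBigO.of_bound 1 (Eventually.of_forall fun x => by simp)
  have hεC : (fun κ : ℝ => ((ε κ : ℝ) : ℂ)) =O[𝓝 0] fun κ : ℝ => κ := by
    refine IsBigO.trans (IsBigO.of_bound 1 (Eventually.of_forall fun x => ?_)) hε
    simp
  have hid' : (fun κ : ℝ => κ) =O[𝓝 0] fun _ : ℝ => (1 : ℝ) :=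
    (continuous_id.tendsto (0 : ℝ)).isBigO_one ℝ
  have hε0 : Tendsto ε (𝓝 0) (𝓝 0) := hε.trans_tendsto tendsto_id
  have hclm (T : K →L[ℂ] K) {f : ℝ → K} {g : ℝ → ℝ} (h : f =O[𝓝 0] g) :
      (fun κ => T (f κ)) =O[𝓝 0] g := (T.isBigO_comp f (𝓝 0)).trans h
  have hBc : Tendsto (fun κ => Ring.inverse (D.M (ε κ) κ 0)) (𝓝 0) (𝓝 1) := by
    have h1 : Tendsto (fun κ => D.M (ε κ) κ 0) (𝓝 0) (𝓝 1) := by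
      have : Tendsto (fun κ : ℝ => D.M (ε κ) κ 0) (𝓝 0)
          (𝓝 (1 - (0 : ℝ) • D.A + (0 : ℝ) • (D.U ∘L D.A) - (0 : ℝ) • D.Q)) :=
        ((tendsto_const_nhds.sub (hε0.smul_const D.A)).add
          (tendsto_id.smul_const (D.U ∘L D.A))).sub tendsto_const_nhds
      simpa using this
    have h2 := NormedRing.inverse_continuousAt (1 : (K →L[ℂ] K)ˣ)
    rw [Units.val_one] at h2
    have h3 := h2.tendsto.comp h1
    rwa [Ring.inverse_one] at h3
  have hB (f : ℝ → K) : (fun κ => Ring.inverse (D.M (ε κ) κ 0) (f κ)) =O[𝓝 0] f := by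
    have h1 := (hBc.norm.isBigO_one ℝ).norm_left
    have h2 : (fun κ => Ring.inverse (D.M (ε κ) κ 0) (f κ)) =O[𝓝 0]
        fun κ => ‖‖Ring.inverse (D.M (ε κ) κ 0)‖‖ * ‖f κ‖ :=
      IsBigO.of_bound 1 (Eventually.of_forall fun κ => by
        simpa using (Ring.inverse (D.M (ε κ) κ 0)).le_opNorm (f κ))
    refine h2.trans ((h1.mul (isBigO_refl (fun κ => ‖f κ‖) _)).trans ?_)
    simpa using (isBigO_refl f (𝓝 0)).norm_left
  have hconst (x : K) : (fun _ : ℝ => x) =O[𝓝 0] fun _ : ℝ => (1 : ℝ) := isBigO_const_const _ (by simp) _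
  have hy1 : y =O[𝓝 0] fun _ : ℝ => (1 : ℝ) := (hB fun _ => D.e).trans (hconst _)
  -- the resolvent correction of a vector of size `g`
  have hcorr {f : ℝ → K} {g : ℝ → ℝ} (h : f =O[𝓝 0] g) :
      (fun κ => (ε κ : ℂ) • D.A (f κ) - (κ : ℂ) • D.U (D.A (f κ))) =O[𝓝 0] fun κ => κ * g κ :=
    (hεC.smul (hclm D.A h)).sub (hid.smul (hclm D.U (hclm D.A h)))
  have hye : (fun κ => y κ - D.e) =O[𝓝 0] fun κ : ℝ => κ := by
    refine IsBigO.congr' (hcorr hy1) ?_ (Eventually.of_forall fun κ => mul_one κ)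
    filter_upwards [hu] with κ hκ
    have := D.M_vec hκ.1
    rw [M_apply] at this
    rw [hy, ← this]
    simp only [Complex.ofReal_zero, zero_smul]
    abel
  have hye2 : (fun κ => y κ - D.e - (ε κ : ℂ) • D.e + (κ : ℂ) • D.U D.e) =O[𝓝 0]
      fun κ : ℝ => κ * κ := by
    refine IsBigO.congr' (hcorr hye) ?_ EventuallyEq.rfl
    filter_upwards [hu] with κ hκ
    have := D.M_vec hκ.1
    rw [M_apply] at this
    have h' : y κ - D.e = (ε κ : ℂ) • D.A (y κ) - (κ : ℂ) • D.U (D.A (y κ)) := by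
      rw [hy, ← this]
      simp only [Complex.ofReal_zero, zero_smul]
      abel
    rw [map_sub, D.A_e, map_sub, smul_sub, smul_sub, h']
    abel
  have hQy2 : (fun κ => D.Q (y κ) + (κ : ℂ) • q) =O[𝓝 0] fun κ : ℝ => κ * κ := by
    refine (hclm D.Q hye2).congr_left fun κ => ?_
    simp [D.Q_e, hq]
  have hκq : (fun κ : ℝ => (κ : ℂ) • q) =O[𝓝 0] fun κ : ℝ => κ := by
    simpa using hid.smul (hconst q)
  have hκ2 : (fun κ : ℝ => κ * κ) =O[𝓝 0] fun κ : ℝ => κ := by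
    simpa using (isBigO_refl (fun κ : ℝ => κ) (𝓝 0)).mul hid'
  have hQy : (fun κ => D.Q (y κ)) =O[𝓝 0] fun κ : ℝ => κ := by
    simpa using (hQy2.trans hκ2).sub hκq
  have hz1 : z =O[𝓝 0] fun κ : ℝ => κ := (hB fun κ => D.Q (y κ)).trans hQy
  have hz2 : (fun κ => z κ + (κ : ℂ) • q) =O[𝓝 0] fun κ : ℝ => κ * κ := by
    refine IsBigO.congr' ((hcorr hz1).add hQy2) ?_ EventuallyEq.rfl
    filter_upwards [hu] with κ hκ
    have h1 : D.M (ε κ) κ 0 (z κ) = D.Q (y κ) := by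
      rw [hz, ← mul_apply_eq_comp, Ring.mul_inverse_cancel _ hκ.1, one_apply_eq_self]
    rw [← h1, M_apply]
    simp only [Complex.ofReal_zero, zero_smul]
    abel
  have hform : (fun κ : ℝ => (inner ℂ (D.Q (y κ)) (D.A (z κ)) : ℂ) - (κ : ℂ) ^ 2 * inner ℂ q (D.A q))
      =O[𝓝 0] fun κ : ℝ => κ ^ 3 := by
    have h1 := isBigO_inner_mul hQy2 (hclm D.A hz1)
    have h2 := isBigO_inner_mul hκq (hclm D.A hz2)
    have h3 := (h1.congr_right fun κ => (by ring : κ * κ * κ = κ ^ 3)).sub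
      (h2.congr_right fun κ => (by ring : κ * (κ * κ) = κ ^ 3))
    refine h3.congr_left fun κ => ?_
    simp only [map_add, map_smul, inner_add_left, inner_add_right, inner_smul_left,
      inner_smul_right, Complex.conj_ofReal]
    ring
  have hnorm : (fun κ : ℝ => (1 : ℂ) - inner ℂ (D.A (y κ)) (D.A (y κ))) =O[𝓝 0] fun κ : ℝ => κ := by
    have h0 : (fun κ => D.A (y κ) - D.e) =O[𝓝 0] fun κ : ℝ => κ := by
      refine (hclm D.A hye).congr_left fun κ => ?_
      rw [map_sub, D.A_e]
    have h1 := isBigO_inner_mul h0 (hclm D.A hy1)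
    have h2 := isBigO_inner_mul (hconst D.e) h0
    have h3 := ((h1.congr_right fun κ => mul_one κ).add (h2.congr_right fun κ => one_mul κ)).neg_left
    refine h3.congr_left fun κ => ?_
    rw [inner_sub_left, inner_sub_right, D.inner_e_e]
    ring
  have hc2 : (fun κ => (c κ : ℂ)) =O[𝓝 0] fun κ : ℝ => κ * κ := by
    have h1 := isBigO_inner_mul hQy (hclm D.A hz1)
    refine IsBigO.trans (IsBigO.of_bound 1 ?_) h1
    filter_upwards [hc, hu] with κ h1 h2
    have h3 := congrArg norm h1
    have h4 : 1 ≤ ‖D.A (y κ)‖ := D.norm_one_le h2.2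
    rw [norm_neg, norm_mul, inner_self_eq_norm_sq_to_K, norm_pow, RCLike.norm_ofReal,
      abs_norm] at h3
    rw [one_mul, ← h3]
    exact le_mul_of_one_le_right (norm_nonneg _) (one_le_pow₀ h4)
  have hfin : (fun κ : ℝ => (c κ : ℂ) + (κ : ℂ) ^ 2 * inner ℂ q (D.A q)) =O[𝓝 0]
      fun κ : ℝ => κ ^ 3 := by
    have h1 := (hc2.mul hnorm).congr_right fun κ => (by ring : κ * κ * κ = κ ^ 3)
    refine (h1.sub hform).congr' ?_ EventuallyEq.rfl
    filter_upwards [hc] with κ h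
    linear_combination -h
  refine IsBigO.trans (IsBigO.of_bound 1 (Eventually.of_forall fun κ => ?_)) hfin
  rw [one_mul, Real.norm_eq_abs]
  refine le_trans (le_of_eq ?_) (Complex.abs_re_le_norm _)
  rw [Complex.add_re, Complex.ofReal_re, ← Complex.ofReal_pow, Complex.re_ofReal_mul]

/-- Second order perturbation theory of the ground state energy `f κ v` of `H₀ + κ U - v P`, under
the assumption that it is even in `v`. -/
theorem analyticAt_and_isBigO {f : ℝ → ℝ → ℝ} {E₀ : ℝ}
    (hf : ∀ κ v, f κ v =
      sInf {r : ℝ | ∃ z, ‖D.A z‖ = 1 ∧ r = (inner ℂ (D.A z) (D.ham E₀ κ v z)).re})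
    (heven : ∀ κ v, f κ (-v) = f κ v) :
    (∀ᶠ κ in 𝓝 (0 : ℝ), AnalyticAt ℝ (f κ) 0) ∧
    (fun κ : ℝ => iteratedDeriv 2 (f κ) 0 / 2 +
      κ ^ 2 * (inner ℂ (D.Q (D.U D.e)) (D.A (D.Q (D.U D.e)))).re) =O[𝓝 0] fun κ : ℝ => κ ^ 3 := by
  obtain ⟨ε, hε, hε0, hu⟩ := D.exists_branch
  have hsmall : ∀ᶠ p in 𝓝 ((0, 0) : ℝ × ℝ), (|ε p| + |p.1| * ‖D.U‖ + |p.2|) * D.C ≤ 1 := by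
    have hc : ContinuousAt (fun p : ℝ × ℝ => (|ε p| + |p.1| * ‖D.U‖ + |p.2|) * D.C) (0, 0) := by
      have := hε.continuousAt
      fun_prop
    refine (hc.eventually_lt continuousAt_const ?_).mono fun p hp => le_of_lt hp
    simp [hε0]
  have hfE : ∀ᶠ p in 𝓝 ((0, 0) : ℝ × ℝ), f p.1 p.2 = E₀ + ε p := by
    filter_upwards [hsmall, hu] with p h1 h2
    rw [hf, D.sInf_eq h1 (D.M_vec h2.1) h2.2]
  have hpull {P : ℝ × ℝ → Prop} (h : ∀ᶠ p in 𝓝 ((0, 0) : ℝ × ℝ), P p) :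
      ∀ᶠ κ in 𝓝 (0 : ℝ), ∀ᶠ v in 𝓝 (0 : ℝ), P (κ, v) := by
    rw [nhds_prod_eq] at h
    exact h.curry
  have hline (κ : ℝ) : ContDiff ℝ ⊤ fun v : ℝ => (κ, v) := by fun_prop
  have han : ∀ᶠ κ in 𝓝 (0 : ℝ), AnalyticAt ℝ (fun v => ε (κ, v)) 0 := by
    filter_upwards [hpull (hε.eventually (by simp))] with κ hκ
    have h1 : ContDiffAt ℝ ⊤ ε (κ, 0) := hκ.self_of_nhds
    exact (h1.comp (0 : ℝ) (hline κ).contDiffAt).analyticAt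
  have hfe : ∀ᶠ κ in 𝓝 (0 : ℝ), f κ =ᶠ[𝓝 0] fun v => E₀ + ε (κ, v) := hpull hfE
  have hanf : ∀ᶠ κ in 𝓝 (0 : ℝ), AnalyticAt ℝ (f κ) 0 := by
    filter_upwards [han, hfe] with κ h1 h2
    exact (analyticAt_const.add h1).congr h2.symm
  refine ⟨hanf, ?_⟩
  have hεκ : (fun κ => ε (κ, 0)) =O[𝓝 0] fun κ : ℝ => κ := by
    have h1 : DifferentiableAt ℝ (fun κ : ℝ => ε (κ, 0)) 0 :=
      (hε.differentiableAt (by simp)).comp (0 : ℝ) (f := fun κ : ℝ => (κ, (0 : ℝ))) (by fun_prop)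
    have h2 := h1.isBigO_sub
    simpa [hε0] using h2
  have hu0 : ∀ᶠ κ in 𝓝 (0 : ℝ), IsUnit (D.M (ε (κ, 0)) κ 0) ∧
      inner ℂ D.e (D.vec (ε (κ, 0)) κ 0) = (1 : ℂ) := by
    filter_upwards [hpull hu] with κ hκ using hκ.self_of_nhds
  refine D.isBigO_second_order hεκ hu0 ?_
  filter_upwards [han, hfe, hanf, hpull hu] with κ h1 h2 h3 h4
  refine D.second_order (ε := fun v => ε (κ, v)) h1.continuousAt h4 ?_
  refine (isBigO_of_analyticAt_of_even h3 (heven κ)).congr' ?_ EventuallyEq.rfl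
  filter_upwards [h2] with v hv
  rw [hv, h2.self_of_nhds]
  ring

end GroundFamily

/-! ### Fourier analysis on configuration space -/

/-- A family of characters which separates points spans a dense subspace of the continuous
functions. -/
theorem span_range_topologicalClosure_eq_top {X I : Type*} [TopologicalSpace X] [CompactSpace X]
    [AddGroup I] (e : I → C(X, ℂ)) (h0 : e 0 = 1) (hadd : ∀ m n, e (m + n) = e m * e n)
    (hneg : ∀ n, e (-n) = star (e n)) (hsep : ∀ x y, x ≠ y → ∃ n, e n x ≠ e n y) :
    (Submodule.span ℂ (Set.range e)).topologicalClosure = ⊤ := by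
  let A : StarSubalgebra ℂ C(X, ℂ) :=
    { toSubalgebra := Algebra.adjoin ℂ (Set.range e)
      star_mem' := by
        change Algebra.adjoin ℂ (Set.range e) ≤ star (Algebra.adjoin ℂ (Set.range e))
        refine Algebra.adjoin_le ?_
        rintro _ ⟨n, rfl⟩
        exact Algebra.subset_adjoin ⟨-n, hneg n⟩ }
  have hA : A.toSubalgebra.toSubmodule = Submodule.span ℂ (Set.range e) := by
    apply Algebra.adjoin_eq_span_of_subset
    refine .trans (fun x ↦ Submonoid.closure_induction (fun _ ↦ id) ⟨0, h0⟩ ?_)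
      Submodule.subset_span
    rintro _ _ _ _ ⟨m, rfl⟩ ⟨n, rfl⟩
    exact ⟨m + n, hadd m n⟩
  have hsepA : A.SeparatesPoints := by
    intro x y hxy
    obtain ⟨n, hn⟩ := hsep x y hxy
    exact ⟨_, ⟨e n, Algebra.subset_adjoin ⟨n, rfl⟩, rfl⟩, hn⟩
  rw [← hA]
  exact congr_arg (Subalgebra.toSubmodule <| StarSubalgebra.toSubalgebra ·)
    (ContinuousMap.starSubalgebra_topologicalClosure_eq_top_of_separatesPoints A hsepA)

section Waves

variable {N d : ℕ} {L : ℝ}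

/-- The plane wave on the torus as a continuous map. -/
def waveC (n : Fin d → ℤ) : C(Torus d L, ℂ) :=
  ⟨wave n, by unfold wave; fun_prop⟩

/-- The plane wave of `N` particles as a continuous map. -/
def planeWaveC (n : Fin N → Fin d → ℤ) : C(Config N d L, ℂ) :=
  ⟨planeWave n, by
    unfold planeWave
    exact continuous_finsetProd _ fun j _ => (waveC (n j)).continuous.comp (continuous_apply j)⟩

@[simp] theorem waveC_apply (n : Fin d → ℤ) (y : Torus d L) : waveC n y = wave n y := rfl

@[simp] theorem planeWaveC_apply (n : Fin N → Fin d → ℤ) (x : Config N d L) :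
    planeWaveC n x = planeWave n x := rfl

theorem wave_zero (y : Torus d L) : wave 0 y = 1 := by simp [wave]

theorem wave_add (m n : Fin d → ℤ) (y : Torus d L) : wave (m + n) y = wave m y * wave n y := by
  simp [wave, Finset.prod_mul_distrib]

theorem wave_neg (n : Fin d → ℤ) (y : Torus d L) : wave (-n) y = starRingEnd ℂ (wave n y) := by
  simp [wave, map_prod]

theorem wave_translate (n : Fin d → ℤ) (x y : Torus d L) :
    wave n (x + y) = wave n x * wave n y := by
  simp [wave, Finset.prod_mul_distrib, fourier_apply, smul_add, AddCircle.toCircle_add]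

theorem wave_neg_apply (n : Fin d → ℤ) (y : Torus d L) : wave n (-y) = wave (-n) y := by
  simp [wave, fourier_apply]

theorem planeWave_zero (x : Config N d L) : planeWave 0 x = 1 := by simp [planeWave, wave_zero]

theorem planeWave_add (m n : Fin N → Fin d → ℤ) (x : Config N d L) :
    planeWave (m + n) x = planeWave m x * planeWave n x := by
  simp [planeWave, wave_add, Finset.prod_mul_distrib]

theorem planeWave_neg (n : Fin N → Fin d → ℤ) (x : Config N d L) :
    planeWave (-n) x = starRingEnd ℂ (planeWave n x) := by
  simp [planeWave, wave_neg, map_prod]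

theorem planeWave_single (j : Fin N) (n : Fin d → ℤ) (x : Config N d L) :
    planeWave (Pi.single j n) x = wave n (x j) := by
  rw [planeWave, Finset.prod_eq_single j]
  · simp
  · intro l _ hl
    rw [Pi.single_eq_of_ne hl, wave_zero]
  · simp

theorem wave_single (μ : Fin d) (n : ℤ) (y : Torus d L) :
    wave (Pi.single μ n) y = fourier n (y μ) := by
  rw [wave, Finset.prod_eq_single μ]
  · simp
  · intro l _ hl
    rw [Pi.single_eq_of_ne hl, fourier_zero]
  · simp

variable [hL : Fact (0 < L)]

theorem exists_wave_ne {x y : Torus d L} (h : x ≠ y) : ∃ n, wave n x ≠ wave n y := by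
  obtain ⟨μ, hμ⟩ := Function.ne_iff.1 h
  refine ⟨Pi.single μ 1, ?_⟩
  rw [wave_single, wave_single, fourier_one, fourier_one]
  intro h'
  exact hμ (AddCircle.injective_toCircle hL.out.ne' (Subtype.coe_injective h'))

theorem span_waveC : (Submodule.span ℂ (Set.range (waveC (d := d) (L := L)))).topologicalClosure = ⊤ := by
  refine span_range_topologicalClosure_eq_top _ ?_ ?_ ?_ ?_
  · ext y; simp [wave_zero]
  · intro m n; ext y; simp [wave_add]
  · intro n; ext y; simp [wave_neg]
  · intro x y h; exact exists_wave_ne h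

theorem span_planeWaveC :
    (Submodule.span ℂ (Set.range (planeWaveC (N := N) (d := d) (L := L)))).topologicalClosure = ⊤ := by
  refine span_range_topologicalClosure_eq_top _ ?_ ?_ ?_ ?_
  · ext y; simp [planeWave_zero]
  · intro m n; ext y; simp [planeWave_add]
  · intro n; ext y; simp [planeWave_neg]
  · intro x y h
    obtain ⟨j, hj⟩ := Function.ne_iff.1 h
    obtain ⟨n, hn⟩ := exists_wave_ne hj
    exact ⟨Pi.single j n, by simpa [planeWave_single] using hn⟩

theorem integral_fourier (n : ℤ) : ∫ y : AddCircle L, (fourier n y : ℂ) = if n = 0 then (L : ℂ) else 0 := by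
  have h := orthonormal_iff_ite.1 (orthonormal_fourier (T := L)) 0 n
  rw [ContinuousMap.inner_toLp] at h
  have h2 : ∫ y : AddCircle L, (fourier n y : ℂ) ∂AddCircle.haarAddCircle = if 0 = n then 1 else 0 := by
    rw [← h]
    refine integral_congr_ae (Eventually.of_forall fun y => ?_)
    simp
  rw [AddCircle.volume_eq_smul_haarAddCircle, integral_smul_measure, h2,
    ENNReal.toReal_ofReal hL.out.le]
  by_cases hn : n = 0
  · simp [hn]
  · simp [hn, Ne.symm hn]

theorem integral_wave (n : Fin d → ℤ) :
    ∫ y : Torus d L, wave n y = if n = 0 then ((L : ℂ) ^ d) else 0 := by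
  unfold wave
  rw [integral_fintype_prod_volume_eq_prod (fun μ (y : AddCircle L) => (fourier (n μ) y : ℂ))]
  simp only [integral_fourier]
  split_ifs with h
  · simp [h]
  · obtain ⟨μ, hμ⟩ := Function.ne_iff.1 h
    exact Finset.prod_eq_zero (Finset.mem_univ μ) (if_neg hμ)

theorem integral_planeWave (n : Fin N → Fin d → ℤ) :
    ∫ x : Config N d L, planeWave n x = if n = 0 then (((L : ℂ) ^ d) ^ N) else 0 := by
  unfold planeWave
  rw [integral_fintype_prod_volume_eq_prod (fun j (y : Torus d L) => wave (n j) y)]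
  simp only [integral_wave]
  split_ifs with h
  · simp [h]
  · obtain ⟨μ, hμ⟩ := Function.ne_iff.1 h
    exact Finset.prod_eq_zero (Finset.mem_univ μ) (if_neg hμ)

/-- The square root of the volume of configuration space, the norm of a plane wave. -/
def waveNorm (N d : ℕ) (L : ℝ) : ℝ := √((L ^ d) ^ N)

theorem waveNorm_pos : 0 < waveNorm N d L :=
  Real.sqrt_pos.2 (pow_pos (pow_pos hL.out _) _)

theorem waveNorm_sq : (waveNorm N d L : ℂ) * (waveNorm N d L : ℂ) = ((L : ℂ) ^ d) ^ N := by
  have : waveNorm N d L * waveNorm N d L = (L ^ d) ^ N :=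
    Real.mul_self_sqrt (pow_nonneg (pow_nonneg hL.out.le _) _)
  exact_mod_cast congrArg (fun r : ℝ => (r : ℂ)) this

/-- The plane wave as a vector of the space of wave functions. -/
def planeWaveL (n : Fin N → Fin d → ℤ) : WaveFun N d L :=
  ContinuousMap.toLp (E := ℂ) 2 volume ℂ (planeWaveC n)

theorem inner_planeWaveL (n : Fin N → Fin d → ℤ) (ψ : WaveFun N d L) :
    inner ℂ (planeWaveL n) ψ = coeff ψ n := by
  rw [L2.inner_def, coeff]
  refine integral_congr_ae ?_
  filter_upwards [ContinuousMap.coeFn_toLp (p := 2) (𝕜 := ℂ) (E := ℂ) volume (planeWaveC (L := L) n)] with x hx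
  rw [planeWaveL, hx]
  simp [mul_comm]

theorem orthonormal_planeWave : Orthonormal ℂ fun n : Fin N → Fin d → ℤ =>
    ((waveNorm N d L : ℂ)⁻¹ • planeWaveL (L := L) n) := by
  rw [orthonormal_iff_ite]
  intro m n
  have h : inner ℂ (planeWaveL (L := L) m) (planeWaveL n) =
      if m = n then ((waveNorm N d L : ℂ) * (waveNorm N d L : ℂ)) else 0 := by
    rw [planeWaveL, planeWaveL, ContinuousMap.inner_toLp, waveNorm_sq]
    have : ∫ x : Config N d L, planeWaveC n x * starRingEnd ℂ (planeWaveC m x) =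
        ∫ x : Config N d L, planeWave (n - m) x := by
      congr with x
      rw [sub_eq_add_neg, planeWave_add, planeWave_neg]; rfl
    rw [this, integral_planeWave]
    simp [sub_eq_zero, eq_comm]
  have hne : (waveNorm N d L : ℂ) ≠ 0 := by exact_mod_cast waveNorm_pos.ne'
  rw [inner_smul_left, inner_smul_right, h]
  split_ifs
  · simp
    field_simp
  · simp

/-- The Hilbert basis of normalised plane waves. -/
def planeBasis (N d : ℕ) (L : ℝ) [Fact (0 < L)] :
    HilbertBasis (Fin N → Fin d → ℤ) ℂ (WaveFun N d L) :=
  HilbertBasis.mk orthonormal_planeWave (by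
    have h1 : (Submodule.span ℂ (Set.range (planeWaveL (N := N) (d := d) (L := L)))).topologicalClosure
        = ⊤ := by
      have := (ContinuousMap.toLp_denseRange (p := 2) ℂ
        (volume : Measure (Config N d L)) ℂ (by simp)).topologicalClosure_map_submodule
          span_planeWaveC
      simpa only [Submodule.map_span, ContinuousLinearMap.coe_coe, ← Set.range_comp] using! this
    rw [← h1]
    refine Submodule.topologicalClosure_mono (Submodule.span_le.2 ?_)
    rintro _ ⟨n, rfl⟩
    have hne : (waveNorm N d L : ℂ) ≠ 0 := by exact_mod_cast waveNorm_pos.ne'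
    have := Submodule.smul_mem (Submodule.span ℂ (Set.range fun n : Fin N → Fin d → ℤ =>
      ((waveNorm N d L : ℂ)⁻¹ • planeWaveL (L := L) n))) (waveNorm N d L : ℂ)
      (Submodule.subset_span ⟨n, rfl⟩)
    rwa [smul_smul, mul_inv_cancel₀ hne, one_smul] at this)

theorem planeBasis_apply (n : Fin N → Fin d → ℤ) :
    planeBasis N d L n = (waveNorm N d L : ℂ)⁻¹ • planeWaveL n := by
  rw [planeBasis, HilbertBasis.coe_mk]

theorem coeff_eq (ψ : WaveFun N d L) (n : Fin N → Fin d → ℤ) :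
    coeff ψ n = (waveNorm N d L : ℂ) * inner ℂ (planeBasis N d L n) ψ := by
  have hne : (waveNorm N d L : ℂ) ≠ 0 := by exact_mod_cast waveNorm_pos.ne'
  rw [planeBasis_apply, inner_smul_left, inner_planeWaveL]
  simp
  field_simp

theorem coeff_ext {ψ φ : WaveFun N d L} (h : ∀ n, coeff ψ n = coeff φ n) : ψ = φ := by
  refine HilbertBasis.ext_inner (planeBasis N d L) fun n => ?_
  have hne : (waveNorm N d L : ℂ) ≠ 0 := by exact_mod_cast waveNorm_pos.ne'
  have := h n
  rw [coeff_eq, coeff_eq] at this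
  exact mul_left_cancel₀ hne this

/-- A relation of the form `coeff φ = a * coeff ψ` in terms of the basis of plane waves. -/
theorem coeff_eq_mul_iff {ψ φ : WaveFun N d L} {n : Fin N → Fin d → ℤ} {a : ℂ} :
    coeff φ n = a * coeff ψ n ↔
      inner ℂ (planeBasis N d L n) φ = a * inner ℂ (planeBasis N d L n) ψ := by
  have hne : (waveNorm N d L : ℂ) ≠ 0 := by exact_mod_cast waveNorm_pos.ne'
  rw [coeff_eq, coeff_eq, mul_left_comm, mul_right_inj' hne]

end Waves

/-! ### Multiplication operators, momentum sectors, exchange and complex conjugation -/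

section WaveFunctions

theorem sum_waveNumber {N d : ℕ} {L : ℝ} (n : Fin N → Fin d → ℤ) (μ : Fin d) :
    ∑ j, waveNumber L (n j μ) = waveNumber L ((∑ j, n j) μ) := by
  simp [waveNumber, Finset.mul_sum]

variable {N d : ℕ} {L : ℝ} [hL : Fact (0 < L)]

section Multiplication

/-- Multiplication by a continuous function, as a bounded operator on wave functions which depends
continuously on the function. -/
def mulOp : C(Config N d L, ℂ) →L[ℂ] WaveFun N d L →L[ℂ] WaveFun N d L :=
  ((ContinuousLinearMap.mul ℂ ℂ).holderL volume ⊤ 2 2) ∘L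
    (ContinuousMap.toLp (E := ℂ) ⊤ (volume : Measure (Config N d L)) ℂ)

theorem coeFn_mulOp (F : C(Config N d L, ℂ)) (ψ : WaveFun N d L) :
    mulOp F ψ =ᵐ[volume] fun x => F x * ψ x := by
  have h1 := (ContinuousLinearMap.mul ℂ ℂ).coeFn_holder (r := 2)
    (ContinuousMap.toLp (E := ℂ) ⊤ (volume : Measure (Config N d L)) ℂ F) ψ
  have h2 := ContinuousMap.coeFn_toLp (p := ⊤) (𝕜 := ℂ) (E := ℂ)
    (volume : Measure (Config N d L)) F
  filter_upwards [h1, h2] with x hx1 hx2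
  refine hx1.trans ?_
  rw [hx2, ContinuousLinearMap.mul_apply']

theorem inner_mulOp (F : C(Config N d L, ℂ)) (ψ φ : WaveFun N d L) :
    inner ℂ ψ (mulOp F φ) = matrixElement F ψ φ := by
  rw [L2.inner_def, matrixElement]
  refine integral_congr_ae ?_
  filter_upwards [coeFn_mulOp F φ] with x hx
  rw [hx]
  simp [mul_comm]

theorem inner_mulOp_left (F : C(Config N d L, ℂ)) (ψ φ : WaveFun N d L) :
    inner ℂ (mulOp F ψ) φ = inner ℂ ψ (mulOp (star F) φ) := by
  rw [L2.inner_def, L2.inner_def]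
  refine integral_congr_ae ?_
  filter_upwards [coeFn_mulOp F ψ, coeFn_mulOp (star F) φ] with x hx hx2
  rw [hx, hx2]
  simp
  ring

theorem inner_mulOp_left_of_real {F : C(Config N d L, ℂ)} (hF : star F = F)
    (ψ φ : WaveFun N d L) : inner ℂ (mulOp F ψ) φ = inner ℂ ψ (mulOp F φ) := by
  rw [inner_mulOp_left, hF]

theorem coeff_mulOp_planeWave (k : Fin N → Fin d → ℤ) (ψ : WaveFun N d L)
    (n : Fin N → Fin d → ℤ) : coeff (mulOp (planeWaveC k) ψ) n = coeff ψ (n - k) := by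
  rw [coeff, coeff]
  refine integral_congr_ae ?_
  filter_upwards [coeFn_mulOp (planeWaveC k) ψ] with x hx
  rw [hx, sub_eq_add_neg, planeWave_add, planeWave_neg, map_mul, Complex.conj_conj]
  simp
  ring

end Multiplication

section Sectors

/-- The orthogonal projection onto the wave functions of total momentum `(2π / L) q`. -/
def sectorProj (q : Fin d → ℤ) : WaveFun N d L →L[ℂ] WaveFun N d L :=
  diag (planeBasis N d L) (fun n => ((if ∑ j, n j = q then 1 else 0 : ℝ) : ℂ)) 1
    (fun n => by split_ifs <;> simp)

theorem coeff_sectorProj (q : Fin d → ℤ) (ψ : WaveFun N d L) (n : Fin N → Fin d → ℤ) :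
    coeff (sectorProj q ψ) n = if ∑ j, n j = q then coeff ψ n else 0 := by
  have : coeff (sectorProj q ψ) n = ((if ∑ j, n j = q then 1 else 0 : ℝ) : ℂ) * coeff ψ n := by
    rw [coeff_eq_mul_iff, sectorProj, inner_diag]
  rw [this]
  split_ifs <;> simp

theorem inner_sectorProj_left (q : Fin d → ℤ) (ψ φ : WaveFun N d L) :
    inner ℂ (sectorProj q ψ) φ = inner ℂ ψ (sectorProj q φ) :=
  inner_diag_left _ _ _ _

theorem sectorProj_sectorProj (q q' : Fin d → ℤ) (ψ : WaveFun N d L) :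
    sectorProj q (sectorProj q' ψ) = if q = q' then sectorProj q ψ else 0 := by
  refine coeff_ext fun n => ?_
  split_ifs with h
  · subst h
    simp only [coeff_sectorProj]
    split_ifs <;> rfl
  · have h0 : coeff (0 : WaveFun N d L) n = 0 := by rw [coeff_eq, inner_zero_right, mul_zero]
    simp only [coeff_sectorProj, h0]
    split_ifs with h1 h2
    · exact absurd (h1.symm.trans h2) h
    · rfl
    · rfl

/-- Multiplication by a plane wave of total momentum `p` shifts the momentum sectors by `p`. -/
theorem sectorProj_mulOp_planeWave {k : Fin N → Fin d → ℤ} {p : Fin d → ℤ} (hk : ∑ j, k j = p)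
    (q : Fin d → ℤ) (ψ : WaveFun N d L) :
    sectorProj q (mulOp (planeWaveC k) ψ) = mulOp (planeWaveC k) (sectorProj (q - p) ψ) := by
  refine coeff_ext fun n => ?_
  simp only [coeff_mulOp_planeWave, coeff_sectorProj, Pi.sub_apply, Finset.sum_sub_distrib, hk,
    sub_left_inj]

theorem waveNumber_injective : Function.Injective (waveNumber L) := by
  intro m n h
  have h2 : (2 * Real.pi / L) ≠ 0 := by
    have := hL.out
    positivity
  exact_mod_cast mul_left_cancel₀ h2 h

/-- The wave functions of total momentum `(2π / L) q` are the simultaneous eigenvectors of the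
components of the momentum. -/
theorem forall_isMomentum_iff {q : Fin d → ℤ} {ψ : WaveFun N d L} :
    (∀ μ, IsMomentum μ ψ ((waveNumber L (q μ) : ℂ) • ψ)) ↔ sectorProj q ψ = ψ := by
  have hsmul (c : ℂ) (n : Fin N → Fin d → ℤ) : coeff (c • ψ) n = c * coeff ψ n := by
    rw [coeff_eq, coeff_eq, inner_smul_right, mul_left_comm]
  constructor
  · intro h
    refine coeff_ext fun n => ?_
    rw [coeff_sectorProj]
    split_ifs with hn
    · rfl
    · obtain ⟨μ, hμ⟩ := Function.ne_iff.1 hn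
      have h1 := h μ n
      rw [hsmul, sum_waveNumber] at h1
      rcases mul_eq_mul_right_iff.1 h1 with h2 | h2
      · exact absurd (waveNumber_injective (L := L) (Complex.ofReal_injective h2)) (Ne.symm hμ)
      · exact h2.symm
  · intro h μ n
    rw [hsmul, sum_waveNumber]
    by_cases hn : ∑ j, n j = q
    · rw [hn]
    · have : coeff ψ n = 0 := by rw [← h, coeff_sectorProj, if_neg hn]
      rw [this, mul_zero, mul_zero]

end Sectors

section Permutations

theorem coeFn_permute (σ : Equiv.Perm (Fin N)) (ψ : WaveFun N d L) :
    permute σ ψ =ᵐ[volume] fun x => ψ fun j => x (σ j) :=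
  Lp.coeFn_compMeasurePreserving ψ (measurePreserving_perm σ)

theorem inner_permute (σ : Equiv.Perm (Fin N)) (ψ φ : WaveFun N d L) :
    inner ℂ (permute σ ψ) (permute σ φ) = inner ℂ ψ φ :=
  (Lp.compMeasurePreservingₗᵢ ℂ (fun x : Config N d L => fun j => x (σ j))
    (measurePreserving_perm σ)).inner_map_map ψ φ

theorem permute_planeWaveL (σ : Equiv.Perm (Fin N)) (n : Fin N → Fin d → ℤ) :
    permute σ (planeWaveL (L := L) fun j => n (σ j)) = planeWaveL n := by
  refine Lp.ext ?_
  have h1 := ContinuousMap.coeFn_toLp (p := 2) (𝕜 := ℂ) (E := ℂ) volume (planeWaveC (L := L) n)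
  have h2 := (measurePreserving_perm (d := d) (L := L) σ).quasiMeasurePreserving.ae_eq_comp
    (ContinuousMap.coeFn_toLp (p := 2) (𝕜 := ℂ) (E := ℂ) volume
      (planeWaveC (L := L) fun j => n (σ j)))
  filter_upwards [coeFn_permute σ (planeWaveL (L := L) fun j => n (σ j)), h1, h2] with x hx1 hx2 hx3
  rw [hx1]
  refine hx3.trans ?_
  rw [planeWaveL, hx2]
  exact Equiv.prod_comp σ fun j => wave (n j) (x j)

theorem coeff_permute (σ : Equiv.Perm (Fin N)) (ψ : WaveFun N d L) (n : Fin N → Fin d → ℤ) :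
    coeff (permute σ ψ) n = coeff ψ fun j => n (σ j) := by
  rw [← inner_planeWaveL, ← permute_planeWaveL σ, inner_permute, inner_planeWaveL]

theorem permute_mulOp (σ : Equiv.Perm (Fin N)) {F : C(Config N d L, ℂ)}
    (hF : ∀ x, F (fun j => x (σ j)) = F x) (ψ : WaveFun N d L) :
    permute σ (mulOp F ψ) = mulOp F (permute σ ψ) := by
  refine Lp.ext ?_
  have h2 := (measurePreserving_perm (d := d) (L := L) σ).quasiMeasurePreserving.ae_eq_comp
    (coeFn_mulOp F ψ)
  filter_upwards [coeFn_permute σ (mulOp F ψ), coeFn_mulOp F (permute σ ψ), coeFn_permute σ ψ, h2]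
    with x h1 h2 h3 h4
  rw [h1, h2, h3]
  refine h4.trans ?_
  simp [hF]

theorem permute_sectorProj (σ : Equiv.Perm (Fin N)) (q : Fin d → ℤ) (ψ : WaveFun N d L) :
    permute σ (sectorProj q ψ) = sectorProj q (permute σ ψ) := by
  refine coeff_ext fun n => ?_
  simp only [coeff_permute, coeff_sectorProj, Equiv.sum_comp σ n]

end Permutations

section Conjugation

theorem coeff_star (ψ : WaveFun N d L) (n : Fin N → Fin d → ℤ) :
    coeff (star ψ) n = starRingEnd ℂ (coeff ψ (-n)) := by
  rw [coeff, coeff, ← integral_conj]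
  refine integral_congr_ae ?_
  filter_upwards [Lp.coeFn_star ψ] with x hx
  rw [hx, planeWave_neg]
  simp

theorem inner_star (ψ φ : WaveFun N d L) :
    inner ℂ (star ψ) (star φ) = starRingEnd ℂ (inner ℂ ψ φ) := by
  rw [L2.inner_def, L2.inner_def, ← integral_conj]
  refine integral_congr_ae ?_
  filter_upwards [Lp.coeFn_star ψ, Lp.coeFn_star φ] with x hx hx2
  rw [hx, hx2]
  simp

theorem norm_star (ψ : WaveFun N d L) : ‖star ψ‖ = ‖ψ‖ := by
  have h : ‖star ψ‖ ^ 2 = ‖ψ‖ ^ 2 := by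
    rw [← inner_self_eq_norm_sq (𝕜 := ℂ), ← inner_self_eq_norm_sq (𝕜 := ℂ), inner_star]
    exact Complex.conj_re _
  exact (sq_eq_sq₀ (norm_nonneg _) (norm_nonneg _)).1 h

theorem permute_star (σ : Equiv.Perm (Fin N)) (ψ : WaveFun N d L) :
    permute σ (star ψ) = star (permute σ ψ) := by
  refine coeff_ext fun n => ?_
  simp only [coeff_permute, coeff_star]
  rfl

theorem sectorProj_star (q : Fin d → ℤ) (ψ : WaveFun N d L) :
    sectorProj q (star ψ) = star (sectorProj (-q) ψ) := by
  refine coeff_ext fun n => ?_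
  simp only [coeff_sectorProj, coeff_star, Pi.neg_apply, Finset.sum_neg_distrib, neg_inj]
  split_ifs <;> simp

theorem star_smul_ofReal (r : ℝ) (ψ : WaveFun N d L) : star ((r : ℂ) • ψ) = (r : ℂ) • star ψ := by
  refine Lp.ext ?_
  filter_upwards [Lp.coeFn_star ((r : ℂ) • ψ), Lp.coeFn_smul (r : ℂ) ψ, Lp.coeFn_star ψ,
    Lp.coeFn_smul (r : ℂ) (star ψ)] with x h1 h2 h3 h4
  rw [h1, h4, Pi.star_apply, h2, Pi.smul_apply, Pi.smul_apply, h3]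
  simp

end Conjugation

end WaveFunctions

/-! ### Symmetries of the Hamiltonian -/

section Waves

variable {N d : ℕ} {L : ℝ} [hL : Fact (0 < L)]

theorem coeff_add (ψ φ : WaveFun N d L) (n : Fin N → Fin d → ℤ) :
    coeff (ψ + φ) n = coeff ψ n + coeff φ n := by
  simp only [coeff_eq, inner_add_right, mul_add]

theorem coeff_smul (c : ℂ) (ψ : WaveFun N d L) (n : Fin N → Fin d → ℤ) :
    coeff (c • ψ) n = c * coeff ψ n := by
  rw [coeff_eq, coeff_eq, inner_smul_right, mul_left_comm]

theorem coeff_neg (ψ : WaveFun N d L) (n : Fin N → Fin d → ℤ) : coeff (-ψ) n = - coeff ψ n := by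
  simp only [coeff_eq, inner_neg_right, mul_neg]

/-- The difference of two positions. -/
def positionDiff (j l : Fin N) : C(Config N d L, Torus d L) := ⟨fun x => x j - x l, by fun_prop⟩

/-- The position of one particle. -/
def position (j : Fin N) : C(Config N d L, Torus d L) := ⟨fun x => x j, by fun_prop⟩

theorem dense_span_waveC :
    Dense (Submodule.span ℂ (Set.range (waveC (d := d) (L := L))) : Set C(Torus d L, ℂ)) :=
  Submodule.dense_iff_topologicalClosure_eq_top.2 span_waveC

/-- A two-body potential is translation invariant and hence preserves the total momentum. -/
theorem sectorProj_mulOp_diff (q : Fin d → ℤ) (j l : Fin N) (f : C(Torus d L, ℂ))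
    (ψ : WaveFun N d L) :
    sectorProj q (mulOp (f.comp (positionDiff j l)) ψ) =
      mulOp (f.comp (positionDiff j l)) (sectorProj q ψ) := by
  let Φ₁ : C(Torus d L, ℂ) →L[ℂ] WaveFun N d L :=
    sectorProj q ∘L (mulOp.flip ψ) ∘L (ContinuousMap.compCLM ℂ ℂ (positionDiff j l))
  let Φ₂ : C(Torus d L, ℂ) →L[ℂ] WaveFun N d L :=
    (mulOp.flip (sectorProj q ψ)) ∘L (ContinuousMap.compCLM ℂ ℂ (positionDiff j l))
  have h : Φ₁ = Φ₂ := by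
    refine ContinuousLinearMap.ext_on dense_span_waveC ?_
    rintro _ ⟨n, rfl⟩
    have hc : (waveC n).comp (positionDiff j l) =
        planeWaveC (N := N) (L := L) (Pi.single j n + Pi.single l (-n)) := by
      ext x
      simp [positionDiff, planeWave_add, planeWave_single, sub_eq_add_neg, wave_translate,
        wave_neg_apply]
    have hk : ∑ i, (Pi.single j n + Pi.single l (-n) : Fin N → Fin d → ℤ) i = 0 := by
      simp [Finset.sum_add_distrib]
    change sectorProj q (mulOp ((waveC n).comp (positionDiff j l)) ψ) =
      mulOp ((waveC n).comp (positionDiff j l)) (sectorProj q ψ)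
    rw [hc, sectorProj_mulOp_planeWave hk, sub_zero]
  exact congrArg (fun Φ : C(Torus d L, ℂ) →L[ℂ] WaveFun N d L => Φ f) h

end Waves

/-- A continuous real function as a continuous complex one. -/
def realC {X : Type*} [TopologicalSpace X] (f : X → ℝ) (hf : Continuous f) :
    C(X, ℂ) :=
  ⟨fun x => (f x : ℂ), by fun_prop⟩

theorem star_realC {X : Type*} [TopologicalSpace X] (f : X → ℝ) (hf : Continuous f) :
    star (realC f hf) = realC f hf := by
  ext x
  simp [realC]

namespace System

section Potentials

variable {N d : ℕ} {L : ℝ} (S : System N d L)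

theorem continuous_W (hw : Continuous S.w) : Continuous S.W := by
  unfold W
  fun_prop

theorem continuous_U (hu : Continuous S.u) : Continuous S.U := by
  unfold U
  fun_prop

/-- The double sum over all ordered pairs counts every unordered pair twice. -/
theorem two_mul_W (hev : ∀ y, S.w (-y) = S.w y) (x : Config N d L) :
    ∑ j, ∑ l, S.w (x j - x l) = 2 * S.W x + N * S.w 0 := by
  have h1 (j : Fin N) : ∑ l, S.w (x j - x l) = ∑ l ∈ Finset.Ioi j, S.w (x j - x l) +
      ∑ l ∈ Finset.Iio j, S.w (x j - x l) + S.w 0 := by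
    rw [← Finset.sum_erase_add _ _ (Finset.mem_univ j), sub_self]
    congr 1
    rw [← Finset.sum_union]
    · congr 1
      ext l
      simp [lt_or_lt_iff_ne, ne_comm]
    · rw [Finset.disjoint_left]
      intro l hl
      simp only [Finset.mem_Ioi, Finset.mem_Iio] at hl ⊢
      exact hl.le.not_gt
  have h2 : ∑ j, ∑ l ∈ Finset.Iio j, S.w (x j - x l) = S.W x := by
    unfold W
    rw [Finset.sum_comm' (s' := fun l => Finset.Ioi l) (t' := Finset.univ) (by simp)]
    refine Finset.sum_congr rfl fun l _ => Finset.sum_congr rfl fun j _ => ?_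
    rw [← hev, neg_sub]
  simp only [h1, Finset.sum_add_distrib, h2, Finset.sum_const, Finset.card_univ, Fintype.card_fin,
    nsmul_eq_mul]
  unfold W
  ring

theorem W_perm (hev : ∀ y, S.w (-y) = S.w y) (σ : Equiv.Perm (Fin N)) (x : Config N d L) :
    S.W (fun j => x (σ j)) = S.W x := by
  have h1 := S.two_mul_W hev fun j => x (σ j)
  have h2 := S.two_mul_W hev x
  have h3 : ∑ j, ∑ l, S.w (x (σ j) - x (σ l)) = ∑ j, ∑ l, S.w (x j - x l) := by
    rw [← Equiv.sum_comp σ (fun j => ∑ l, S.w (x j - x l))]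
    exact Finset.sum_congr rfl fun j _ => Equiv.sum_comp σ fun l => S.w (x (σ j) - x l)
  linarith

theorem U_perm (σ : Equiv.Perm (Fin N)) (x : Config N d L) :
    S.U (fun j => x (σ j)) = S.U x :=
  Equiv.sum_comp σ fun j => S.u (x j)

variable [hL : Fact (0 < L)]

theorem sectorProj_mulOp_W (hw : Continuous S.w) (q : Fin d → ℤ) (ψ : WaveFun N d L) :
    sectorProj q (mulOp (realC S.W (S.continuous_W hw)) ψ) =
      mulOp (realC S.W (S.continuous_W hw)) (sectorProj q ψ) := by
  have h : realC S.W (S.continuous_W hw) =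
      ∑ j, ∑ l ∈ Finset.Ioi j, (realC S.w hw).comp (positionDiff j l) := by
    ext x
    simp [realC, W, positionDiff, ContinuousMap.sum_apply]
  simp only [h, map_sum, sum_apply, sectorProj_mulOp_diff]

/-- The Hamiltonian in terms of bounded multiplication operators. -/
theorem isHamiltonian_iff (hw : Continuous S.w) (hu : Continuous S.u) {κ v : ℝ}
    {ψ φ : WaveFun N d L} :
    S.IsHamiltonian κ v ψ φ ↔ ∃ τ π : WaveFun N d L, IsKinetic S.m ψ τ ∧ IsMomentum S.axis ψ π ∧
      φ = τ + mulOp (realC S.W (S.continuous_W hw)) ψ +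
        (κ : ℂ) • mulOp (realC S.U (S.continuous_U hu)) ψ - (v : ℂ) • π := by
  refine exists_congr fun τ => exists_congr fun π => and_congr_right fun _ => and_congr_right fun _ => ?_
  set F := mulOp (realC S.W (S.continuous_W hw)) ψ with hF
  set G := mulOp (realC S.U (S.continuous_U hu)) ψ with hG
  have key : ∀ᵐ x, (τ + F + (κ : ℂ) • G - (v : ℂ) • π : WaveFun N d L) x =
      τ x + ((S.W x + κ * S.U x : ℝ) : ℂ) * ψ x - (v : ℂ) * π x := by
    filter_upwards [Lp.coeFn_sub (τ + F + (κ : ℂ) • G) ((v : ℂ) • π),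
      Lp.coeFn_add (τ + F) ((κ : ℂ) • G), Lp.coeFn_add τ F, Lp.coeFn_smul (κ : ℂ) G,
      Lp.coeFn_smul (v : ℂ) π, coeFn_mulOp (realC S.W (S.continuous_W hw)) ψ,
      coeFn_mulOp (realC S.U (S.continuous_U hu)) ψ] with x h1 h2 h3 h4 h5 h6 h7
    rw [h1, Pi.sub_apply, h2, Pi.add_apply, h3, Pi.add_apply, h4, Pi.smul_apply, h5, Pi.smul_apply,
      hF, hG, h6, h7]
    simp [realC]
    ring
  constructor
  · intro h
    refine Lp.ext ?_
    filter_upwards [h, key] with x h1 h2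
    rw [h1, h2]
  · intro h
    filter_upwards [key] with x h2
    rw [h, h2]

theorem mem_space_iff {ψ : WaveFun N d L} :
    ψ ∈ S.space ↔ ∀ σ : S.G, permute (σ : Equiv.Perm (Fin N)) ψ = (((S.χ σ : ℤˣ) : ℤ) : ℂ) • ψ := by
  simp [space, Submodule.mem_iInf, LinearMap.mem_eqLocus]

theorem mulOp_mem_space {F : C(Config N d L, ℂ)}
    (hF : ∀ (σ : Equiv.Perm (Fin N)) x, F (fun j => x (σ j)) = F x) {ψ : WaveFun N d L}
    (hψ : ψ ∈ S.space) : mulOp F ψ ∈ S.space := by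
  rw [mem_space_iff] at hψ ⊢
  intro σ
  rw [permute_mulOp _ (hF σ), hψ, map_smul]

theorem sectorProj_mem_space (q : Fin d → ℤ) {ψ : WaveFun N d L} (hψ : ψ ∈ S.space) :
    sectorProj q ψ ∈ S.space := by
  rw [mem_space_iff] at hψ ⊢
  intro σ
  rw [permute_sectorProj, hψ, map_smul]

theorem star_mem_space {ψ : WaveFun N d L} (hψ : ψ ∈ S.space) : star ψ ∈ S.space := by
  rw [mem_space_iff] at hψ ⊢
  intro σ
  have h := star_smul_ofReal (((S.χ σ : ℤˣ) : ℤ) : ℝ) ψ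
  rw [Complex.ofReal_intCast] at h
  rw [permute_star, hψ, h]

theorem isClosed_space : IsClosed (S.space : Set (WaveFun N d L)) := by
  have h : (S.space : Set (WaveFun N d L)) = ⋂ σ : S.G,
      {ψ | permute (σ : Equiv.Perm (Fin N)) ψ = (((S.χ σ : ℤˣ) : ℤ) : ℂ) • ψ} := by
    ext ψ
    simp [mem_space_iff]
  rw [h]
  refine isClosed_iInter fun σ => isClosed_eq ?_ (continuous_const_smul _)
  exact (Lp.compMeasurePreservingₗᵢ ℂ (fun x : Config N d L => fun j => x ((σ : Equiv.Perm (Fin N)) j))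
    (measurePreserving_perm _)).continuous

instance : CompleteSpace S.space := S.isClosed_space.completeSpace_coe

end Potentials

section Symmetries

variable {N d : ℕ} {L : ℝ} (S : System N d L) [hL : Fact (0 < L)] {κ v : ℝ} {ψ φ : WaveFun N d L}

/-- Time reversal changes the sign of the velocity. -/
theorem IsHamiltonian.star (h : S.IsHamiltonian κ v ψ φ) :
    S.IsHamiltonian κ (-v) (star ψ) (star φ) := by
  obtain ⟨τ, π, hτ, hπ, hφ⟩ := h
  refine ⟨Star.star τ, - Star.star π, fun n => ?_, fun n => ?_, ?_⟩
  · rw [coeff_star, coeff_star, hτ, map_mul, Complex.conj_ofReal]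
    simp [waveNumber]
  · rw [coeff_neg, coeff_star, coeff_star, hπ, map_mul, Complex.conj_ofReal]
    simp [waveNumber]
  · filter_upwards [hφ, Lp.coeFn_star φ, Lp.coeFn_star ψ, Lp.coeFn_star τ, Lp.coeFn_star π,
      Lp.coeFn_neg (Star.star π)] with x h1 h2 h3 h4 h5 h6
    rw [h2, h3, h4, h6, Pi.neg_apply, h5, Pi.star_apply, h1]
    simp

theorem IsHamiltonian.permute (hw : Continuous S.w) (hev : ∀ y, S.w (-y) = S.w y)
    (hu : Continuous S.u) (σ : Equiv.Perm (Fin N)) (h : S.IsHamiltonian κ v ψ φ) :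
    S.IsHamiltonian κ v (permute σ ψ) (permute σ φ) := by
  rw [S.isHamiltonian_iff hw hu] at h ⊢
  obtain ⟨τ, π, hτ, hπ, rfl⟩ := h
  refine ⟨Superfluid.permute σ τ, Superfluid.permute σ π, fun n => ?_, fun n => ?_, ?_⟩
  · rw [coeff_permute, coeff_permute, hτ]
    rw [Equiv.sum_comp σ fun j => ∑ μ, waveNumber L (n j μ) ^ 2 / (2 * S.m)]
  · rw [coeff_permute, coeff_permute, hπ]
    rw [Equiv.sum_comp σ fun j => waveNumber L (n j S.axis)]
  · rw [map_sub, map_add, map_add, map_smul, map_smul, permute_mulOp, permute_mulOp]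
    · intro x; simp [realC, S.U_perm]
    · intro x; simp [realC, S.W_perm hev]

theorem IsHamiltonian.sectorProj (hw : Continuous S.w) (hu : Continuous S.u) (q : Fin d → ℤ)
    (h : S.IsHamiltonian 0 v ψ φ) :
    S.IsHamiltonian 0 v (sectorProj q ψ) (sectorProj q φ) := by
  rw [S.isHamiltonian_iff hw hu] at h ⊢
  obtain ⟨τ, π, hτ, hπ, rfl⟩ := h
  refine ⟨Superfluid.sectorProj q τ, Superfluid.sectorProj q π, fun n => ?_, fun n => ?_, ?_⟩
  · rw [coeff_sectorProj, coeff_sectorProj, hτ]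
    split_ifs <;> simp
  · rw [coeff_sectorProj, coeff_sectorProj, hπ]
    split_ifs <;> simp
  · simp only [map_sub, map_add, map_smul, S.sectorProj_mulOp_W hw, Complex.ofReal_zero, zero_smul,
      map_zero]

theorem IsHamiltonian.smul (hw : Continuous S.w) (hu : Continuous S.u) (c : ℂ)
    (h : S.IsHamiltonian κ v ψ φ) : S.IsHamiltonian κ v (c • ψ) (c • φ) := by
  rw [S.isHamiltonian_iff hw hu] at h ⊢
  obtain ⟨τ, π, hτ, hπ, rfl⟩ := h
  refine ⟨c • τ, c • π, fun n => ?_, fun n => ?_, ?_⟩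
  · rw [coeff_smul, coeff_smul, hτ, mul_left_comm]
  · rw [coeff_smul, coeff_smul, hπ, mul_left_comm]
  · simp only [map_smul, smul_sub, smul_add, smul_comm c]

/-- The ground state energy is an even function of the velocity, by time reversal. -/
theorem energy_neg (κ v : ℝ) : S.energy κ (-v) = S.energy κ v := by
  have key (v : ℝ) : {e : ℝ | ∃ ψ φ : WaveFun N d L, ψ ∈ S.space ∧ ‖ψ‖ = 1 ∧
      S.IsHamiltonian κ v ψ φ ∧ e = (inner ℂ ψ φ).re} ⊆ {e : ℝ | ∃ ψ φ : WaveFun N d L,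
      ψ ∈ S.space ∧ ‖ψ‖ = 1 ∧ S.IsHamiltonian κ (-v) ψ φ ∧ e = (inner ℂ ψ φ).re} := by
    rintro e ⟨ψ, φ, h1, h2, h3, rfl⟩
    exact ⟨star ψ, star φ, S.star_mem_space h1, by rw [norm_star, h2], h3.star, by
      rw [inner_star, Complex.conj_re]⟩
  have h2 := key (-v)
  rw [neg_neg] at h2
  exact congrArg sInf (h2.antisymm (key v))

end Symmetries

end System

/-! ### The resolvent of the unperturbed Hamiltonian -/

section Kinetic

variable {N d : ℕ} {L : ℝ}

/-- The kinetic energy of a plane wave. -/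
def kineticSymbol (m : ℝ) (n : Fin N → Fin d → ℤ) (L : ℝ) : ℝ :=
  ∑ j, ∑ μ, waveNumber L (n j μ) ^ 2 / (2 * m)

theorem kineticSymbol_nonneg {m : ℝ} (hm : 0 < m) (n : Fin N → Fin d → ℤ) :
    0 ≤ kineticSymbol m n L :=
  Finset.sum_nonneg fun _ _ => Finset.sum_nonneg fun _ _ => by positivity

theorem waveNumber_sq_le_kineticSymbol {m : ℝ} (hm : 0 < m) (n : Fin N → Fin d → ℤ) (j : Fin N)
    (μ : Fin d) : waveNumber L (n j μ) ^ 2 / (2 * m) ≤ kineticSymbol m n L := by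
  refine le_trans ?_ (Finset.single_le_sum (f := fun j => ∑ μ, waveNumber L (n j μ) ^ 2 / (2 * m))
    (fun _ _ => Finset.sum_nonneg fun _ _ => by positivity) (Finset.mem_univ j))
  exact Finset.single_le_sum (f := fun μ => waveNumber L (n j μ) ^ 2 / (2 * m))
    (fun _ _ => by positivity) (Finset.mem_univ μ)

/-- The square of the total momentum is controlled by the kinetic energy. -/
theorem sum_waveNumber_sq_le {m : ℝ} (hm : 0 < m) (n : Fin N → Fin d → ℤ) (μ : Fin d) :
    (∑ j, waveNumber L (n j μ)) ^ 2 ≤ 2 * m * N * kineticSymbol m n L := by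
  have h1 := sq_sum_le_card_mul_sum_sq (s := Finset.univ) (f := fun j => waveNumber L (n j μ))
  have h2 : ∑ j, waveNumber L (n j μ) ^ 2 ≤ 2 * m * kineticSymbol m n L := by
    rw [kineticSymbol, Finset.mul_sum]
    refine Finset.sum_le_sum fun j _ => ?_
    have := Finset.single_le_sum (f := fun μ => waveNumber L (n j μ) ^ 2 / (2 * m))
      (fun _ _ => by positivity) (Finset.mem_univ μ)
    rw [div_le_iff₀ (by positivity)] at this
    linarith
  rw [Finset.card_univ, Fintype.card_fin] at h1
  have h3 : (N : ℝ) * ∑ j, waveNumber L (n j μ) ^ 2 ≤ N * (2 * m * kineticSymbol m n L) := by gcongr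
  linarith

theorem tendsto_kineticSymbol {m : ℝ} (hm : 0 < m) (hL : 0 < L) :
    Tendsto (fun n : Fin N → Fin d → ℤ => kineticSymbol m n L) cofinite atTop := by
  rw [tendsto_atTop]
  intro C
  rw [eventually_cofinite]
  set c := (2 * Real.pi / L) ^ 2 / (2 * m) with hc
  have hc0 : 0 < c := by positivity
  obtain ⟨M, hM⟩ := exists_nat_gt (C / c)
  refine (Set.finite_Icc (fun (_ : Fin N) (_ : Fin d) => -(M : ℤ)) (fun _ _ => (M : ℤ))).subset ?_
  intro n hn
  simp only [Set.mem_ofPred_eq, not_le] at hn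
  have key (j : Fin N) (μ : Fin d) : |n j μ| ≤ M := by
    have h1 := (waveNumber_sq_le_kineticSymbol hm n j μ).trans_lt hn
    have h2 : waveNumber L (n j μ) ^ 2 / (2 * m) = (n j μ : ℝ) ^ 2 * c := by
      rw [waveNumber, hc]; ring
    rw [h2, ← lt_div_iff₀ hc0] at h1
    have h3 : ((n j μ) ^ 2 : ℤ) < M := by exact_mod_cast h1.trans hM
    have h4 : |n j μ| ≤ (n j μ) ^ 2 := by
      rw [← sq_abs]
      exact Int.le_self_sq _
    exact h4.trans h3.le
  exact ⟨fun j μ => (abs_le.1 (key j μ)).1, fun j μ => (abs_le.1 (key j μ)).2⟩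

end Kinetic

namespace System

variable {N d : ℕ} {L : ℝ} (S : System N d L) [hL : Fact (0 < L)]

/-- For large `s` the operator `H₀ + s` has a compact symmetric inverse: it is
`(T + s)⁻¹ (1 + W (T + s)⁻¹)⁻¹`, where the free resolvent `(T + s)⁻¹` is diagonal in the basis of
plane waves and the potential energy `W` is bounded. -/
theorem exists_resolvent (hm : 0 < S.m) (hw : Continuous S.w) (hu : Continuous S.u) :
    ∃ (s : ℝ) (R : WaveFun N d L →L[ℂ] WaveFun N d L), IsCompactOperator R ∧
      (∀ x y, inner ℂ (R x) y = inner ℂ x (R y)) ∧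
      ∀ ψ φ, S.IsHamiltonian 0 0 ψ φ ↔ ψ = R (φ + (s : ℂ) • ψ) := by
  set W := mulOp (realC S.W (S.continuous_W hw)) with hW
  set s := ‖W‖ + 1 with hs
  have hs0 : 0 < s := by positivity
  set t : (Fin N → Fin d → ℤ) → ℝ := fun n => kineticSymbol S.m n L with ht
  have ht0 : ∀ n, 0 ≤ t n := fun n => kineticSymbol_nonneg hm n
  have hpos : ∀ n, 0 < t n + s := fun n => by linarith [ht0 n]
  have hb : ∀ n, ‖((1 / (t n + s) : ℝ) : ℂ)‖ ≤ 1 / s := by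
    intro n
    rw [Complex.norm_real, Real.norm_eq_abs, abs_of_pos (one_div_pos.2 (hpos n))]
    exact one_div_le_one_div_of_le hs0 (by linarith [ht0 n])
  set B := diag (planeBasis N d L) (fun n => ((1 / (t n + s) : ℝ) : ℂ)) (1 / s) hb with hB
  have hBc : IsCompactOperator B := by
    refine isCompactOperator_diag ?_
    have h1 : Tendsto (fun n => 1 / (t n + s)) cofinite (𝓝 0) := by
      simp only [one_div]
      exact tendsto_inv_atTop_zero.comp
        (tendsto_atTop_add_const_right _ _ (tendsto_kineticSymbol hm hL.out))
    have := (Complex.continuous_ofReal.tendsto _).comp h1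
    rwa [Complex.ofReal_zero] at this
  have hBs (x y) : inner ℂ (B x) y = inner ℂ x (B y) := inner_diag_left _ _ _ _
  have hWs (x y) : inner ℂ (W x) y = inner ℂ x (W y) :=
    inner_mulOp_left_of_real (star_realC _ _) x y
  have hnorm : ‖-(W ∘L B)‖ < 1 := by
    rw [norm_neg]
    calc ‖W ∘L B‖ ≤ ‖W‖ * ‖B‖ := ContinuousLinearMap.opNorm_comp_le _ _
      _ ≤ ‖W‖ * (1 / s) := by gcongr; exact norm_diag_le (by positivity)
      _ < 1 := by rw [mul_one_div, div_lt_one hs0]; linarith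
  obtain ⟨m, hmu⟩ : IsUnit (1 - -(W ∘L B)) := (Units.oneSub _ hnorm).isUnit
  set T : WaveFun N d L →L[ℂ] WaveFun N d L := ↑m⁻¹ with hT
  have hT1 (x) : T x + W (B (T x)) = x := by
    have h1 : ((m : WaveFun N d L →L[ℂ] WaveFun N d L) * T) x = x := by rw [hT, m.mul_inv]; rfl
    rw [hmu] at h1
    simpa using h1
  have hT2 (x) : T (x + W (B x)) = x := by
    have h1 : (T * (m : WaveFun N d L →L[ℂ] WaveFun N d L)) x = x := by rw [hT, m.inv_mul]; rfl
    rw [hmu] at h1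
    simpa using h1
  have hcoeff (z : WaveFun N d L) (n) : coeff (B z) n = ((1 / (t n + s) : ℝ) : ℂ) * coeff z n := by
    rw [coeff_eq_mul_iff, hB, inner_diag]
  have hcoeff' (z : WaveFun N d L) (n) : coeff z n = ((t n + s : ℝ) : ℂ) * coeff (B z) n := by
    rw [hcoeff, ← mul_assoc, ← Complex.ofReal_mul, mul_one_div_cancel (hpos n).ne',
      Complex.ofReal_one, one_mul]
  have hkin (z τ : WaveFun N d L) : IsKinetic S.m (B z) τ ↔ τ = z - (s : ℂ) • B z := by
    have h1 : IsKinetic S.m (B z) (z - (s : ℂ) • B z) := by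
      intro n
      change _ = ((t n : ℝ) : ℂ) * _
      rw [sub_eq_add_neg, coeff_add, coeff_neg, coeff_smul, hcoeff' z n]
      push_cast
      ring
    constructor
    · intro h
      exact coeff_ext fun n => by rw [h n, h1 n]
    · rintro rfl
      exact h1
  refine ⟨s, B ∘L T, hBc.comp_clm T, ?_, ?_⟩
  · intro x y
    change inner ℂ (B (T x)) y = inner ℂ x (B (T y))
    have h1 : inner ℂ (B (T x)) y = inner ℂ (B (T x)) (T y + W (B (T y))) := by rw [hT1]
    have h2 : inner ℂ x (B (T y)) = inner ℂ (T x + W (B (T x))) (B (T y)) := by rw [hT1]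
    rw [h1, h2, inner_add_right, inner_add_left, hBs, hWs]
  · intro ψ φ
    rw [S.isHamiltonian_iff hw hu]
    constructor
    · rintro ⟨τ, π, hτ, -, rfl⟩
      have h1 : ψ = B (τ + (s : ℂ) • ψ) := by
        refine coeff_ext fun n => ?_
        rw [hcoeff, coeff_add, coeff_smul, hτ n]
        change _ = _ * (((t n : ℝ) : ℂ) * _ + _)
        have : ((t n + s : ℝ) : ℂ) ≠ 0 := by exact_mod_cast (hpos n).ne'
        push_cast at this ⊢
        field_simp
      have h2 : τ + W ψ + ((0 : ℝ) : ℂ) • mulOp (realC S.U (S.continuous_U hu)) ψ -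
          ((0 : ℝ) : ℂ) • π + (s : ℂ) • ψ = (τ + (s : ℂ) • ψ) + W (B (τ + (s : ℂ) • ψ)) := by
        rw [← h1]
        simp only [Complex.ofReal_zero, zero_smul]
        abel
      rw [h2]
      change ψ = B (T _)
      rw [hT2]
      exact h1
    · intro h
      set z := T (φ + (s : ℂ) • ψ) with hz
      have h1 : ψ = B z := h
      have h2 : z + W ψ = φ + (s : ℂ) • ψ := by rw [h1, hz, hT1, ← hz, ← h1]
      -- the momentum is bounded relative to the kinetic energy
      set C := 1 / s + 2 * S.m * N with hC
      have hkb : ∀ n : Fin N → Fin d → ℤ,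
          ‖((∑ j, waveNumber L (n j S.axis)) / (t n + s) : ℝ) * (1 : ℂ)‖ ≤ C := by
        intro n
        set k := ∑ j, waveNumber L (n j S.axis) with hk
        have h3 : k ^ 2 ≤ 2 * S.m * N * t n := sum_waveNumber_sq_le hm n S.axis
        rw [mul_one, Complex.norm_real, Real.norm_eq_abs, abs_div, abs_of_pos (hpos n),
          div_le_iff₀ (hpos n)]
        have h4 : |k| ≤ 1 + k ^ 2 := by
          rw [← sq_abs]
          nlinarith [sq_nonneg (|k| - 1), abs_nonneg k]
        have h5 : 1 ≤ 1 / s * (t n + s) := by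
          rw [one_div, inv_mul_eq_div, one_le_div hs0]
          linarith [ht0 n]
        have h6 : 2 * S.m * N * t n ≤ 2 * S.m * N * (t n + s) := by
          gcongr
          linarith
        rw [hC]
        nlinarith
      refine ⟨z - (s : ℂ) • ψ, diag (planeBasis N d L) _ C hkb z, ?_, ?_, ?_⟩
      · rw [h1, hkin]
      · intro n
        have h3 : coeff (diag (planeBasis N d L) _ C hkb z) n =
            (((∑ j, waveNumber L (n j S.axis)) / (t n + s) : ℝ) * (1 : ℂ)) * coeff z n := by
          rw [coeff_eq_mul_iff, inner_diag]
        have : ((t n + s : ℝ) : ℂ) ≠ 0 := by exact_mod_cast (hpos n).ne'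
        rw [h3, h1, hcoeff' z n]
        push_cast at this ⊢
        field_simp
      · simp only [Complex.ofReal_zero, zero_smul]
        have h3 : z = φ + (s : ℂ) • ψ - W ψ := by rw [← h2]; abel
        rw [h3]
        abel

end System

/-! ### Joint eigenbases -/

section JointSpectralTheorem

variable {K J : Type*} [NormedAddCommGroup K] [InnerProductSpace ℂ K] [CompleteSpace K]

/-- The spectral theorem for an injective compact symmetric operator which commutes with a complete
family of mutually orthogonal projections: there is a Hilbert basis of joint eigenvectors. -/
theorem exists_hilbertBasis_joint (R : K →L[ℂ] K) (P : J → K →L[ℂ] K) (hRc : IsCompactOperator R)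
    (hRs : ∀ x y, inner ℂ (R x) y = inner ℂ x (R y)) (hRi : ∀ x, R x = 0 → x = 0)
    (hPs : ∀ q x y, inner ℂ (P q x) y = inner ℂ x (P q y)) (hPP : ∀ q x, P q (P q x) = P q x)
    (hPo : ∀ q q' x, q ≠ q' → P q (P q' x) = 0) (hRP : ∀ q x, R (P q x) = P q (R x))
    (hP : ∀ x, (∀ q, P q x = 0) → x = 0) :
    ∃ (w : ℂ × J → Set K) (b : HilbertBasis (Σ i, w i) ℂ K),
      ∀ a, R (b a) = a.1.1 • b a ∧ P a.1.2 (b a) = b a := by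
  let V : ℂ × J → Submodule ℂ K := fun i =>
    LinearMap.eqLocus (R : K →ₗ[ℂ] K) (i.1 • LinearMap.id) ⊓
      LinearMap.eqLocus (P i.2 : K →ₗ[ℂ] K) LinearMap.id
  have hV (i : ℂ × J) (x : K) : x ∈ V i ↔ R x = i.1 • x ∧ P i.2 x = x := by
    simp [V, LinearMap.mem_eqLocus]
  have hVc (i : ℂ × J) : CompleteSpace (V i) := by
    have : (V i : Set K) = {x | R x = i.1 • x} ∩ {x | P i.2 x = x} := by
      ext x
      simp only [SetLike.mem_coe, hV]
      rfl
    have hcl : IsClosed (V i : Set K) := by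
      rw [this]
      exact (isClosed_eq R.continuous (continuous_const_smul _)).inter
        (isClosed_eq (P i.2).continuous continuous_id)
    exact hcl.completeSpace_coe
  have horth : OrthogonalFamily ℂ (fun i => V i) fun i => (V i).subtypeₗᵢ := by
    rintro ⟨r, q⟩ ⟨r', q'⟩ hne ⟨x, hx⟩ ⟨y, hy⟩
    change inner ℂ x y = 0
    rw [hV] at hx hy
    by_cases hq : q = q'
    · have hr : r ≠ r' := fun h => hne (by rw [h, hq])
      have hsym : (R : K →ₗ[ℂ] K).IsSymmetric := fun x y => hRs x y
      exact hsym.orthogonalFamily_eigenspaces hr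
        (⟨x, Module.End.mem_eigenspace_iff.2 hx.1⟩ : Module.End.eigenspace (R : K →ₗ[ℂ] K) r)
        (⟨y, Module.End.mem_eigenspace_iff.2 hy.1⟩ : Module.End.eigenspace (R : K →ₗ[ℂ] K) r')
    · rw [← hx.2, ← hy.2, hPs, hPo q q' y hq, inner_zero_right]
  choose w0 b0 hb0 using fun i => exists_hilbertBasis ℂ (V i)
  let w : ℂ × J → Set K := fun i => Subtype.val '' w0 i
  let g : (i : ℂ × J) → w i → V i := fun i a => ⟨a.1, by
    obtain ⟨x, _, hx⟩ := a.2
    rw [← hx]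
    exact x.2⟩
  have hgmem (i : ℂ × J) (a : w i) : g i a ∈ w0 i := by
    obtain ⟨x, hx, hxa⟩ := a.2
    have : g i a = x := Subtype.ext hxa.symm
    rw [this]
    exact hx
  have hgo (i : ℂ × J) : Orthonormal ℂ (g i) := by
    have h1 : Orthonormal ℂ ((↑) : w0 i → V i) := by
      rw [← hb0 i]
      exact (b0 i).orthonormal
    have h2 : g i = ((↑) : w0 i → V i) ∘ fun a => ⟨g i a, hgmem i a⟩ := rfl
    rw [h2]
    refine h1.comp _ fun a b hab => ?_
    have h3 := congrArg (fun z : w0 i => ((z : V i) : K)) hab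
    exact Subtype.ext h3
  have hortho := horth.orthonormal_sigma_orthonormal hgo
  -- a vector orthogonal to all joint eigenspaces vanishes
  have hzero (x : K) (hx : ∀ i, ∀ y ∈ V i, inner ℂ y x = 0) : x = 0 := by
    refine hP x fun q => ?_
    let C : K →L[ℂ] K := R ∘L P q
    have hCs : C.IsSymmetric := fun y z => by
      change inner ℂ (R (P q y)) z = inner ℂ y (R (P q z))
      rw [hRs, hPs, hRP]
    have hC := ContinuousLinearMap.orthogonalComplement_iSup_eigenspaces_eq_bot
      (hRc.comp_clm (P q) : IsCompactOperator C) hCs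
    have hmem : P q x ∈ (⨆ μ, Module.End.eigenspace (C : Module.End ℂ K) μ)ᗮ := by
      rw [← Submodule.iInf_orthogonal, Submodule.mem_iInf]
      intro r
      rw [Submodule.mem_orthogonal]
      intro y hy
      have hy1 : R (P q y) = r • y := Module.End.mem_eigenspace_iff.1 hy
      rw [← hPs]
      by_cases hr : r = 0
      · rw [hr, zero_smul] at hy1
        rw [hRi _ hy1, inner_zero_left]
      · have hy2 : P q y = y := by
          have h1 : P q (r • y) = r • y := by rw [← hy1, ← hRP, hPP]
          rw [map_smul] at h1
          exact smul_right_injective K hr h1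
        rw [hy2]
        exact hx (r, q) y ((hV _ _).2 ⟨by rw [← hy1, hy2], hy2⟩)
    rw [hC] at hmem
    simpa using hmem
  have hspan : (Submodule.span ℂ (Set.range fun a : Σ i, w i => (V a.1).subtypeₗᵢ (g a.1 a.2)))ᗮ = ⊥ := by
    rw [eq_bot_iff]
    intro x hx
    rw [Submodule.mem_orthogonal] at hx
    refine (Submodule.mem_bot ℂ).2 (hzero x fun i y hy => ?_)
    have h1 : (innerSL ℂ x) ∘L (V i).subtypeL = 0 := by
      refine ContinuousLinearMap.ext_on
        (Submodule.dense_iff_topologicalClosure_eq_top.2 (b0 i).dense_span) ?_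
      rintro _ ⟨z, rfl⟩
      have hz : b0 i z = z := by rw [hb0 i]
      have h2 := hx ((b0 i z : V i) : K) (Submodule.subset_span
        ⟨⟨i, ⟨(z : V i), Set.mem_image_of_mem _ z.2⟩⟩, by rw [hz]; rfl⟩)
      change inner ℂ x ((b0 i z : V i) : K) = 0
      rw [← inner_conj_symm, h2, map_zero]
    have h2 : inner ℂ x y = (0 : ℂ) := congrArg (fun T : V i →L[ℂ] ℂ => T ⟨y, hy⟩) h1
    rw [← inner_conj_symm, h2, map_zero]
  refine ⟨w, HilbertBasis.mkOfOrthogonalEqBot hortho hspan, fun a => ?_⟩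
  rw [HilbertBasis.coe_mkOfOrthogonalEqBot]
  exact (hV _ _).1 (g a.1 a.2).2

/-- A reindexing of a Hilbert basis. -/
theorem exists_hilbertBasis_reindex {I I' : Type*} (b : HilbertBasis I ℂ K) (e : I' ≃ I) :
    ∃ b' : HilbertBasis I' ℂ K, ∀ i, b' i = b (e i) := by
  refine ⟨HilbertBasis.mk (v := fun i => b (e i)) (b.orthonormal.comp e e.injective) ?_, fun i => ?_⟩
  · have : Set.range (fun i => b (e i)) = Set.range b := e.surjective.range_comp b
    rw [this, b.dense_span]
  · rw [HilbertBasis.coe_mk]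

end JointSpectralTheorem

/-! ### The resolvent on wave functions of given statistics -/

namespace System

section ResolventOnSpace

variable {N d : ℕ} {L : ℝ} (S : System N d L) [hL : Fact (0 < L)] {κ v : ℝ} {ψ φ φ' : WaveFun N d L}

theorem IsHamiltonian.unique (hw : Continuous S.w) (hu : Continuous S.u)
    (h : S.IsHamiltonian κ v ψ φ) (h' : S.IsHamiltonian κ v ψ φ') : φ = φ' := by
  rw [S.isHamiltonian_iff hw hu] at h h'
  obtain ⟨τ, π, hτ, hπ, rfl⟩ := h
  obtain ⟨τ', π', hτ', hπ', rfl⟩ := h'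
  have h1 : τ = τ' := coeff_ext fun n => by rw [hτ, hτ']
  have h2 : π = π' := coeff_ext fun n => by rw [hπ, hπ']
  rw [h1, h2]

theorem IsHamiltonian.mem_space (hw : Continuous S.w) (hev : ∀ y, S.w (-y) = S.w y)
    (hu : Continuous S.u) (h : S.IsHamiltonian κ v ψ φ) (hψ : ψ ∈ S.space) : φ ∈ S.space := by
  rw [S.mem_space_iff] at hψ ⊢
  intro σ
  have h1 := h.permute S hw hev hu σ
  rw [hψ σ] at h1
  exact h1.unique S hw hu (h.smul S hw hu _)

/-- The projection onto total momentum `(2π / L) q` in the Hilbert space of the system. -/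
def sector (q : Fin d → ℤ) : S.space →L[ℂ] S.space :=
  (sectorProj q).restrict fun _ => S.sectorProj_mem_space q

@[simp] theorem coe_sector (q : Fin d → ℤ) (x : S.space) :
    (S.sector q x : WaveFun N d L) = sectorProj q (x : WaveFun N d L) := rfl

/-- The resolvent of `H₀` on the Hilbert space of the system. -/
theorem exists_resolvent_space (hm : 0 < S.m) (hw : Continuous S.w)
    (hev : ∀ y, S.w (-y) = S.w y) (hu : Continuous S.u) :
    ∃ (s : ℝ) (R : S.space →L[ℂ] S.space), IsCompactOperator R ∧
      (∀ x y, inner ℂ (R x) y = inner ℂ x (R y)) ∧ (∀ x, R x = 0 → x = 0) ∧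
      (∀ q x, R (S.sector q x) = S.sector q (R x)) ∧
      ∀ ψ φ : S.space, S.IsHamiltonian 0 0 (ψ : WaveFun N d L) φ ↔ ψ = R (φ + (s : ℂ) • ψ) := by
  obtain ⟨s, R, hRc, hRs, hR⟩ := S.exists_resolvent hm hw hu
  have hR' (y : WaveFun N d L) : S.IsHamiltonian 0 0 (R y) (y - (s : ℂ) • R y) := by
    rw [hR, sub_add_cancel]
  have hmem : ∀ y ∈ S.space, R y ∈ S.space := by
    intro y hy
    rw [S.mem_space_iff] at hy ⊢
    intro σ
    have h := (hR' y).permute S hw hev hu σ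
    rw [hR, map_sub, map_smul, sub_add_cancel, hy σ, map_smul] at h
    exact h
  have hc := IsCompactOperator.restrict' (f := (R : WaveFun N d L →ₗ[ℂ] WaveFun N d L)) hRc hmem
  refine ⟨s, R.restrict hmem, hc, fun x y => hRs x y, fun x hx => ?_, fun q x => ?_, fun ψ φ => ?_⟩
  · have h0 : R x = 0 := congrArg Subtype.val hx
    have h1 := hR' (x : WaveFun N d L)
    rw [h0, smul_zero, sub_zero] at h1
    have h2 := h1.smul S hw hu 0
    rw [zero_smul, zero_smul] at h2
    exact Subtype.ext (h1.unique S hw hu h2)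
  · have h := (hR' (x : WaveFun N d L)).sectorProj S hw hu q
    rw [hR, map_sub, map_smul, sub_add_cancel] at h
    exact Subtype.ext h.symm
  · rw [hR]
    exact (Subtype.ext_iff (a1 := ψ) (a2 := R.restrict hmem (φ + (s : ℂ) • ψ))).symm

theorem IsHamiltonian.inner_comm (hm : 0 < S.m) (hw : Continuous S.w) (hu : Continuous S.u)
    {ψ' φ' : WaveFun N d L} (h : S.IsHamiltonian 0 0 ψ φ) (h' : S.IsHamiltonian 0 0 ψ' φ') :
    inner ℂ φ ψ' = inner ℂ ψ φ' := by
  obtain ⟨s, R, -, hRs, hR⟩ := S.exists_resolvent hm hw hu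
  rw [hR] at h h'
  have h1 := hRs (φ + (s : ℂ) • ψ) (φ' + (s : ℂ) • ψ')
  rw [← h, ← h', inner_add_right, inner_add_left, inner_smul_left, inner_smul_right,
    Complex.conj_ofReal] at h1
  exact (add_right_cancel h1).symm

theorem sector_ext {x : S.space} (h : ∀ q, S.sector q x = 0) : x = 0 := by
  refine Subtype.ext (coeff_ext fun n => ?_)
  have h1 : sectorProj (∑ j, n j) (x : WaveFun N d L) = 0 := congrArg Subtype.val (h (∑ j, n j))
  have h2 := coeff_sectorProj (∑ j, n j) (x : WaveFun N d L) n
  rw [if_pos rfl, h1] at h2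
  exact h2.symm

theorem sector_sector (q q' : Fin d → ℤ) (x : S.space) :
    S.sector q (S.sector q' x) = if q = q' then S.sector q x else 0 := by
  refine Subtype.ext ((sectorProj_sectorProj q q' _).trans ?_)
  split_ifs <;> rfl

theorem inner_sector_left (q : Fin d → ℤ) (x y : S.space) :
    inner ℂ (S.sector q x) y = inner ℂ x (S.sector q y) :=
  inner_sectorProj_left q _ _

/-- The boost `e^{i k · (x_1 + ⋯ + x_N)}` shifts the total momentum by `N k`. -/
theorem exists_boost (k q : Fin d → ℤ) {x : S.space} (hx : S.sector q x ≠ 0) :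
    ∃ y : S.space, S.sector (q + N • k) y ≠ 0 := by
  have hk : ∑ _j : Fin N, k = N • k := by simp
  refine ⟨⟨mulOp (planeWaveC fun _ => k) (x : WaveFun N d L), S.mulOp_mem_space
    (fun σ y => Equiv.prod_comp σ fun j => wave k (y j)) x.2⟩, fun h => hx ?_⟩
  refine Subtype.ext (coeff_ext fun n => ?_)
  have h1 : sectorProj (q + N • k) (mulOp (planeWaveC fun _ => k) (x : WaveFun N d L)) = 0 :=
    congrArg Subtype.val h
  have h2 := coeff_mulOp_planeWave (fun _ => k) (sectorProj q (x : WaveFun N d L)) (n + fun _ => k)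
  rw [sectorProj_mulOp_planeWave hk, add_sub_cancel_right] at h1
  rw [h1, add_sub_cancel_right] at h2
  rw [coe_sector, ← h2]
  simp [coeff_eq]

/-- A nonzero wave function can be boosted to infinitely many values of the total momentum. -/
theorem infinite_sector_ne_zero (hN : 0 < N) {x : S.space} (hx : x ≠ 0) :
    {q | ∃ y, S.sector q y ≠ 0}.Infinite := by
  obtain ⟨q₀, hq₀⟩ : ∃ q, S.sector q x ≠ 0 := by
    by_contra! h
    exact hx (S.sector_ext h)
  refine Set.infinite_of_injective_forall_mem
    (f := fun k : ℤ => q₀ + N • Pi.single S.axis k) ?_ fun k => S.exists_boost _ _ hq₀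
  intro k k' h
  have h1 := congrFun h S.axis
  simp only [Pi.add_apply, Pi.smul_apply, Pi.single_eq_same, add_right_inj] at h1
  simpa [hN.ne'] using h1

/-- The Hilbert space of the system is separable. -/
theorem countable_index {I : Type*} (b : HilbertBasis I ℂ S.space) : Countable I := by
  have hon : Orthonormal ℂ fun i => (b i : WaveFun N d L) :=
    b.orthonormal.comp_linearIsometry S.space.subtypeₗᵢ
  have h1 (n : Fin N → Fin d → ℤ) :
      {i | inner ℂ (b i : WaveFun N d L) (planeBasis N d L n) ≠ 0}.Countable := by
    have h2 := (hon.inner_products_summable (planeBasis N d L n)).countable_support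
    refine h2.mono fun i hi => ?_
    simpa using hi
  refine Set.countable_univ_iff.1 ((Set.countable_iUnion h1).mono fun i _ => ?_)
  rw [Set.mem_iUnion]
  by_contra! h
  have h0 : (b i : WaveFun N d L) = 0 := by
    refine HilbertBasis.ext_inner (planeBasis N d L) fun n => ?_
    have := h n
    simp only [Set.mem_ofPred_eq, ne_eq, not_not] at this
    rw [inner_zero_right, ← inner_conj_symm, this, map_zero]
  exact hon.ne_zero i h0

end ResolventOnSpace

end System

/-! ### Existence of a momentum eigenbasis -/

section Generic

variable {K ι : Type*} [NormedAddCommGroup K] [InnerProductSpace ℂ K]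

theorem hasSum_mul_norm_sq_inner (b : HilbertBasis ι ℂ K) {t : ι → ℝ} {x y : K}
    (h : ∀ i, inner ℂ (b i) y = (t i : ℂ) * inner ℂ (b i) x) :
    HasSum (fun i => t i * ‖inner ℂ (b i) x‖ ^ 2) (inner ℂ x y).re := by
  refine (Complex.hasSum_re (b.hasSum_inner_mul_inner x y)).congr_fun fun i => ?_
  rw [h, ← inner_conj_symm x (b i), mul_left_comm, mul_comm ((starRingEnd ℂ) _),
    Complex.mul_conj, Complex.normSq_eq_norm_sq]
  norm_cast

/-- The eigenvalues of a compact operator along an orthonormal sequence of eigenvectors tend to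
zero. -/
theorem tendsto_eigenvalue_of_isCompactOperator {R : K →L[ℂ] K} (hR : IsCompactOperator R)
    {v : ℕ → K} (hv : Orthonormal ℂ v) {r : ℕ → ℝ} (hr : ∀ n, R (v n) = (r n : ℂ) • v n) :
    Tendsto r atTop (𝓝 0) := by
  rw [Metric.tendsto_atTop]
  by_contra! h
  obtain ⟨ε, hε, h⟩ := h
  obtain ⟨φ, hφ, hφr⟩ := Nat.exists_strictMono_subsequence
    (P := fun n => ε ≤ dist (r n) 0) fun n => (h (n + 1)).imp fun _ hk => hk
  have hc := hR.isCompact_closure_image_closedBall 1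
  obtain ⟨a, -, ψ, hψ, ha⟩ := hc.tendsto_subseq (x := fun n => R (v (φ n))) fun n =>
    subset_closure ⟨v (φ n), by simp [hv.1], rfl⟩
  have hC := ha.cauchySeq
  rw [Metric.cauchySeq_iff'] at hC
  obtain ⟨M, hM⟩ := hC ε hε
  have h1 := hM (M + 1) (Nat.le_succ M)
  have hne : φ (ψ (M + 1)) ≠ φ (ψ M) := fun h => by
    have := hψ.injective (hφ.injective h)
    omega
  have h2 : ‖R (v (φ (ψ (M + 1)))) - R (v (φ (ψ M)))‖ ^ 2 =
      r (φ (ψ (M + 1))) ^ 2 + r (φ (ψ M)) ^ 2 := by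
    rw [hr, hr, @norm_sub_sq ℂ, norm_smul, norm_smul, hv.1, hv.1, inner_smul_left, inner_smul_right,
      hv.2 hne]
    simp
  have h3 := hφr (ψ (M + 1))
  simp only [Function.comp_apply, dist_eq_norm, sub_zero, Real.norm_eq_abs] at h1 h3
  have h4 := pow_lt_pow_left₀ h1 (norm_nonneg _) two_ne_zero
  have h5 := pow_le_pow_left₀ hε.le h3 2
  rw [h2] at h4
  rw [sq_abs] at h5
  nlinarith [sq_nonneg (r (φ (ψ M)))]

end Generic

section Kinetic

variable {N d : ℕ} {L : ℝ} [hL : Fact (0 < L)] {ψ τ : WaveFun N d L}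

theorem IsKinetic.re_inner_nonneg {m : ℝ} (hm : 0 < m) (h : IsKinetic m ψ τ) :
    0 ≤ (inner ℂ ψ τ).re :=
  (hasSum_mul_norm_sq_inner (planeBasis N d L) fun n => coeff_eq_mul_iff.1 (h n)).nonneg fun n =>
    mul_nonneg (kineticSymbol_nonneg hm n) (sq_nonneg _)

/-- The kinetic energy dominates the square of the total momentum. -/
theorem IsKinetic.momentum_sq_le {m : ℝ} (hm : 0 < m) (h : IsKinetic m ψ τ)
    {q : Fin d → ℤ} (hq : sectorProj q ψ = ψ) (μ : Fin d) :
    waveNumber L (q μ) ^ 2 * ‖ψ‖ ^ 2 ≤ 2 * m * N * (inner ℂ ψ τ).re := by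
  have h1 := (hasSum_mul_norm_sq_inner (planeBasis N d L)
    fun n => coeff_eq_mul_iff.1 (h n)).mul_left (2 * m * N)
  have h2 := (hasSum_norm_sq_inner (planeBasis N d L) ψ).mul_left (waveNumber L (q μ) ^ 2)
  refine hasSum_le (fun n => ?_) h2 h1
  by_cases hn : ∑ j, n j = q
  · rw [← mul_assoc]
    refine mul_le_mul_of_nonneg_right ?_ (sq_nonneg _)
    have h3 := sum_waveNumber_sq_le (L := L) hm n μ
    rw [sum_waveNumber, hn] at h3
    exact h3
  · have h3 : coeff ψ n = ((0 : ℝ) : ℂ) * coeff ψ n := by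
      rw [Complex.ofReal_zero, zero_mul, ← hq, coeff_sectorProj, if_neg hn]
    rw [coeff_eq_mul_iff] at h3
    rw [h3]
    simp

end Kinetic

namespace System

section Spectrum

variable {N d : ℕ} {L : ℝ} (S : System N d L) [hL : Fact (0 < L)] {κ v : ℝ} {ψ φ : WaveFun N d L}

/-- The kinetic energy exceeds the energy by at most the bound of the potential energy. -/
theorem IsHamiltonian.exists_kinetic_le (hw : Continuous S.w) (hu : Continuous S.u)
    (h : S.IsHamiltonian 0 0 ψ φ) :
    ∃ τ, IsKinetic S.m ψ τ ∧ (inner ℂ ψ τ).re ≤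
      (inner ℂ ψ φ).re + ‖mulOp (realC S.W (S.continuous_W hw))‖ * ‖ψ‖ ^ 2 := by
  rw [S.isHamiltonian_iff hw hu] at h
  obtain ⟨τ, π, hτ, -, rfl⟩ := h
  refine ⟨τ, hτ, ?_⟩
  set W := mulOp (realC S.W (S.continuous_W hw)) with hW
  have h1 : |(inner ℂ ψ (W ψ)).re| ≤ ‖W‖ * ‖ψ‖ ^ 2 := by
    refine (Complex.abs_re_le_norm _).trans ((norm_inner_le_norm _ _).trans ?_)
    have := W.le_opNorm ψ
    nlinarith [norm_nonneg ψ]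
  have h2 := (abs_le.1 h1).1
  simp only [Complex.ofReal_zero, zero_smul, sub_zero, add_zero, inner_add_right, Complex.add_re]
  linarith

theorem energy_le_re_inner (hm : 0 < S.m) (hw : Continuous S.w) (hu : Continuous S.u)
    (h : S.IsHamiltonian 0 0 ψ φ) (hψ : ψ ∈ S.space) (h1 : ‖ψ‖ = 1) :
    S.energy 0 0 ≤ (inner ℂ ψ φ).re := by
  refine csInf_le ⟨-‖mulOp (realC S.W (S.continuous_W hw))‖, ?_⟩ ⟨ψ, φ, hψ, h1, h, rfl⟩
  rintro _ ⟨ψ', φ', -, h1', h', rfl⟩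
  obtain ⟨τ, hτ, hle⟩ := h'.exists_kinetic_le S hw hu
  have := hτ.re_inner_nonneg hm
  rw [h1'] at hle
  linarith

/-- The Hilbert space has an orthonormal basis of simultaneous eigenvectors of the energy and the
momentum. -/
theorem exists_isMomentumEigenbasis (hN : 0 < N) (hm : 0 < S.m) (hw : Continuous S.w)
    (hev : ∀ y, S.w (-y) = S.w y) (hu : Continuous S.u) (hground : S.UniqueGroundState) :
    ∃ Ω E q, S.IsMomentumEigenbasis Ω E q := by
  obtain ⟨s, R, hRc, hRs, hRi, hRP, hR⟩ := S.exists_resolvent_space hm hw hev hu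
  obtain ⟨w, b, hb⟩ := exists_hilbertBasis_joint R S.sector hRc hRs hRi S.inner_sector_left
    (fun q x => by rw [sector_sector, if_pos rfl]) (fun q q' x h => by rw [sector_sector, if_neg h])
    hRP (fun x => S.sector_ext)
  have hr (a) : ∃ e : ℝ, S.IsHamiltonian 0 0 (b a : WaveFun N d L) ((e : ℂ) • (b a : WaveFun N d L)) := by
    have h1 : (a.1.1 : ℂ) ≠ 0 := fun h => b.orthonormal.ne_zero a (hRi _ (by rw [(hb a).1, h, zero_smul]))
    have h2 : starRingEnd ℂ a.1.1 = a.1.1 := by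
      have := hRs (b a) (b a)
      rw [(hb a).1, inner_smul_left, inner_smul_right] at this
      exact mul_right_cancel₀ (inner_self_ne_zero.2 (b.orthonormal.ne_zero a)) this
    obtain ⟨r, hr⟩ := Complex.conj_eq_iff_real.1 h2
    rw [hr] at h1
    refine ⟨1 / r - s, ?_⟩
    have h3 := (hR (b a) (((1 / r - s : ℝ) : ℂ) • b a)).2 ?_
    · exact h3
    · rw [← add_smul, map_smul, (hb a).1, smul_smul, hr]
      push_cast
      rw [sub_add_cancel, one_div_mul_cancel h1, one_smul]
  choose e he using hr
  obtain ⟨ω, hω, hω0, hωH, -⟩ := hground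
  obtain ⟨a₀, ha₀⟩ : ∃ a, inner ℂ (b a) (⟨ω, hω⟩ : S.space) ≠ 0 := by
    by_contra! h
    refine hω0 (congrArg Subtype.val (HilbertBasis.ext_inner b (x := (⟨ω, hω⟩ : S.space)) (y := 0)
      fun a => ?_))
    rw [h, inner_zero_right]
  have hea : e a₀ = S.energy 0 0 := by
    have h1 := (he a₀).inner_comm S hm hw hu hωH
    rw [inner_smul_left, inner_smul_right, Complex.conj_ofReal] at h1
    exact_mod_cast mul_right_cancel₀ ha₀ h1
  have : Countable (Σ i, w i) := S.countable_index b
  have : Infinite (Σ i, w i) := by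
    have h1 := S.infinite_sector_ne_zero hN (x := ⟨ω, hω⟩) fun h => hω0 (congrArg Subtype.val h)
    have h2 : {q | ∃ y, S.sector q y ≠ 0} ⊆ Set.range fun a : (Σ i, w i) => a.1.2 := by
      rintro q ⟨y, hy⟩
      by_contra hq
      refine hy (HilbertBasis.ext_inner b fun a => ?_)
      have h3 : q ≠ a.1.2 := fun h => hq ⟨a, h.symm⟩
      rw [← inner_sector_left, ← (hb a).2, sector_sector, if_neg h3, inner_zero_left, inner_zero_right]
    refine not_finite_iff_infinite.1 fun hfin => ?_
    exact h1 ((Set.finite_range _).subset h2)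
  obtain ⟨f⟩ : Nonempty (ℕ ≃ Σ i, w i) := nonempty_equiv_of_countable
  let g := (Equiv.swap 0 (f.symm a₀)).trans f
  have hg : g 0 = a₀ := by simp [g]
  obtain ⟨b', hb'⟩ := exists_hilbertBasis_reindex b g
  refine ⟨b', fun n => e (g n), fun n => (g n).1.2, ⟨⟨by rw [hg, hea], fun n => ?_⟩, fun n => ?_⟩⟩
  · rw [hb']
    exact he (g n)
  · rw [forall_isMomentum_iff, hb']
    exact congrArg Subtype.val (hb (g n)).2

end Spectrum

end System

/-! ### One-body potentials between momentum eigenstates -/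

section OneBody

variable {N d : ℕ} {L : ℝ}

/-- The one-body potential `∑_j f (x_j)`. -/
def oneBody (f : C(Torus d L, ℂ)) : C(Config N d L, ℂ) := ∑ j, f.comp (position j)

theorem oneBody_apply (f : C(Torus d L, ℂ)) (x : Config N d L) : oneBody f x = ∑ j, f (x j) := by
  simp [oneBody, position, ContinuousMap.sum_apply]

theorem oneBody_perm (f : C(Torus d L, ℂ)) (σ : Equiv.Perm (Fin N)) (x : Config N d L) :
    oneBody f (fun j => x (σ j)) = oneBody f x := by
  rw [oneBody_apply, oneBody_apply]
  exact Equiv.sum_comp σ fun j => f (x j)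

variable [hL : Fact (0 < L)]

/-- Between a wave function of zero momentum and one of momentum `k`, only the Fourier component of a
one-body potential at `k` contributes. -/
theorem inner_mulOp_position {q : Fin d → ℤ} {φ ψ : WaveFun N d L} (hφ : sectorProj q φ = φ)
    (hψ : sectorProj 0 ψ = ψ) (f : C(Torus d L, ℂ)) (j : Fin N) :
    (L : ℂ) ^ d * inner ℂ φ (mulOp (f.comp (position j)) ψ) =
      (∫ y, f y * wave (-q) y) * inner ℂ φ (mulOp ((waveC q).comp (position j)) ψ) := by
  let T : C(Torus d L, ℂ) →L[ℂ] Lp ℂ 2 (volume : Measure (Torus d L)) :=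
    ContinuousMap.toLp (E := ℂ) 2 volume ℂ
  have hT (g : C(Torus d L, ℂ)) : inner ℂ (T (waveC q)) (T g) = ∫ y, g y * wave (-q) y := by
    rw [ContinuousMap.inner_toLp]
    simp only [waveC_apply, wave_neg]
  let Φ₁ : C(Torus d L, ℂ) →L[ℂ] ℂ := (L : ℂ) ^ d • (innerSL ℂ φ ∘L mulOp.flip ψ ∘L
    ContinuousMap.compCLM ℂ ℂ (position j))
  let Φ₂ : C(Torus d L, ℂ) →L[ℂ] ℂ :=
    inner ℂ φ (mulOp ((waveC q).comp (position j)) ψ) • (innerSL ℂ (T (waveC q)) ∘L T)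
  have h : Φ₁ = Φ₂ := by
    refine ContinuousLinearMap.ext_on dense_span_waveC ?_
    rintro _ ⟨n, rfl⟩
    change (L : ℂ) ^ d * inner ℂ φ (mulOp ((waveC n).comp (position j)) ψ) =
      inner ℂ φ (mulOp ((waveC q).comp (position j)) ψ) * inner ℂ (T (waveC q)) (T (waveC n))
    have hint : ∫ y : Torus d L, waveC n y * wave (-q) y = if n - q = 0 then (L : ℂ) ^ d else 0 := by
      rw [← integral_wave]
      refine integral_congr_ae (Eventually.of_forall fun y => ?_)
      simp only [waveC_apply]
      rw [← wave_add, sub_eq_add_neg]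
    rw [hT, hint]
    by_cases hn : n = q
    · rw [hn, sub_self, if_pos rfl, mul_comm]
    · have hc : (waveC n).comp (position j) = planeWaveC (N := N) (L := L) (Pi.single j n) := by
        ext x
        exact (planeWave_single j n x).symm
      have hs : ∑ l, (Pi.single j n : Fin N → Fin d → ℤ) l = n := by
        rw [Finset.sum_pi_single', if_pos (Finset.mem_univ j)]
      rw [if_neg (sub_ne_zero.2 hn), hc, ← hφ, inner_sectorProj_left,
        sectorProj_mulOp_planeWave hs, ← hψ, sectorProj_sectorProj,
        if_neg (sub_ne_zero.2 (Ne.symm hn)), map_zero, inner_zero_right, mul_zero, mul_zero]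
  have h2 := congrArg (fun Φ : C(Torus d L, ℂ) →L[ℂ] ℂ => Φ f) h
  rw [← hT, mul_comm (inner ℂ (T (waveC q)) (T f))]
  exact h2

theorem inner_mulOp_oneBody {q : Fin d → ℤ} {φ ψ : WaveFun N d L} (hφ : sectorProj q φ = φ)
    (hψ : sectorProj 0 ψ = ψ) (f : C(Torus d L, ℂ)) :
    (L : ℂ) ^ d * inner ℂ φ (mulOp (oneBody f) ψ) =
      (∫ y, f y * wave (-q) y) * inner ℂ φ (mulOp (oneBody (waveC q)) ψ) := by
  simp only [oneBody, map_sum, sum_apply, inner_sum, Finset.mul_sum]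
  exact Finset.sum_congr rfl fun j _ => inner_mulOp_position hφ hψ f j

end OneBody

section Derivative

variable {d : ℕ} {L : ℝ} {u : Torus d L → ℝ}

theorem isOpenQuotientMap_torus :
    IsOpenQuotientMap (fun (y : Fin d → ℝ) μ => (y μ : AddCircle L) : (Fin d → ℝ) → Torus d L) := by
  refine ⟨fun z => ?_, by fun_prop, ?_⟩
  · choose y hy using fun μ => QuotientAddGroup.mk_surjective (z μ)
    exact ⟨y, funext hy⟩
  · exact IsOpenMap.piMap (fun _ => QuotientAddGroup.isOpenMap_coe) (by simp)

theorem continuous_of_lift (hu : ContDiff ℝ 1 (fun y : Fin d → ℝ => u (fun μ => (y μ : AddCircle L)))) :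
    Continuous u :=
  isOpenQuotientMap_torus.continuous_comp_iff.1 hu.continuous

theorem partialDeriv_lift
    (hu : ContDiff ℝ 1 (fun y : Fin d → ℝ => u (fun μ => (y μ : AddCircle L)))) (μ : Fin d)
    (y : Fin d → ℝ) :
    HasDerivAt (fun t : ℝ => u ((fun ν => (y ν : AddCircle L)) + Pi.single μ (t : AddCircle L)))
      (fderiv ℝ (fun y : Fin d → ℝ => u (fun ν => (y ν : AddCircle L))) y (Pi.single μ 1)) 0 := by
  have h1 : HasDerivAt (fun t : ℝ => y + t • Pi.single μ (1 : ℝ)) (Pi.single μ 1) 0 := by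
    simpa using ((hasDerivAt_id (0 : ℝ)).smul_const (Pi.single μ (1 : ℝ))).const_add y
  have h2 := (hu.differentiable one_ne_zero y).hasFDerivAt
  have h3 : y = y + (0 : ℝ) • Pi.single μ (1 : ℝ) := by simp
  rw [h3] at h2
  have h4 := h2.comp_hasDerivAt (0 : ℝ) h1
  rw [← h3] at h4
  refine h4.congr_of_eventuallyEq (Eventually.of_forall fun t => ?_)
  refine congrArg u (funext fun ν => ?_)
  rcases eq_or_ne ν μ with rfl | hν
  · simp
  · simp [Pi.single_eq_of_ne hν]

theorem continuous_partialDeriv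
    (hu : ContDiff ℝ 1 (fun y : Fin d → ℝ => u (fun μ => (y μ : AddCircle L)))) (μ : Fin d) :
    Continuous (partialDeriv u μ) := by
  refine isOpenQuotientMap_torus.continuous_comp_iff.1 ?_
  have h : (partialDeriv u μ ∘ fun (y : Fin d → ℝ) ν => (y ν : AddCircle L)) = fun y =>
      fderiv ℝ (fun y : Fin d → ℝ => u (fun ν => (y ν : AddCircle L))) y (Pi.single μ 1) :=
    funext fun y => (partialDeriv_lift hu μ y).deriv
  rw [h]
  exact (hu.continuous_fderiv one_ne_zero).clm_apply continuous_const

theorem hasDerivAt_translate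
    (hu : ContDiff ℝ 1 (fun y : Fin d → ℝ => u (fun μ => (y μ : AddCircle L)))) (μ : Fin d)
    (z : Torus d L) (t : ℝ) :
    HasDerivAt (fun t : ℝ => u (z + Pi.single μ (t : AddCircle L)))
      (partialDeriv u μ (z + Pi.single μ (t : AddCircle L))) t := by
  have h1 (z : Torus d L) : HasDerivAt (fun t : ℝ => u (z + Pi.single μ (t : AddCircle L)))
      (partialDeriv u μ z) 0 := by
    obtain ⟨y, rfl⟩ := isOpenQuotientMap_torus.surjective z
    have := partialDeriv_lift hu μ y
    rw [partialDeriv, this.deriv]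
    exact this
  have h2 := h1 (z + Pi.single μ (t : AddCircle L))
  rw [← sub_self t] at h2
  have h3 := h2.comp_sub_const t t
  refine h3.congr_of_eventuallyEq (Eventually.of_forall fun t' => ?_)
  simp only [add_assoc, ← Pi.single_add]
  rw [← AddCircle.coe_add, add_sub_cancel]

/-- Differentiation is multiplication by `i k` on the Fourier side. -/
theorem fourierTransform_partialDeriv [hL : Fact (0 < L)]
    (hu : ContDiff ℝ 1 (fun y : Fin d → ℝ => u (fun μ => (y μ : AddCircle L)))) (μ : Fin d)
    (n : Fin d → ℤ) :
    fourierTransform (partialDeriv u μ) n =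
      Complex.I * waveNumber L (n μ) * fourierTransform u n := by
  have hc := continuous_of_lift hu
  have hc' := continuous_partialDeriv hu μ
  have hwave (n : Fin d → ℤ) : Continuous (wave n : Torus d L → ℂ) := (waveC n).continuous
  have hwn (y : Torus d L) : ‖wave (-n) y‖ = 1 := by
    rw [wave, norm_prod]
    exact Finset.prod_eq_one fun ν _ => Circle.norm_coe _
  obtain ⟨B, hB⟩ : ∃ B, ∀ y, ‖partialDeriv u μ y‖ ≤ B := by
    obtain ⟨B, hB⟩ := isCompact_univ.exists_bound_of_continuousOn hc'.continuousOn
    exact ⟨B, fun y => hB y trivial⟩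
  have hshift (t : ℝ) : Continuous fun y : Torus d L => y + Pi.single μ (t : AddCircle L) := by
    fun_prop
  -- the transform of a translate, as a function of the translation
  have h1 : HasDerivAt (fun t : ℝ => ∫ y : Torus d L,
      (u (y + Pi.single μ (t : AddCircle L)) : ℂ) * wave (-n) y)
      (∫ y : Torus d L, (partialDeriv u μ (y + Pi.single μ ((0 : ℝ) : AddCircle L)) : ℂ) *
        wave (-n) y) 0 := by
    refine (hasDerivAt_integral_of_dominated_loc_of_deriv_le (μ := volume) (x₀ := (0 : ℝ))
      (F := fun (t : ℝ) (y : Torus d L) => (u (y + Pi.single μ (t : AddCircle L)) : ℂ) *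
        wave (-n) y)
      (F' := fun (t : ℝ) (y : Torus d L) =>
        (partialDeriv u μ (y + Pi.single μ (t : AddCircle L)) : ℂ) * wave (-n) y)
      (bound := fun _ => B) univ_mem (Eventually.of_forall fun t => ?_) ?_ ?_ ?_ ?_ ?_).2
    · exact ((Complex.continuous_ofReal.comp (hc.comp (hshift t))).mul (hwave _)).aestronglyMeasurable
    · exact ((Complex.continuous_ofReal.comp (hc.comp (hshift 0))).mul
        (hwave _)).integrable_of_hasCompactSupport (HasCompactSupport.of_compactSpace _)
    · exact ((Complex.continuous_ofReal.comp (hc'.comp (hshift 0))).mul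
        (hwave _)).aestronglyMeasurable
    · refine Eventually.of_forall fun y t _ => ?_
      rw [norm_mul, hwn, mul_one, Complex.norm_real]
      exact hB _
    · exact integrable_const B
    · exact Eventually.of_forall fun y t _ =>
        (hasDerivAt_translate hu μ y t).ofReal_comp.mul_const _
  have h2 (t : ℝ) : ∫ y : Torus d L, (u (y + Pi.single μ (t : AddCircle L)) : ℂ) * wave (-n) y =
      Complex.exp (Complex.I * waveNumber L (n μ) * t) * fourierTransform u n := by
    rw [fourierTransform, ← integral_const_mul,
      ← integral_add_right_eq_self (fun y : Torus d L =>
        Complex.exp (Complex.I * waveNumber L (n μ) * t) * ((u y : ℂ) * wave (-n) y))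
        (Pi.single μ (t : AddCircle L))]
    refine integral_congr_ae (Eventually.of_forall fun y => ?_)
    have h3 : wave (-n) (Pi.single μ (t : AddCircle L)) =
        Complex.exp (-(Complex.I * waveNumber L (n μ) * t)) := by
      rw [wave, Finset.prod_eq_single μ]
      · rw [Pi.single_eq_same, fourier_coe_apply]
        congr 1
        simp only [waveNumber, Pi.neg_apply]
        push_cast
        ring
      · intro ν _ hν
        rw [Pi.single_eq_of_ne hν]
        simp
      · simp
    simp only [wave_translate, h3]
    rw [Complex.exp_neg]
    field_simp [Complex.exp_ne_zero]
  simp only [h2, AddCircle.coe_zero, Pi.single_zero, add_zero] at h1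
  have h4 : HasDerivAt (fun t : ℝ => Complex.exp (Complex.I * waveNumber L (n μ) * t) *
      fourierTransform u n) (Complex.I * waveNumber L (n μ) * fourierTransform u n) 0 := by
    have h5 : HasDerivAt (fun t : ℝ => Complex.I * waveNumber L (n μ) * (t : ℂ))
        (Complex.I * waveNumber L (n μ)) 0 := by
      simpa using (hasDerivAt_id (0 : ℝ)).ofReal_comp.const_mul (Complex.I * waveNumber L (n μ))
    simpa using h5.cexp.mul_const (fourierTransform u n)
  exact h1.unique h4

end Derivative

/-! ### The gap and the momentum bound -/

section DiagonalFamily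

variable {K : Type*} [NormedAddCommGroup K] [InnerProductSpace ℂ K]

/-- The eigenvalue of `(H₀ - E₀ + |Ω_0⟩⟨Ω_0|)⁻¹` at `Ω_n`, where `x n` is the excitation energy. -/
def reducedResolvent (x : ℕ → ℝ) (n : ℕ) : ℝ := if n = 0 then 1 else 1 / x n

/-- Excitation energies `x n` with a gap, and momenta `k n` which are bounded relative to the
energy. -/
structure GapCondition (x k : ℕ → ℝ) (δ C : ℝ) : Prop where
  gap_pos : 0 < δ
  C_nonneg : 0 ≤ C
  x_zero : x 0 = 0
  k_zero : k 0 = 0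
  gap : ∀ n, n ≠ 0 → δ ≤ x n
  bound : ∀ n, |k n| ≤ C * x n

namespace GapCondition

variable {x k : ℕ → ℝ} {δ C : ℝ} (h : GapCondition x k δ C)
include h

theorem reducedResolvent_nonneg (n : ℕ) : 0 ≤ reducedResolvent x n := by
  rw [reducedResolvent]
  split_ifs with hn
  · exact zero_le_one
  · exact one_div_nonneg.2 (h.gap_pos.le.trans (h.gap n hn))

theorem reducedResolvent_le (n : ℕ) : reducedResolvent x n ≤ 1 + 1 / δ := by
  have hδ := h.gap_pos
  rw [reducedResolvent]
  split_ifs with hn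
  · simp [hδ.le]
  · have := one_div_le_one_div_of_le hδ (h.gap n hn)
    linarith

theorem reducedResolvent_mul (n : ℕ) :
    reducedResolvent x n * x n = 1 - if n = 0 then 1 else 0 := by
  rw [reducedResolvent]
  split_ifs with hn
  · rw [hn, h.x_zero]
    simp
  · rw [one_div_mul_cancel (h.gap_pos.trans_le (h.gap n hn)).ne', sub_zero]

theorem abs_mul_le (n : ℕ) : |reducedResolvent x n * k n| ≤ C := by
  rw [abs_mul, abs_of_nonneg (h.reducedResolvent_nonneg n)]
  refine (mul_le_mul_of_nonneg_left (h.bound n) (h.reducedResolvent_nonneg n)).trans ?_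
  rw [mul_left_comm, h.reducedResolvent_mul]
  have := h.C_nonneg
  split_ifs <;> simp [this]

theorem norm_reducedResolvent_le (n : ℕ) : ‖(reducedResolvent x n : ℂ)‖ ≤ 1 + 1 / δ := by
  rw [Complex.norm_real, Real.norm_eq_abs, abs_of_nonneg (h.reducedResolvent_nonneg n)]
  exact h.reducedResolvent_le n

theorem norm_mul_le (n : ℕ) : ‖((reducedResolvent x n * k n : ℝ) : ℂ)‖ ≤ C := by
  rw [Complex.norm_real]
  exact h.abs_mul_le n

end GapCondition

/-- The perturbation problem in an eigenbasis: `H₀ = E₀ + x` and `P = k` are diagonal. -/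
def diagonalFamily (b : HilbertBasis ℕ ℂ K) {x k : ℕ → ℝ} {δ C : ℝ} (h : GapCondition x k δ C)
    (U : K →L[ℂ] K) (hU : ∀ x y, inner ℂ (U x) y = inner ℂ x (U y)) : GroundFamily K where
  A := diag b (fun n => (reducedResolvent x n : ℂ)) (1 + 1 / δ) h.norm_reducedResolvent_le
  Q := diag b (fun n => ((reducedResolvent x n * k n : ℝ) : ℂ)) C h.norm_mul_le
  U := U
  e := b 0
  C := (1 + 1 / δ) + C
  norm_e := b.orthonormal.1 0
  A_e := by rw [diag_basis]; simp [reducedResolvent]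
  Q_e := by rw [diag_basis, h.k_zero]; simp
  A_symm := inner_diag_left _ _
  U_symm := hU
  AQ_symm y z := by
    rw [inner_diag_left, inner_diag_left]
    congr 1
    refine HilbertBasis.ext_inner b fun n => ?_
    simp only [inner_diag]
    ring
  A_bound y := by
    refine hasSum_le (fun n => ?_) (hasSum_norm_sq_inner b _)
      ((hasSum_inner_diag_self (reducedResolvent x) _ y).mul_left _)
    rw [inner_diag, norm_mul, Complex.norm_real, Real.norm_eq_abs, mul_pow, sq_abs, ← mul_assoc, sq]
    have h1 := h.reducedResolvent_nonneg n
    have h2 := h.reducedResolvent_le n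
    have h3 := h.C_nonneg
    gcongr
    linarith
  Q_bound y := by
    have h1 : HasSum (fun n => reducedResolvent x n * (reducedResolvent x n * k n) *
        ‖inner ℂ (b n) y‖ ^ 2) (inner ℂ y (diag b (fun n => (reducedResolvent x n : ℂ)) (1 + 1 / δ)
          h.norm_reducedResolvent_le (diag b (fun n => ((reducedResolvent x n * k n : ℝ) : ℂ)) C
          h.norm_mul_le y))).re := by
      refine hasSum_mul_norm_sq_inner b fun n => ?_
      simp only [inner_diag]
      push_cast
      ring
    have h2 := (hasSum_inner_diag_self (b := b) (reducedResolvent x) h.norm_reducedResolvent_le y).mul_left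
      ((1 + 1 / δ) + C)
    have h3 (n : ℕ) : |reducedResolvent x n * (reducedResolvent x n * k n) *
        ‖inner ℂ (b n) y‖ ^ 2| ≤ ((1 + 1 / δ) + C) *
          (reducedResolvent x n * ‖inner ℂ (b n) y‖ ^ 2) := by
      have h1 := h.reducedResolvent_nonneg n
      have h4 := h.abs_mul_le n
      have h5 := h.gap_pos
      have h6 : C ≤ (1 + 1 / δ) + C := by
        have : 0 < 1 / δ := by positivity
        linarith
      rw [abs_mul, abs_mul, abs_of_nonneg h1, abs_of_nonneg (sq_nonneg ‖inner ℂ (b n) y‖),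
        ← mul_assoc, mul_comm (1 + 1 / δ + C)]
      gcongr
      exact h4.trans h6
    rw [inner_diag_left]
    rw [abs_le]
    constructor
    · exact hasSum_le (fun n => (abs_le.1 (h3 n)).1) h2.neg h1
    · exact hasSum_le (fun n => (abs_le.1 (h3 n)).2) h1 h2
  A_nonneg y := (hasSum_inner_diag_self (reducedResolvent x) _ y).nonneg fun n =>
    mul_nonneg (h.reducedResolvent_nonneg n) (sq_nonneg _)

end DiagonalFamily

namespace System

section Gap

variable {N d : ℕ} {L : ℝ} {S : System N d L} [hL : Fact (0 < L)]
  {Ω : HilbertBasis ℕ ℂ S.space} {E : ℕ → ℝ} {q : ℕ → Fin d → ℤ}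

theorem IsEigenbasis.inner_eq (h : S.IsEigenbasis Ω E) (hm : 0 < S.m) (hw : Continuous S.w)
    (hu : Continuous S.u) {ψ φ : S.space} (hψ : S.IsHamiltonian 0 0 (ψ : WaveFun N d L) φ) (n : ℕ) :
    inner ℂ (Ω n) φ = (E n : ℂ) * inner ℂ (Ω n) ψ := by
  have h1 := (h.eigen n).inner_comm S hm hw hu hψ
  rw [inner_smul_left, Complex.conj_ofReal] at h1
  exact h1.symm

theorem IsEigenbasis.eq_smul_ground (h : S.IsEigenbasis Ω E) (hground : S.UniqueGroundState)
    {ψ : WaveFun N d L} (hψ : ψ ∈ S.space) (hH : S.IsHamiltonian 0 0 ψ ((E 0 : ℂ) • ψ)) :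
    ∃ c : ℂ, ψ = c • (Ω 0 : WaveFun N d L) := by
  obtain ⟨ω, -, -, -, hω⟩ := hground
  obtain ⟨c, hc⟩ := hω (Ω 0 : WaveFun N d L) (Ω 0).2 (by rw [← h.ground]; exact h.eigen 0)
  obtain ⟨c', hc'⟩ := hω ψ hψ (by rw [← h.ground]; exact hH)
  have hc0 : c ≠ 0 := by
    rintro rfl
    rw [zero_smul] at hc
    exact Ω.orthonormal.ne_zero 0 (Subtype.ext hc)
  exact ⟨c' * c⁻¹, by rw [hc, smul_smul, hc', mul_assoc, inv_mul_cancel₀ hc0, mul_one]⟩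

theorem IsEigenbasis.energy_lt (h : S.IsEigenbasis Ω E) (hm : 0 < S.m) (hw : Continuous S.w)
    (hu : Continuous S.u) (hground : S.UniqueGroundState) {n : ℕ} (hn : n ≠ 0) : E 0 < E n := by
  have h1 : E 0 ≤ E n := by
    have h2 := S.energy_le_re_inner hm hw hu (h.eigen n) (Ω n).2 (Ω.orthonormal.1 n)
    have h3 : inner ℂ (Ω n : WaveFun N d L) (Ω n : WaveFun N d L) = (1 : ℂ) := by
      rw [inner_self_eq_norm_sq_to_K]
      have : ‖(Ω n : WaveFun N d L)‖ = 1 := Ω.orthonormal.1 n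
      simp [this]
    rw [inner_smul_right, h3, mul_one, Complex.ofReal_re, ← h.ground] at h2
    exact h2
  refine lt_of_le_of_ne h1 fun h2 => ?_
  obtain ⟨c, hc⟩ := h.eq_smul_ground hground (Ω n).2 (by rw [h2]; exact h.eigen n)
  have h4 : inner ℂ (Ω n : WaveFun N d L) (Ω 0 : WaveFun N d L) = 0 := Ω.orthonormal.2 hn
  have h5 : inner ℂ (Ω n : WaveFun N d L) (Ω n : WaveFun N d L) = 0 := by
    nth_rewrite 2 [hc]
    rw [inner_smul_right, h4, mul_zero]
  exact Ω.orthonormal.ne_zero n (Subtype.ext (inner_self_eq_zero.1 h5))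

/-- The eigenvalues of a compact operator accumulate only at zero, hence the ground state energy is
isolated. -/
theorem IsEigenbasis.exists_gap (h : S.IsEigenbasis Ω E) (hm : 0 < S.m) (hw : Continuous S.w)
    (hev : ∀ y, S.w (-y) = S.w y) (hu : Continuous S.u) (hground : S.UniqueGroundState) :
    ∃ δ > 0, ∀ n, n ≠ 0 → δ ≤ E n - E 0 := by
  obtain ⟨s, R, hRc, hRs, hRi, -, hR⟩ := S.exists_resolvent_space hm hw hev hu
  have hE (n : ℕ) : R (((E n + s : ℝ) : ℂ) • Ω n) = Ω n := by
    have h1 := (hR (Ω n) ((E n : ℂ) • Ω n)).1 (h.eigen n)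
    rw [← add_smul, ← Complex.ofReal_add] at h1
    exact h1.symm
  have hne (n : ℕ) : E n + s ≠ 0 := by
    intro h0
    have h1 := hE n
    rw [h0, Complex.ofReal_zero, zero_smul, map_zero] at h1
    exact Ω.orthonormal.ne_zero n h1.symm
  have hRΩ (n : ℕ) : R (Ω n) = (((E n + s)⁻¹ : ℝ) : ℂ) • Ω n := by
    have h1 := hE n
    rw [map_smul] at h1
    nth_rewrite 2 [← h1]
    rw [smul_smul, ← Complex.ofReal_mul, inv_mul_cancel₀ (hne n), Complex.ofReal_one, one_smul]
  have h1 := tendsto_eigenvalue_of_isCompactOperator hRc Ω.orthonormal hRΩ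
  -- large `n` have energy at least `E 0 + 1`, since `|E n + s| → ∞` and `E n` is bounded below
  have h2 : ∀ᶠ n in atTop, 1 ≤ E n - E 0 ∨ n = 0 := by
    set c := |E 0 + s| + 1 with hc
    have hc0 : 0 < c := by positivity
    filter_upwards [(tendsto_order.1 (tendsto_norm_zero.comp h1)).2 c⁻¹ (by positivity)] with n hn
    by_cases hn0 : n = 0
    · exact Or.inr hn0
    left
    have h3 := h.energy_lt hm hw hu hground hn0
    have h4 : c < |E n + s| := by
      rw [Function.comp_apply, Real.norm_eq_abs, abs_inv] at hn
      exact (inv_lt_inv₀ (abs_pos.2 (hne n)) hc0).1 hn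
    have h5 := neg_abs_le (E 0 + s)
    have h6 := le_abs_self (E 0 + s)
    rcases lt_abs.1 h4 with h7 | h7 <;> linarith
  obtain ⟨M, hM⟩ := eventually_atTop.1 h2
  have h3 : ∃ δ > 0, ∀ n < M, n ≠ 0 → δ ≤ E n - E 0 := by
    clear hM
    induction M with
    | zero => exact ⟨1, one_pos, fun n hn => absurd hn (Nat.not_lt_zero n)⟩
    | succ M ih =>
      obtain ⟨δ, hδ, ih⟩ := ih
      by_cases hM0 : M = 0
      · exact ⟨δ, hδ, fun n hn hn0 => absurd (by omega) hn0⟩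
      · refine ⟨min δ (E M - E 0), lt_min hδ (sub_pos.2 (h.energy_lt hm hw hu hground hM0)),
          fun n hn hn0 => ?_⟩
        rcases Nat.lt_succ_iff_lt_or_eq.1 hn with h | rfl
        · exact (min_le_left _ _).trans (ih n h hn0)
        · exact min_le_right _ _
  obtain ⟨δ, hδ, h3⟩ := h3
  refine ⟨min δ 1, lt_min hδ one_pos, fun n hn => ?_⟩
  rcases lt_or_ge n M with h4 | h4
  · exact (min_le_left _ _).trans (h3 n h4 hn)
  · exact (min_le_right _ _).trans ((hM n h4).resolve_right hn)

theorem IsMomentumEigenbasis.sectorProj_eq (h : S.IsMomentumEigenbasis Ω E q) (n : ℕ) :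
    sectorProj (q n) (Ω n : WaveFun N d L) = Ω n :=
  forall_isMomentum_iff.1 (h.momentum n)

/-- By uniqueness the ground state is invariant under time reversal, hence has momentum zero. -/
theorem IsMomentumEigenbasis.momentum_zero (h : S.IsMomentumEigenbasis Ω E q)
    (hground : S.UniqueGroundState) : q 0 = 0 := by
  have h1 := (h.eigen 0).star
  rw [neg_zero, star_smul_ofReal] at h1
  obtain ⟨c, hc⟩ := h.toIsEigenbasis.eq_smul_ground hground (S.star_mem_space (Ω 0).2) h1
  have hne : (Ω 0 : WaveFun N d L) ≠ 0 := fun h0 => Ω.orthonormal.ne_zero 0 (Subtype.ext h0)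
  have hc0 : c ≠ 0 := by
    rintro rfl
    rw [zero_smul] at hc
    have h2 := norm_star (Ω 0 : WaveFun N d L)
    rw [hc, norm_zero] at h2
    exact hne (norm_eq_zero.1 h2.symm)
  have h2 : sectorProj (-q 0) (Ω 0 : WaveFun N d L) = Ω 0 := by
    have h3 := sectorProj_star (-q 0) (Ω 0 : WaveFun N d L)
    rw [neg_neg, h.sectorProj_eq, hc, map_smul] at h3
    exact smul_right_injective _ hc0 h3
  have h3 : q 0 = -q 0 := by
    by_contra h4
    have h5 := sectorProj_sectorProj (q 0) (-q 0) (Ω 0 : WaveFun N d L)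
    rw [if_neg h4, h2, h.sectorProj_eq] at h5
    exact hne h5
  funext μ
  have := congrFun h3 μ
  simp only [Pi.neg_apply] at this
  simp only [Pi.zero_apply]
  omega

/-- As `k² ≤ 2 m N (E + ‖W‖)` for an eigenstate of energy `E` and momentum `k`, the gap makes the
momentum bounded relative to the excitation energy. -/
theorem IsMomentumEigenbasis.exists_gapCondition (h : S.IsMomentumEigenbasis Ω E q)
    (hm : 0 < S.m) (hw : Continuous S.w) (hev : ∀ y, S.w (-y) = S.w y) (hu : Continuous S.u)
    (hground : S.UniqueGroundState) :
    ∃ δ C, GapCondition (fun n => E n - E 0) (fun n => waveNumber L (q n S.axis)) δ C := by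
  obtain ⟨δ, hδ, hgap⟩ := h.toIsEigenbasis.exists_gap hm hw hev hu hground
  have hq := h.momentum_zero hground
  set w := ‖mulOp (realC S.W (S.continuous_W hw))‖ with hwdef
  set a := 2 * S.m * N with ha
  have ha0 : 0 ≤ a := by positivity
  set b := a * |E 0 + w| with hb
  have hb0 : 0 ≤ b := by positivity
  refine ⟨δ, √(a / δ + b / δ ^ 2), hδ, Real.sqrt_nonneg _, sub_self _, by simp [hq, waveNumber],
    hgap, fun n => ?_⟩
  by_cases hn : n = 0
  · simp [hn, hq, waveNumber]
  have hx := hgap n hn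
  have hsq : waveNumber L (q n S.axis) ^ 2 ≤ a * (E n - E 0) + b := by
    obtain ⟨τ, hτ, hle⟩ := (h.eigen n).exists_kinetic_le S hw hu
    have h1 := hτ.momentum_sq_le hm (h.sectorProj_eq n) S.axis
    have h2 : ‖(Ω n : WaveFun N d L)‖ = 1 := Ω.orthonormal.1 n
    have h3 : inner ℂ (Ω n : WaveFun N d L) (Ω n : WaveFun N d L) = (1 : ℂ) := by
      rw [inner_self_eq_norm_sq_to_K]
      simp [h2]
    rw [inner_smul_right, h3, mul_one, Complex.ofReal_re, h2, one_pow, mul_one] at hle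
    rw [h2, one_pow, mul_one] at h1
    calc _ ≤ _ := h1
      _ ≤ a * (E n + w) := by gcongr
      _ = a * (E n - E 0) + a * (E 0 + w) := by ring
      _ ≤ _ := by rw [hb]; gcongr; exact le_abs_self _
  have hpos : 0 < E n - E 0 := hδ.trans_le hx
  refine abs_le_of_sq_le_sq (hsq.trans ?_) (by positivity)
  rw [mul_pow, Real.sq_sqrt (by positivity), add_mul]
  have h1 : 1 ≤ (E n - E 0) / δ := (one_le_div hδ).2 hx
  have h2 : a * (E n - E 0) ≤ a / δ * (E n - E 0) ^ 2 := by
    calc a * (E n - E 0) = a * (E n - E 0) * 1 := by ring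
      _ ≤ a * (E n - E 0) * ((E n - E 0) / δ) := by gcongr
      _ = _ := by ring
  have h3 : b ≤ b / δ ^ 2 * (E n - E 0) ^ 2 := by
    calc b = b * 1 ^ 2 := by ring
      _ ≤ b * ((E n - E 0) / δ) ^ 2 := by gcongr
      _ = _ := by ring
  linarith

end Gap

end System

/-! ### The perturbation problem in an eigenbasis -/

section DiagonalFamily

variable {K : Type*} [NormedAddCommGroup K] [InnerProductSpace ℂ K]

/-- If `R` maps `(e i + s) • b i` to `b i`, then it inverts the multiplication by `e + s` in the
basis `b`. -/
theorem eq_apply_of_forall_inner {ι : Type*} (b : HilbertBasis ι ℂ K) {R : K →L[ℂ] K}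
    (hR : ∀ x y, inner ℂ (R x) y = inner ℂ x (R y)) {e : ι → ℝ} {s : ℝ}
    (hb : ∀ i, b i = R ((e i : ℂ) • b i + (s : ℂ) • b i)) {x y : K}
    (hc : ∀ i, inner ℂ (b i) y = (e i : ℂ) * inner ℂ (b i) x) : x = R (y + (s : ℂ) • x) := by
  refine HilbertBasis.ext_inner b fun i => ?_
  have h1 := hb i
  rw [← add_smul, map_smul] at h1
  have h2 : ((e i : ℂ) + s) * inner ℂ (R (b i)) (y + (s : ℂ) • x) =
      inner ℂ (b i) (y + (s : ℂ) • x) := by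
    nth_rewrite 2 [h1]
    rw [inner_smul_left, map_add, Complex.conj_ofReal, Complex.conj_ofReal]
  have h3 : (e i : ℂ) + s ≠ 0 := fun h0 => by
    rw [h0, zero_smul] at h1
    exact b.orthonormal.ne_zero i h1
  rw [← hR]
  refine mul_left_cancel₀ h3 ?_
  rw [h2, inner_add_right, inner_smul_right, hc]
  ring

variable (b : HilbertBasis ℕ ℂ K) {x k : ℕ → ℝ} {δ C : ℝ} (h : GapCondition x k δ C)
  {U : K →L[ℂ] K} {hU : ∀ x y, inner ℂ (U x) y = inner ℂ x (U y)}

theorem inner_diagonalFamily_A (y : K) (n : ℕ) :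
    inner ℂ (b n) ((diagonalFamily b h U hU).A y) =
      (reducedResolvent x n : ℂ) * inner ℂ (b n) y :=
  inner_diag (h := h.norm_reducedResolvent_le) n y

theorem inner_diagonalFamily_Q (y : K) (n : ℕ) :
    inner ℂ (b n) ((diagonalFamily b h U hU).Q y) =
      ((reducedResolvent x n * k n : ℝ) : ℂ) * inner ℂ (b n) y :=
  inner_diag (h := h.norm_mul_le) n y

/-- Without perturbation, the operator `ham` is `A` followed by multiplication by `E₀ + x`. -/
theorem inner_diagonalFamily_ham (E₀ : ℝ) (y : K) (n : ℕ) :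
    inner ℂ (b n) (y + (E₀ : ℂ) • (diagonalFamily b h U hU).A y -
      inner ℂ (diagonalFamily b h U hU).e y • (diagonalFamily b h U hU).e) =
      ((E₀ + x n : ℝ) : ℂ) * inner ℂ (b n) ((diagonalFamily b h U hU).A y) := by
  have hA := inner_diagonalFamily_A b h (hU := hU) y n
  have he : (diagonalFamily b h U hU).e = b 0 := rfl
  have h1 := congrArg Complex.ofReal (h.reducedResolvent_mul n)
  rw [inner_sub_right, inner_add_right, inner_smul_right, inner_smul_right, hA, he,
    orthonormal_iff_ite.1 b.orthonormal]
  push_cast at h1 ⊢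
  split_ifs at h1 ⊢ with hn
  · subst hn
    rw [Complex.ofReal_one] at h1
    linear_combination - inner ℂ (b 0) y * h1
  · rw [Complex.ofReal_zero] at h1
    linear_combination - inner ℂ (b n) y * h1

/-- The graph of the multiplication by `E₀ + x` consists of the pairs `(A y, ham y)`. -/
theorem exists_eq_of_diag {E₀ : ℝ} {x' y' : K}
    (hc : ∀ n, inner ℂ (b n) y' = ((E₀ + x n : ℝ) : ℂ) * inner ℂ (b n) x') :
    ∃ y, x' = (diagonalFamily b h U hU).A y ∧
      y' = y + (E₀ : ℂ) • (diagonalFamily b h U hU).A y -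
        inner ℂ (diagonalFamily b h U hU).e y • (diagonalFamily b h U hU).e := by
  have he : (diagonalFamily b h U hU).e = b 0 := rfl
  have h0 : x' = (diagonalFamily b h U hU).A (y' - (E₀ : ℂ) • x' + inner ℂ (b 0) x' • b 0) := by
    refine HilbertBasis.ext_inner b fun n => ?_
    have h1 := congrArg Complex.ofReal (h.reducedResolvent_mul n)
    rw [inner_diagonalFamily_A, inner_add_right, inner_sub_right, inner_smul_right, inner_smul_right, hc,
      orthonormal_iff_ite.1 b.orthonormal]
    push_cast at h1 ⊢
    split_ifs at h1 ⊢ with hn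
    · subst hn
      have h2 : reducedResolvent x 0 = 1 := rfl
      rw [h2] at h1 ⊢
      push_cast at h1 ⊢
      linear_combination - inner ℂ (b 0) x' * h1
    · rw [Complex.ofReal_zero] at h1
      linear_combination - inner ℂ (b n) x' * h1
  refine ⟨_, h0, ?_⟩
  rw [← h0, ← GroundFamily.inner_e_A, ← h0, he]
  abel

end DiagonalFamily

theorem IsMomentum.unique {N d : ℕ} {L : ℝ} [Fact (0 < L)] {μ : Fin d} {ψ φ φ' : WaveFun N d L}
    (h : IsMomentum μ ψ φ) (h' : IsMomentum μ ψ φ') : φ = φ' :=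
  coeff_ext fun n => by rw [h n, h' n]

namespace System

section Reduction

variable {N d : ℕ} {L : ℝ} (S : System N d L) [hL : Fact (0 < L)]

/-- Multiplication by `U` in the Hilbert space of the system. -/
def potentialOp (hu : Continuous S.u) : S.space →L[ℂ] S.space :=
  (mulOp (realC S.U (S.continuous_U hu))).restrict fun _ =>
    S.mulOp_mem_space fun σ x => congrArg Complex.ofReal (S.U_perm σ x)

theorem inner_potentialOp_left (hu : Continuous S.u) (ψ φ : S.space) :
    inner ℂ (S.potentialOp hu ψ) φ = inner ℂ ψ (S.potentialOp hu φ) :=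
  inner_mulOp_left_of_real (star_realC _ _) _ _

/-- The Hamiltonian `H(κ, v)` as a perturbation of `H₀`. -/
theorem isHamiltonian_iff_add (hw : Continuous S.w) (hu : Continuous S.u) {κ v : ℝ}
    {ψ φ : WaveFun N d L} :
    S.IsHamiltonian κ v ψ φ ↔ ∃ φ₀ π : WaveFun N d L, S.IsHamiltonian 0 0 ψ φ₀ ∧
      IsMomentum S.axis ψ π ∧
      φ = φ₀ + (κ : ℂ) • mulOp (realC S.U (S.continuous_U hu)) ψ - (v : ℂ) • π := by
  simp only [S.isHamiltonian_iff hw hu]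
  constructor
  · rintro ⟨τ, π, hτ, hπ, rfl⟩
    exact ⟨_, π, ⟨τ, π, hτ, hπ, rfl⟩, hπ, by simp⟩
  · rintro ⟨_, π, ⟨τ, π', hτ, -, rfl⟩, hπ, rfl⟩
    exact ⟨τ, π, hτ, hπ, by simp⟩

variable {S} {Ω : HilbertBasis ℕ ℂ S.space} {E : ℕ → ℝ} {q : ℕ → Fin d → ℤ} {δ C : ℝ}

/-- In an eigenbasis, `H₀` is multiplication by the eigenvalues. -/
theorem IsEigenbasis.isHamiltonian_iff (h : S.IsEigenbasis Ω E) (hm : 0 < S.m)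
    (hw : Continuous S.w) (hev : ∀ y, S.w (-y) = S.w y) (hu : Continuous S.u) {ψ φ : S.space} :
    S.IsHamiltonian 0 0 (ψ : WaveFun N d L) φ ↔
      ∀ n, inner ℂ (Ω n) φ = (E n : ℂ) * inner ℂ (Ω n) ψ := by
  refine ⟨h.inner_eq hm hw hu, fun hc => ?_⟩
  obtain ⟨s, R, -, hRs, -, -, hR⟩ := S.exists_resolvent_space hm hw hev hu
  exact (hR ψ φ).2 (eq_apply_of_forall_inner Ω hRs
    (fun n => (hR (Ω n) ((E n : ℂ) • Ω n)).1 (h.eigen n)) hc)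

/-- The function `U_d ω`. -/
def forceState (S : System N d L)
    (hu : ContDiff ℝ 1 (fun y : Fin d → ℝ => S.u (fun μ => (y μ : AddCircle L))))
    (ω : S.space) : S.space :=
  ⟨mulOp (oneBody (realC (partialDeriv S.u S.axis) (continuous_partialDeriv hu S.axis))) ω,
    S.mulOp_mem_space (oneBody_perm _) ω.2⟩

theorem matrixElement_Ud
    (hu : ContDiff ℝ 1 (fun y : Fin d → ℝ => S.u (fun μ => (y μ : AddCircle L))))
    (ψ ω : S.space) :
    matrixElement (fun x => (S.Ud x : ℂ)) (ψ : WaveFun N d L) (ω : WaveFun N d L) =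
      inner ℂ ψ (S.forceState hu ω) := by
  refine Eq.trans ?_ (inner_mulOp _ _ _).symm
  congr 1
  funext x
  rw [oneBody_apply, Ud, Complex.ofReal_sum]
  rfl

theorem matrixElement_densityMode (n : Fin d → ℤ) (ψ ω : WaveFun N d L) :
    matrixElement (densityMode (-n)) ψ ω = inner ℂ ψ (mulOp (oneBody (waveC n)) ω) := by
  rw [inner_mulOp]
  congr 1
  funext x
  rw [oneBody_apply, densityMode, neg_neg]
  rfl

/-- The matrix elements of `U_d` as Fourier transforms of the potential times matrix elements of
density modes. -/
theorem IsMomentumEigenbasis.inner_forceState (h : S.IsMomentumEigenbasis Ω E q)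
    (hground : S.UniqueGroundState)
    (hu : ContDiff ℝ 1 (fun y : Fin d → ℝ => S.u (fun μ => (y μ : AddCircle L)))) (n : ℕ) :
    (L : ℂ) ^ d * inner ℂ (Ω n) (S.forceState hu (Ω 0)) =
      Complex.I * waveNumber L (q n S.axis) * fourierTransform S.u (q n) *
        matrixElement (densityMode (-(q n))) (Ω n : WaveFun N d L) (Ω 0 : WaveFun N d L) := by
  have h0 := h.sectorProj_eq 0
  rw [h.momentum_zero hground] at h0
  rw [matrixElement_densityMode, ← fourierTransform_partialDeriv hu]
  exact inner_mulOp_oneBody (h.sectorProj_eq n) h0 _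

/-- Between momentum eigenstates, the force `U_d` is `i` times the commutator of the momentum with
the potential. -/
theorem IsMomentumEigenbasis.inner_forceState_eq_potentialOp (h : S.IsMomentumEigenbasis Ω E q)
    (hground : S.UniqueGroundState)
    (hu : ContDiff ℝ 1 (fun y : Fin d → ℝ => S.u (fun μ => (y μ : AddCircle L)))) (n : ℕ) :
    inner ℂ (Ω n) (S.forceState hu (Ω 0)) = Complex.I * waveNumber L (q n S.axis) *
      inner ℂ (Ω n) (S.potentialOp (continuous_of_lift hu) (Ω 0)) := by
  have h0 := h.sectorProj_eq 0
  rw [h.momentum_zero hground] at h0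
  have h1 : (L : ℂ) ^ d * inner ℂ (Ω n) (S.potentialOp (continuous_of_lift hu) (Ω 0)) =
      fourierTransform S.u (q n) *
        matrixElement (densityMode (-(q n))) (Ω n : WaveFun N d L) (Ω 0 : WaveFun N d L) := by
    rw [matrixElement_densityMode]
    refine Eq.trans ?_ (inner_mulOp_oneBody (h.sectorProj_eq n) h0
      (realC S.u (continuous_of_lift hu)))
    have h2 : realC S.U (S.continuous_U (continuous_of_lift hu)) =
        oneBody (realC S.u (continuous_of_lift hu)) := by
      ext x
      rw [oneBody_apply]
      simp [realC, U]
    rw [← h2]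
    rfl
  have hLd : (L : ℂ) ^ d ≠ 0 := pow_ne_zero _ (by exact_mod_cast hL.out.ne')
  refine mul_left_cancel₀ hLd ?_
  rw [h.inner_forceState hground, mul_assoc (Complex.I * _), ← h1]
  ring

/-- The total momentum, restricted to the range of the reduced resolvent. -/
theorem IsMomentumEigenbasis.isMomentum_diag (h : S.IsMomentumEigenbasis Ω E q)
    (G : GapCondition (fun n => E n - E 0) (fun n => waveNumber L (q n S.axis)) δ C) {U hU}
    (y : S.space) :
    IsMomentum S.axis ((diagonalFamily Ω G U hU).A y : WaveFun N d L)
      ((diagonalFamily Ω G U hU).Q y : WaveFun N d L) := by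
  intro m
  rw [coeff_eq_mul_iff]
  set D := diagonalFamily Ω G U hU
  let ℓ : S.space →L[ℂ] ℂ := innerSL ℂ (planeBasis N d L m) ∘L S.space.subtypeL
  let c : ℂ := ((∑ j, waveNumber L (m j S.axis) : ℝ) : ℂ)
  have h1 : ℓ ∘L D.Q = c • (ℓ ∘L D.A) := by
    refine ContinuousLinearMap.ext_on (s := Set.range Ω)
      (Submodule.dense_iff_topologicalClosure_eq_top.2 Ω.dense_span) ?_
    rintro _ ⟨n, rfl⟩
    have hA : D.A (Ω n) = (reducedResolvent (fun n => E n - E 0) n : ℂ) • Ω n :=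
      diag_basis (h := G.norm_reducedResolvent_le) n
    have hQ : D.Q (Ω n) = ((reducedResolvent (fun n => E n - E 0) n *
      waveNumber L (q n S.axis) : ℝ) : ℂ) • Ω n :=
      diag_basis (h := G.norm_mul_le) n
    have h2 := coeff_eq_mul_iff.1 (h.momentum n S.axis m)
    rw [inner_smul_right] at h2
    have h3 : (waveNumber L (q n S.axis) : ℂ) * ℓ (Ω n) = c * ℓ (Ω n) := h2
    change ℓ (D.Q (Ω n)) = c * ℓ (D.A (Ω n))
    rw [hA, hQ, map_smul, map_smul, smul_eq_mul, smul_eq_mul]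
    push_cast
    linear_combination (reducedResolvent (fun n => E n - E 0) n : ℂ) * h3
  exact congrArg (fun T : S.space →L[ℂ] ℂ => T y) h1

/-- The Hamiltonian `H(κ, v)` in terms of the bounded operators of the perturbation problem. -/
theorem IsMomentumEigenbasis.isHamiltonian_iff_ham (h : S.IsMomentumEigenbasis Ω E q)
    (hm : 0 < S.m) (hw : Continuous S.w) (hev : ∀ y, S.w (-y) = S.w y) (hu : Continuous S.u)
    (G : GapCondition (fun n => E n - E 0) (fun n => waveNumber L (q n S.axis)) δ C) {κ v : ℝ}
    {ψ φ : WaveFun N d L} (hψ : ψ ∈ S.space) :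
    S.IsHamiltonian κ v ψ φ ↔ ∃ y, ψ = (diagonalFamily Ω G (S.potentialOp hu)
        (S.inner_potentialOp_left hu)).A y ∧
      φ = (diagonalFamily Ω G (S.potentialOp hu) (S.inner_potentialOp_left hu)).ham (E 0) κ v y := by
  set D := diagonalFamily Ω G (S.potentialOp hu) (S.inner_potentialOp_left hu) with hD
  have hcoe (y : S.space) : (D.ham (E 0) κ v y : WaveFun N d L) =
      ((y + (E 0 : ℂ) • D.A y - inner ℂ D.e y • D.e : S.space) : WaveFun N d L) +
        (κ : ℂ) • mulOp (realC S.U (S.continuous_U hu)) (D.A y : WaveFun N d L) -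
        (v : ℂ) • (D.Q y : WaveFun N d L) := rfl
  rw [S.isHamiltonian_iff_add hw hu]
  constructor
  · rintro ⟨φ₀, π, hφ₀, hπ, rfl⟩
    have hmem := hφ₀.mem_space S hw hev hu hψ
    obtain ⟨y, hyA, hy⟩ := exists_eq_of_diag (U := S.potentialOp hu)
      (hU := S.inner_potentialOp_left hu) Ω G (E₀ := E 0) (x' := ⟨ψ, hψ⟩) (y' := ⟨φ₀, hmem⟩)
      (fun n => by
        have := h.inner_eq hm hw hu (ψ := ⟨ψ, hψ⟩) (φ := ⟨φ₀, hmem⟩) hφ₀ n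
        rw [this]
        push_cast
        ring)
    have hyA' : ψ = D.A y := congrArg Subtype.val hyA
    have hy' : φ₀ = ((y + (E 0 : ℂ) • D.A y - inner ℂ D.e y • D.e : S.space) : WaveFun N d L) :=
      congrArg Subtype.val hy
    refine ⟨y, hyA', ?_⟩
    have h2 : π = D.Q y := hπ.unique (by rw [hyA']; exact h.isMomentum_diag G y)
    rw [hcoe, ← hy', ← hyA', ← h2]
  · rintro ⟨y, rfl, rfl⟩
    refine ⟨_, _, ?_, h.isMomentum_diag G y, hcoe y⟩
    refine (h.isHamiltonian_iff hm hw hev hu).2 fun n => ?_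
    refine (inner_diagonalFamily_ham Ω G (E 0) y n).trans ?_
    push_cast
    rw [add_sub_cancel]

/-- The ground state energy in terms of the bounded operators of the perturbation problem. -/
theorem IsMomentumEigenbasis.energy_eq (h : S.IsMomentumEigenbasis Ω E q)
    (hm : 0 < S.m) (hw : Continuous S.w) (hev : ∀ y, S.w (-y) = S.w y) (hu : Continuous S.u)
    (G : GapCondition (fun n => E n - E 0) (fun n => waveNumber L (q n S.axis)) δ C) (κ v : ℝ) :
    S.energy κ v = sInf {r : ℝ | ∃ z, ‖(diagonalFamily Ω G (S.potentialOp hu)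
        (S.inner_potentialOp_left hu)).A z‖ = 1 ∧
      r = (inner ℂ ((diagonalFamily Ω G (S.potentialOp hu) (S.inner_potentialOp_left hu)).A z)
        ((diagonalFamily Ω G (S.potentialOp hu) (S.inner_potentialOp_left hu)).ham
          (E 0) κ v z)).re} := by
  refine congrArg sInf (Set.ext fun r => ⟨?_, ?_⟩)
  · rintro ⟨ψ, φ, hψ, h1, hH, rfl⟩
    obtain ⟨y, rfl, rfl⟩ := (h.isHamiltonian_iff_ham hm hw hev hu G hψ).1 hH
    exact ⟨y, h1, rfl⟩
  · rintro ⟨y, h1, rfl⟩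
    exact ⟨_, _, Subtype.coe_prop _, h1,
      (h.isHamiltonian_iff_ham hm hw hev hu G (Subtype.coe_prop _)).2 ⟨y, rfl, rfl⟩, rfl⟩

end Reduction

end System

/-! ### Expansion of the superfluid fraction -/

namespace System

section Expansion

variable {N d : ℕ} {L : ℝ} {S : System N d L} [hL : Fact (0 < L)]
  {Ω Ω' : HilbertBasis ℕ ℂ S.space} {E E' : ℕ → ℝ} {q : ℕ → Fin d → ℤ} {δ C : ℝ}

theorem inner_smul_right_space (x y : S.space) (c : ℂ) : inner ℂ x (c • y) = c * inner ℂ x y :=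
  inner_smul_right (x : WaveFun N d L) (y : WaveFun N d L) c

theorem inner_smul_left_space (x y : S.space) (c : ℂ) :
    inner ℂ (c • x) y = starRingEnd ℂ c * inner ℂ x y :=
  inner_smul_left (x : WaveFun N d L) (y : WaveFun N d L) c

theorem expansionTerm_zero (Ω : HilbertBasis ℕ ℂ S.space) (E : ℕ → ℝ) :
    S.expansionTerm Ω E 0 = 0 := by
  simp [expansionTerm]

/-- Two eigenbases are related by a unitary which commutes with `H₀`; hence the reduced resolvent is
diagonal in both. -/
theorem IsEigenbasis.inner_reducedResolvent (h : S.IsEigenbasis Ω E) (h' : S.IsEigenbasis Ω' E')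
    (hm : 0 < S.m) (hw : Continuous S.w) (hu : Continuous S.u) (hground : S.UniqueGroundState)
    {k : ℕ → ℝ} (G : GapCondition (fun n => E n - E 0) k δ C) {U hU} (z : S.space) (n : ℕ) :
    inner ℂ (Ω' n) ((diagonalFamily Ω G U hU).A z) =
      (reducedResolvent (fun n => E' n - E' 0) n : ℂ) * inner ℂ (Ω' n) z := by
  have hE0 : E 0 = E' 0 := h.ground.trans h'.ground.symm
  have h1 : (diagonalFamily Ω G U hU).A (Ω' n) =
      (reducedResolvent (fun n => E' n - E' 0) n : ℂ) • Ω' n := by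
    refine HilbertBasis.ext_inner Ω fun m => ?_
    rw [inner_diagonalFamily_A]
    rw [inner_smul_right_space]
    by_cases h0 : inner ℂ (Ω m) (Ω' n) = 0
    · rw [h0, mul_zero, mul_zero]
    have hE : E' n = E m := by
      have h2 := h.inner_eq hm hw hu (ψ := Ω' n) (φ := (E' n : ℂ) • Ω' n) (h'.eigen n) m
      have h3 := (inner_smul_right_space (Ω m) (Ω' n) (E' n : ℂ)).symm.trans h2
      exact_mod_cast mul_right_cancel₀ h0 h3
    have hmn : m = 0 ↔ n = 0 := by
      constructor
      · rintro rfl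
        by_contra hn
        have := h'.energy_lt hm hw hu hground hn
        linarith
      · rintro rfl
        by_contra hn
        have := h.energy_lt hm hw hu hground hn
        linarith
    simp only [reducedResolvent, hmn, hE, hE0]
  rw [← (diagonalFamily Ω G U hU).A_symm, h1, inner_smul_left_space, Complex.conj_ofReal]

/-- The second order coefficient of perturbation theory as a sum over an arbitrary eigenbasis. -/
theorem IsMomentumEigenbasis.hasSum_expansionTerm (h : S.IsMomentumEigenbasis Ω E q)
    (h' : S.IsEigenbasis Ω' E') (hm : 0 < S.m) (hw : Continuous S.w)
    (hu : ContDiff ℝ 1 (fun y : Fin d → ℝ => S.u (fun μ => (y μ : AddCircle L))))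
    (hground : S.UniqueGroundState)
    (G : GapCondition (fun n => E n - E 0) (fun n => waveNumber L (q n S.axis)) δ C)
    {D : GroundFamily S.space} (hD : D = diagonalFamily Ω G (S.potentialOp (continuous_of_lift hu))
      (S.inner_potentialOp_left (continuous_of_lift hu))) :
    HasSum (S.expansionTerm Ω' E')
      (inner ℂ (D.Q (D.U D.e)) (D.A (D.Q (D.U D.e)))).re := by
  have huc := continuous_of_lift hu
  set g := S.forceState hu (Ω 0) with hg
  have hA (z : S.space) (n : ℕ) : inner ℂ (Ω' n) (D.A z) =
      (reducedResolvent (fun n => E' n - E' 0) n : ℂ) * inner ℂ (Ω' n) z := by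
    rw [hD]
    exact h.toIsEigenbasis.inner_reducedResolvent h' hm hw huc hground G z n
  have hforce (n : ℕ) := h.inner_forceState_eq_potentialOp hground hu n
  have hQ : D.Q (D.U D.e) = D.A ((-Complex.I) • g) := by
    subst hD
    refine HilbertBasis.ext_inner Ω fun n => ?_
    rw [inner_diagonalFamily_A, inner_diagonalFamily_Q]
    rw [inner_smul_right_space, hg, hforce]
    change _ * inner ℂ (Ω n) (S.potentialOp huc (Ω 0)) = _
    push_cast
    linear_combination (reducedResolvent (fun n => E n - E 0) n : ℂ) *
      (waveNumber L (q n S.axis) : ℂ) * inner ℂ (Ω n) (S.potentialOp huc (Ω 0)) * Complex.I_mul_I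
  obtain ⟨c, hc⟩ := h.toIsEigenbasis.eq_smul_ground hground (Ω' 0).2
    (by rw [h.ground, ← h'.ground]; exact h'.eigen 0)
  have hc' : Ω' 0 = c • Ω 0 := Subtype.ext hc
  have hc1 : ‖c‖ = 1 := by
    have h1 : ‖(Ω' 0 : WaveFun N d L)‖ = 1 := Ω'.orthonormal.1 0
    have h2 : ‖(Ω 0 : WaveFun N d L)‖ = 1 := Ω.orthonormal.1 0
    rw [hc, norm_smul, h2, mul_one] at h1
    exact h1
  have hg0 : inner ℂ (Ω' 0) g = 0 := by
    rw [hc', inner_smul_left_space, hg, hforce, h.momentum_zero hground]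
    simp [waveNumber]
  refine (hasSum_mul_norm_sq_inner Ω' (x := D.Q (D.U D.e))
    (t := reducedResolvent fun n => E' n - E' 0) (fun n => hA _ n)).congr_fun fun n => ?_
  rw [hQ, hA, inner_smul_right_space]
  by_cases hn : n = 0
  · rw [hn, expansionTerm_zero, hg0]
    simp
  have h2 : S.forceState hu (Ω' 0) = c • g := by
    refine Subtype.ext ?_
    change mulOp _ (Ω' 0 : WaveFun N d L) = c • mulOp _ (Ω 0 : WaveFun N d L)
    rw [hc, map_smul]
  have h4 := h'.energy_lt hm hw huc hground hn
  have h5 : E' n - E' 0 ≠ 0 := (sub_pos.2 h4).ne'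
  rw [expansionTerm, matrixElement_Ud hu, h2, inner_smul_right_space]
  simp only [reducedResolvent, hn, if_false, norm_mul, norm_neg, Complex.norm_I, hc1, one_mul,
    Complex.norm_real, mul_pow, Real.norm_eq_abs, sq_abs]
  field_simp

/-- Second order perturbation theory for the system: `v ↦ E(κ, v)` is analytic, and `c₂` has the
expansion `- s κ² + O(κ³)`, where `s` is the sum of the expansion terms over any eigenbasis. -/
theorem IsMomentumEigenbasis.analyticAt_and_isBigO (h : S.IsMomentumEigenbasis Ω E q)
    (hm : 0 < S.m) (hw : Continuous S.w) (hev : ∀ y, S.w (-y) = S.w y)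
    (hu : ContDiff ℝ 1 (fun y : Fin d → ℝ => S.u (fun μ => (y μ : AddCircle L))))
    (hground : S.UniqueGroundState) :
    (∀ᶠ κ in 𝓝 (0 : ℝ), AnalyticAt ℝ (S.energy κ) 0) ∧
    ∃ s : ℝ, (fun κ : ℝ => S.c₂ κ + κ ^ 2 * s) =O[𝓝 0] (fun κ : ℝ => κ ^ 3) ∧
      ∀ Ω' E', S.IsEigenbasis Ω' E' → HasSum (S.expansionTerm Ω' E') s := by
  have huc := continuous_of_lift hu
  obtain ⟨δ, C, G⟩ := h.exists_gapCondition hm hw hev huc hground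
  have h1 := (diagonalFamily Ω G (S.potentialOp huc) (S.inner_potentialOp_left huc)).analyticAt_and_isBigO
    (h.energy_eq hm hw hev huc G) S.energy_neg
  exact ⟨h1.1, _, h1.2, fun Ω' E' h' => h.hasSum_expansionTerm h' hm hw hu hground G rfl⟩

/-- The second order expansion of the superfluid fraction. -/
theorem superfluidFraction_isBigO {s : ℝ}
    (hs : (fun κ : ℝ => S.c₂ κ + κ ^ 2 * s) =O[𝓝 0] (fun κ : ℝ => κ ^ 3)) :
    (fun κ : ℝ => S.superfluidFraction κ - (1 - 2 * κ ^ 2 / (N * S.m) * s)) =O[𝓝 0]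
      fun κ : ℝ => κ ^ 3 := by
  refine (hs.const_mul_left (2 / (N * S.m))).congr_left fun κ => ?_
  rw [superfluidFraction]
  ring

theorem c₂_zero {s : ℝ}
    (hs : (fun κ : ℝ => S.c₂ κ + κ ^ 2 * s) =O[𝓝 0] (fun κ : ℝ => κ ^ 3)) : S.c₂ 0 = 0 := by
  obtain ⟨C, hC⟩ := hs.bound
  simpa using hC.self_of_nhds

theorem hasDerivAt_c₂ {s : ℝ}
    (hs : (fun κ : ℝ => S.c₂ κ + κ ^ 2 * s) =O[𝓝 0] (fun κ : ℝ => κ ^ 3)) :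
    HasDerivAt S.c₂ 0 0 := by
  have h1 : (fun κ : ℝ => κ ^ 3) =O[𝓝 0] (fun κ : ℝ => κ ^ 2) :=
    (isLittleO_pow_pow (by norm_num : 2 < 3)).isBigO
  have h2 : S.c₂ =O[𝓝 0] (fun κ : ℝ => κ ^ 2) := by
    refine ((hs.trans h1).sub (isBigO_const_mul_self s _ (𝓝 (0 : ℝ)))).congr_left fun κ => ?_
    ring
  rw [hasDerivAt_iff_isLittleO, c₂_zero hs]
  refine (h2.trans_isLittleO (isLittleO_pow_pow (by norm_num : 1 < 2))).congr
    (fun κ => by simp) (fun κ => by simp)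

end Expansion

end System

/-! ### The dynamic structure factor -/

/-- Integration against a weighted sum of point masses. -/
theorem integrable_and_hasSum_integral_sum_dirac {ι : Type*} [Countable ι] {c x : ι → ℝ} {f : ℝ → ℝ}
    (hc : ∀ i, 0 ≤ c i) (hs : Summable fun i => c i * |f (x i)|) :
    Integrable f (Measure.sum fun i => ENNReal.ofReal (c i) • Measure.dirac (x i)) ∧
      HasSum (fun i => c i * f (x i))
        (∫ ω, f ω ∂(Measure.sum fun i => ENNReal.ofReal (c i) • Measure.dirac (x i))) := by
  have h1 : Integrable f (Measure.sum fun i => ENNReal.ofReal (c i) • Measure.dirac (x i)) :=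
    integrable_sum_dirac (fun i => ENNReal.ofReal_ne_top)
      (hs.congr fun i => by rw [ENNReal.toReal_ofReal (hc i), Real.norm_eq_abs])
  refine ⟨h1, (hasSum_integral_measure h1).congr_fun fun i => ?_⟩
  rw [integral_smul_measure, integral_dirac, ENNReal.toReal_ofReal (hc i), smul_eq_mul]

namespace System

section StructureFactor

variable {N d : ℕ} {L : ℝ} {S : System N d L} [hL : Fact (0 < L)]
  {Ω : HilbertBasis ℕ ℂ S.space} {E : ℕ → ℝ} {q : ℕ → Fin d → ℤ}

/-- Bessel's inequality for `ρ_{-k} ω`. -/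
theorem summable_norm_sq_densityMode (Ω : HilbertBasis ℕ ℂ S.space) (k : Fin d → ℤ)
    (ω : S.space) :
    Summable fun l => ‖matrixElement (densityMode (-k)) (Ω l : WaveFun N d L)
      (ω : WaveFun N d L)‖ ^ 2 := by
  let g : S.space := ⟨mulOp (oneBody (waveC k)) (ω : WaveFun N d L),
    S.mulOp_mem_space (oneBody_perm _) ω.2⟩
  refine (hasSum_norm_sq_inner Ω g).summable.congr fun l => ?_
  rw [matrixElement_densityMode]
  rfl

/-- The moment `ω⁻³` of the dynamic structure factor is finite because of the gap, and the
contribution of one momentum to the expansion is the corresponding part of the sum. -/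
theorem IsMomentumEigenbasis.integrableOn_and_hasSum_fourierTerm (h : S.IsMomentumEigenbasis Ω E q)
    (hm : 0 < S.m) (hw : Continuous S.w) (hev : ∀ y, S.w (-y) = S.w y)
    (hu : ContDiff ℝ 1 (fun y : Fin d → ℝ => S.u (fun μ => (y μ : AddCircle L))))
    (hground : S.UniqueGroundState) (k : Fin d → ℤ) :
    IntegrableOn (fun ω : ℝ => 1 / ω ^ 3) (Set.Ioi 0) (S.structureFactor Ω E q k) ∧
      HasSum (fun l : {l : ℕ // q l = k} => S.expansionTerm Ω E l) (S.fourierTerm Ω E q k) := by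
  have huc := continuous_of_lift hu
  obtain ⟨δ, C, G⟩ := h.exists_gapCondition hm hw hev huc hground
  have hδ := G.gap_pos
  set c : {l : ℕ // q l = k} → ℝ := fun l => ‖matrixElement (densityMode (-k))
    (Ω l : WaveFun N d L) (Ω 0 : WaveFun N d L)‖ ^ 2 with hc
  let f : ℝ → ℝ := (Set.Ioi (0 : ℝ)).indicator fun ω => 1 / ω ^ 3
  have hcs : Summable c :=
    (summable_norm_sq_densityMode Ω k (Ω 0)).comp_injective Subtype.val_injective
  have hx (l : ℕ) : 0 ≤ f (E l - E 0) ∧ f (E l - E 0) = 1 / (E l - E 0) ^ 3 ∧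
      f (E l - E 0) ≤ 1 / δ ^ 3 := by
    by_cases hl : l = 0
    · subst hl
      have : 0 ≤ 1 / δ ^ 3 := by positivity
      simpa [f] using this
    · have h1 := G.gap l hl
      have h2 : 0 < E l - E 0 := hδ.trans_le h1
      have h3 : f (E l - E 0) = 1 / (E l - E 0) ^ 3 := Set.indicator_of_mem (Set.mem_Ioi.2 h2) _
      refine ⟨by rw [h3]; positivity, h3, ?_⟩
      rw [h3]
      gcongr
  have hs : Summable fun l : {l : ℕ // q l = k} => c l * |f (E l - E 0)| := by
    refine Summable.of_nonneg_of_le (fun l => by positivity) (fun l => ?_)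
      (hcs.mul_right (1 / δ ^ 3))
    rw [abs_of_nonneg (hx l).1]
    exact mul_le_mul_of_nonneg_left (hx l).2.2 (sq_nonneg _)
  obtain ⟨h1, h2⟩ := integrable_and_hasSum_integral_sum_dirac (c := c)
    (x := fun l : {l : ℕ // q l = k} => E l - E 0) (fun l => sq_nonneg _) hs
  change Integrable f (S.structureFactor Ω E q k) at h1
  change HasSum _ (∫ ω, f ω ∂(S.structureFactor Ω E q k)) at h2
  refine ⟨(integrable_indicator_iff measurableSet_Ioi).1 h1, ?_⟩
  rw [integral_indicator measurableSet_Ioi] at h2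
  rw [fourierTerm]
  refine (h2.mul_left _).congr_fun fun l => ?_
  have h3 := congrArg norm (h.inner_forceState hground hu l)
  rw [l.2, norm_mul, norm_mul, norm_mul, norm_mul, Complex.norm_I, one_mul, norm_pow,
    Complex.norm_real, Complex.norm_real, Real.norm_eq_abs, Real.norm_eq_abs,
    abs_of_pos hL.out] at h3
  have hLd : 0 < L ^ d := pow_pos hL.out d
  rw [expansionTerm, matrixElement_Ud hu, (hx l).2.1, hc]
  have h4 : ‖inner ℂ (Ω l) (S.forceState hu (Ω 0))‖ = |waveNumber L (k S.axis)| *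
      ‖fourierTransform S.u k‖ * ‖matrixElement (densityMode (-k))
        (Ω l : WaveFun N d L) (Ω 0 : WaveFun N d L)‖ / L ^ d := by
    rw [eq_div_iff hLd.ne', ← h3, mul_comm]
  rw [h4]
  simp only [div_pow, mul_pow, sq_abs]
  ring

/-- Sorting the expansion by momentum. -/
theorem IsMomentumEigenbasis.hasSum_fourierTerm (h : S.IsMomentumEigenbasis Ω E q)
    (hm : 0 < S.m) (hw : Continuous S.w) (hev : ∀ y, S.w (-y) = S.w y)
    (hu : ContDiff ℝ 1 (fun y : Fin d → ℝ => S.u (fun μ => (y μ : AddCircle L))))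
    (hground : S.UniqueGroundState) {s : ℝ} (hs : HasSum (S.expansionTerm Ω E) s) :
    HasSum (S.fourierTerm Ω E q) s :=
  HasSum.sigma ((Equiv.sigmaFiberEquiv q).hasSum_iff.2 hs) fun k =>
    (h.integrableOn_and_hasSum_fourierTerm hm hw hev hu hground k).2

end StructureFactor

end System

end Superfluid

end

theorem mainTheorem1 {N d : ℕ} {L : ℝ} [Fact (0 < L)] (S : Superfluid.System N d L)
    (hN : 0 < N) (hm : 0 < S.m)
    (hw : Continuous S.w) (hw_even : ∀ y, S.w (-y) = S.w y)
    (hu : ContDiff ℝ 1 (fun y : Fin d → ℝ => S.u (fun μ => (y μ : AddCircle L))))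
    (hground : S.UniqueGroundState) :
    (∀ᶠ κ in 𝓝 (0 : ℝ), AnalyticAt ℝ (S.energy κ) 0 ∧
      (fun v : ℝ => S.energy κ v - (S.energy κ 0 + S.c₂ κ * v ^ 2)) =O[𝓝 0]
        fun v : ℝ => v ^ 4) ∧
    (S.c₂ 0 = 0 ∧ HasDerivAt S.c₂ 0 0) ∧
    (∃ Ω E q, S.IsMomentumEigenbasis Ω E q) ∧
    (∀ Ω E, S.IsEigenbasis Ω E →
      Summable (fun n : ℕ => S.expansionTerm Ω E (n + 1)) ∧
      (fun κ : ℝ => S.superfluidFraction κ -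
          (1 - 2 * κ ^ 2 / (N * S.m) * ∑' n : ℕ, S.expansionTerm Ω E (n + 1))) =O[𝓝 0]
        fun κ : ℝ => κ ^ 3) ∧
    (∀ Ω E q, S.IsMomentumEigenbasis Ω E q →
      (∀ k, IntegrableOn (fun ω : ℝ => 1 / ω ^ 3) (Set.Ioi 0) (S.structureFactor Ω E q k)) ∧
      Summable (S.fourierTerm Ω E q) ∧
      ∑' n : ℕ, S.expansionTerm Ω E (n + 1) = ∑' k : Fin d → ℤ, S.fourierTerm Ω E q k ∧
      (fun κ : ℝ => S.superfluidFraction κ -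
          (1 - 2 * κ ^ 2 / (N * S.m) * ∑' k : Fin d → ℤ, S.fourierTerm Ω E q k)) =O[𝓝 0]
        fun κ : ℝ => κ ^ 3) := by
  have huc := Superfluid.continuous_of_lift hu
  obtain ⟨Ω₁, E₁, q₁, h₁⟩ := S.exists_isMomentumEigenbasis hN hm hw hw_even huc hground
  obtain ⟨hana, s, hs, hsum⟩ := h₁.analyticAt_and_isBigO hm hw hw_even hu hground
  have hsum' (Ω E) (h : S.IsEigenbasis Ω E) :
      HasSum (fun n : ℕ => S.expansionTerm Ω E (n + 1)) s := by
    have h2 := (hasSum_nat_add_iff' 1).2 (hsum Ω E h)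
    rwa [Finset.sum_range_one, Superfluid.System.expansionTerm_zero, sub_zero] at h2
  have hfrac := Superfluid.System.superfluidFraction_isBigO hs
  refine ⟨?_, ⟨Superfluid.System.c₂_zero hs, Superfluid.System.hasDerivAt_c₂ hs⟩,
    ⟨Ω₁, E₁, q₁, h₁⟩, fun Ω E h => ⟨(hsum' Ω E h).summable, ?_⟩, fun Ω E q h => ?_⟩
  · filter_upwards [hana] with κ hκ
    exact ⟨hκ, Superfluid.isBigO_of_analyticAt_of_even hκ (S.energy_neg κ)⟩
  · rw [(hsum' Ω E h).tsum_eq]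
    exact hfrac
  · have hF := h.hasSum_fourierTerm hm hw hw_even hu hground (hsum Ω E h.toIsEigenbasis)
    refine ⟨fun k => (h.integrableOn_and_hasSum_fourierTerm hm hw hw_even hu hground k).1,
      hF.summable, ?_, ?_⟩
    · rw [(hsum' Ω E h.toIsEigenbasis).tsum_eq, hF.tsum_eq]
    · rw [hF.tsum_eq]
      exact hfrac
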